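/- Let $\alpha\in(1,2)$, $\beta\in[-1,1]$, $A>0$, $K>0$ and $\gamma\ge 0$. Let $S_\alpha(1,\beta)$ be the probability law on $\mathbb{R}$ with characteristic function $t\mapsto \exp\{-|t|^\alpha(1-i\beta\,\mathrm{sign}(t)\tan\frac{\pi\alpha}{2})\}$, and for two laws $\mu,\nu$ on $\mathbb{R}$ with finite first moment let $d_W(\mu,\nu)=\sup_h|\int h\,d\mu-\int h\,d\nu|$, the supremum being over all $1$-Lipschitz $h:\mathbb{R}\to\mathbb{R}$. Let $X_1,X_2,\dots$ be independent, identically distributed real random variables on a common probability space such that the distribution function of $X_1$ is $$F(x)=1-\frac{A+\epsilon(x)}{|x|^\alpha}(1+\beta)\quad(x>0),\qquad F(x)=\frac{A+\epsilon(x)}{|x|^\alpha}(1-\beta)\quad(x<0),$$ where $\epsilon:\mathbb{R}\to\mathbb{R}$ is a bounded (measurable) function that tends to $0$ at $\pm\infty$ and satisfies $|\epsilon(x)|\le K|x|^{-\gamma}$ for all $x\ne0$. Put $$\sigma=\Big(A\alpha\int_{\mathbb{R}}\frac{1-\cos y}{|y|^{1+\alpha}}\,dy\Big)^{1/\alpha},\qquad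 S_n=\frac1\sigma n^{-1/\alpha}\big(X_1+\dots+X_n-n\,\mathbb{E}[X_1]\big).$$ Then $X_1$ and $S_\alpha(1,\beta)$ have finite first moments, and there is a constant $c>0$ depending only on $\alpha,\beta,\gamma,A,K$ (not on $n$, $\epsilon$, or the random variables) such that for all $n\ge1$ (for all $n\ge2$ if $\gamma=2-\alpha$) $$d_W(\mathcal{L}(S_n),S_\alpha(1,\beta))\le c\cdot\begin{cases} n^{1-\frac2\alpha}, & \gamma>2-\alpha,\\ n^{1-\frac2\alpha}\log n, & \gamma=2-\alpha,\\ n^{-\frac{(\alpha-1)\gamma}{\alpha(1-\gamma)}}, & 0<\gamma<2-\alpha,\\ n^{1-\frac2\alpha}\displaystyle\int_{-\sigma n^{1/\alpha}}^{\sigma n^{1/\alpha}}\frac{|\epsilon(x)|}{|x|^{\alpha-1}}\,dx+\Big(\sup_{|x|\ge\sigma n^{1/\alpha}}|\epsilon(x)|\Big)^{\alpha-1}, & \gamma=0.\end{cases}$$ -/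

import Mathlib

open MeasureTheory ProbabilityTheory Filter Topology
open scoped ENNReal NNReal

noncomputable section

/-- The Wasserstein distance `sup |∫ h dμ - ∫ h dν|` over all `1`-Lipschitz `h : ℝ → ℝ`, for two
laws `μ`, `ν` on `ℝ` with finite first moment (so that every such `h` is integrable). It takes
values in `[0, ∞]`, so a bound on it is a bound for every single `h`. -/
def wassersteinDist (μ ν : Measure ℝ) : ℝ≥0∞ :=
  ⨆ (h : ℝ → ℝ) (_ : LipschitzWith 1 h), ENNReal.ofReal |(∫ x, h x ∂μ) - ∫ x, h x ∂ν|

/-- `μ` is the `α`-stable law `S_α(σ, β)`: the probability measure on `ℝ` whose characteristic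
function is `exp (-σ^α |t|^α (1 - i β sign(t) tan(πα/2)))`. -/
structure IsStableLaw (α σ β : ℝ) (μ : Measure ℝ) : Prop where
  isProbabilityMeasure : IsProbabilityMeasure μ
  charFun_eq : ∀ t : ℝ, charFun μ t =
    Complex.exp (-((σ ^ α * |t| ^ α : ℝ) : ℂ) *
      (1 - Complex.I * ((β * Real.sign t * Real.tan (Real.pi * α / 2) : ℝ) : ℂ)))

/-- The law `μ` is in the domain of normal attraction of a stable law of exponent `α`, with
parameters `A`, `β` and tail correction `ε`: the function `ε` is bounded, vanishes at `±∞`, and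
the distribution function of `μ` is `1 - (1 + β) (A + ε x) / |x|^α` at `x > 0` and
`(1 - β) (A + ε x) / |x|^α` at `x < 0`. (Its value at `0` is determined by right continuity.) -/
structure InNormalAttraction (α β A : ℝ) (ε : ℝ → ℝ) (μ : Measure ℝ) : Prop where
  measurable : Measurable ε
  bounded : ∃ B : ℝ, ∀ x, |ε x| ≤ B
  tendsto_atTop : Tendsto ε atTop (𝓝 0)
  tendsto_atBot : Tendsto ε atBot (𝓝 0)
  cdf_pos : ∀ x : ℝ, 0 < x → cdf μ x = 1 - (A + ε x) / |x| ^ α * (1 + β)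
  cdf_neg : ∀ x : ℝ, x < 0 → cdf μ x = (A + ε x) / |x| ^ α * (1 - β)

/-- The normalizing constant `σ = (A α ∫_ℝ (1 - cos y) / |y|^(1+α) dy)^(1/α)`. -/
def stableScale (α A : ℝ) : ℝ :=
  (A * α * ∫ y : ℝ, (1 - Real.cos y) / |y| ^ (1 + α)) ^ (1 / α)

/-- `S_n = σ⁻¹ n^(-1/α) (X_1 + ⋯ + X_n - n E[X_1])`, where the sequence is indexed from `0`. -/
def normalizedSum {Ω : Type*} [MeasurableSpace Ω] (P : Measure Ω) (X : ℕ → Ω → ℝ)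
    (α A : ℝ) (n : ℕ) (ω : Ω) : ℝ :=
  1 / stableScale α A * (n : ℝ) ^ (-(1 / α)) *
    ((∑ i ∈ Finset.range n, X i ω) - n * ∫ ω', X 0 ω' ∂P)

end

noncomputable section

/-! The proof is a Lindeberg exchange in which the stable law itself does the smoothing. With `s =
n^(-1/α)` and `b = σ n^(1/α)`, the sum is a sum of `n` increments `(X_i - m)/b`, and by
self-similarity the stable law is a sum of `n` independent copies of `s Y`. The increments are
replaced one at a time. What matters is how far the two kinds of increment differ against a test
function `g` whose derivative `G` satisfies `|G(w+x) - G(w)| ≤ M min(|x|,1)`.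

Both have the same first-order effect: `n⁻¹` times the generator `∫ k(x) (G(w+x) - G(w)) dx`, where
`k` (`stableKernel`) is the signed tail of the Lévy measure. For the stable increment this is
`IsStableLaw.abs_integral_sub_generator_le`, with error `O(M s²)`. It rests on Stein's identity `E[Y
f(Y)] = α ∫ k(x) E[f(Y+x) - f(Y)] dx`, obtained by Fourier inversion from the first-order
Lévy-Khintchine formula `integral_stableKernel_char`; the constant in that formula is computed by
analytic continuation of a Laplace-type integral (`laplaceKernel_eq`). For the increment of the sum,
Taylor's formula integrated against the tails (`integral_taylor_eq`) gives the same expression with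
the actual tail in place of `k`. The two tails differ only through `ε`, so the error is `O(M Q / n)`
with `Q` the weighted average `tailDiscrepancy` of `ε(b·)`. Centering shifts by `O(s)` and costs
`O(M s²)` more (`one_step_smooth`).

When `j` stable increments are still present, they smooth a `C¹` function at scale `(j/n)^(1/α)`, so
that `M = O((n/j)^(1/α))` by `IsStableLaw.isSmoothTest_integral`. Since `1/α < 1`, the sum of
`(n/j)^(1/α)` over `j` is `O(n)`, and the total error is `O(n s² + Q) = O(n^(1-2/α) + Q)`; the
exchange with no smoothing left costs only `O(s)`, by the Lipschitz property
(`abs_integral_normalizedSum_sub_le`). The four rates are four estimates of `Q`. Uniformity in `ε`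
near the origin comes from the distribution function taking values in `[0,1]`. -/

/-! ### Integrals over the two half-lines, and the weight `min(|x|,1) |x|^(-α)`. -/

theorem integrable_of_integrableOn_Ioi_of_comp_neg {E : Type*} [NormedAddCommGroup E]
    {f : ℝ → E} (h1 : IntegrableOn f (Set.Ioi 0)) (h2 : IntegrableOn (fun x => f (-x)) (Set.Ioi 0)) :
    Integrable f := by
  have h3 : IntegrableOn f (Set.Iic 0) := by
    rw [← Measure.map_neg_eq_self (volume : Measure ℝ)]
    have m : MeasurableEmbedding fun x : ℝ => -x := (Homeomorph.neg ℝ).measurableEmbedding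
    rw [show (fun x : ℝ => -x) = Neg.neg from rfl] at m
    rw [m.integrableOn_map_iff]
    simpa [Function.comp_def, Set.neg_preimage, Set.neg_Iic] using
      (integrableOn_Ici_iff_integrableOn_Ioi).2 h2
  have := h3.union h1
  rwa [Set.Iic_union_Ioi, integrableOn_univ] at this

theorem integrable_comp_abs {f : ℝ → ℝ} (h : IntegrableOn f (Set.Ioi 0)) :
    Integrable (fun x => f |x|) := by
  have h1 : IntegrableOn (fun x => f |x|) (Set.Ioi 0) :=
    h.congr_fun (fun x hx => by simp [abs_of_pos (show (0:ℝ) < x from hx)]) measurableSet_Ioi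
  exact integrable_of_integrableOn_Ioi_of_comp_neg h1 (by simpa using h1)

/-- The integrable envelope of the Lévy-type kernels of index `α ∈ (1, 2)`. -/
def levyWeight (α x : ℝ) : ℝ := min |x| 1 * |x| ^ (-α)

theorem levyWeight_nonneg (α x : ℝ) : 0 ≤ levyWeight α x := by
  unfold levyWeight; positivity

theorem levyWeight_abs (α x : ℝ) : levyWeight α |x| = levyWeight α x := by
  simp [levyWeight]

theorem integrableOn_Ioc_rpow {s a : ℝ} (hs : -1 < s) (ha : 0 ≤ a) :
    IntegrableOn (fun x : ℝ => x ^ s) (Set.Ioc 0 a) :=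
  (intervalIntegrable_iff_integrableOn_Ioc_of_le ha).1 (intervalIntegral.intervalIntegrable_rpow' hs)

theorem integrable_levyWeight {α : ℝ} (h1 : 1 < α) (h2 : α < 2) : Integrable (levyWeight α) := by
  have h : IntegrableOn (levyWeight α) (Set.Ioi 0) := by
    rw [← Set.Ioc_union_Ioi_eq_Ioi zero_le_one]
    refine IntegrableOn.union ?_ ?_
    · refine (integrableOn_Ioc_rpow (s := 1 - α) (by linarith) zero_le_one).congr_fun ?_
        measurableSet_Ioc
      intro x hx
      simp only [levyWeight]
      rw [abs_of_pos hx.1, min_eq_left hx.2, sub_eq_add_neg, Real.rpow_add hx.1, Real.rpow_one]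
    · refine (integrableOn_Ioi_rpow_of_lt (a := -α) (by linarith) zero_lt_one).congr_fun ?_
        measurableSet_Ioi
      intro x hx
      have hx' : (1 : ℝ) < x := hx
      simp only [levyWeight]
      rw [abs_of_pos (by linarith), min_eq_right hx'.le, one_mul]
  have := integrable_comp_abs h
  simpa only [levyWeight_abs] using this

theorem levyWeight_of_pos {α x : ℝ} (hx : 0 < x) : levyWeight α x = min x 1 * x ^ (-α) := by
  simp [levyWeight, abs_of_pos hx]

/-! ### The Laplace-type kernel on the right half-plane and its boundary value. -/

/-- `∫_0^∞ (e^{-rx} - 1) x^{-α} dx`. -/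
def laplaceKernel (α : ℝ) (r : ℂ) : ℂ :=
  ∫ x in Set.Ioi (0 : ℝ), (Complex.exp (-(r * x)) - 1) * ((x ^ (-α) : ℝ) : ℂ)

theorem norm_exp_neg_sub_one_le {z : ℂ} (hz : 0 ≤ z.re) :
    ‖Complex.exp (-z) - 1‖ ≤ 2 * min ‖z‖ 1 := by
  have h2 : ‖Complex.exp (-z) - 1‖ ≤ 2 := by
    calc ‖Complex.exp (-z) - 1‖ ≤ ‖Complex.exp (-z)‖ + ‖(1:ℂ)‖ := norm_sub_le _ _
      _ ≤ 1 + 1 := by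
        gcongr
        · rw [Complex.norm_exp]; simpa using hz
        · simp
      _ = 2 := by norm_num
  rcases le_total ‖z‖ 1 with h | h
  · rw [min_eq_left h]
    have := Complex.norm_exp_sub_one_le (x := -z) (by simpa using h)
    simpa using this
  · rw [min_eq_right h]; linarith

theorem norm_laplace_integrand_le {α x : ℝ} {r : ℂ} (hr : 0 ≤ r.re) (hx : 0 < x) {R : ℝ}
    (hR : ‖r‖ ≤ R) (hR1 : 1 ≤ R) :
    ‖(Complex.exp (-(r * x)) - 1) * ((x ^ (-α) : ℝ) : ℂ)‖ ≤ 2 * R * levyWeight α x := by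
  rw [norm_mul, Complex.norm_real, Real.norm_of_nonneg (Real.rpow_nonneg hx.le _),
    levyWeight_of_pos hx, ← mul_assoc]
  have hp : 0 ≤ x ^ (-α) := Real.rpow_nonneg hx.le _
  refine mul_le_mul_of_nonneg_right ?_ hp
  refine (norm_exp_neg_sub_one_le (z := r * x) ?_).trans ?_
  · simp; positivity
  · rw [norm_mul, Complex.norm_real, Real.norm_of_nonneg hx.le, mul_assoc]
    gcongr
    rw [mul_min_of_nonneg _ _ (by linarith)]
    refine min_le_min (by gcongr) (by linarith)

theorem aestronglyMeasurable_laplace_integrand (α : ℝ) (r : ℂ) :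
    AEStronglyMeasurable (fun x : ℝ => (Complex.exp (-(r * x)) - 1) * ((x ^ (-α) : ℝ) : ℂ))
      (volume.restrict (Set.Ioi 0)) := by
  apply Measurable.aestronglyMeasurable
  fun_prop

theorem integrableOn_laplace_integrand {α : ℝ} (h1 : 1 < α) (h2 : α < 2) {r : ℂ} (hr : 0 ≤ r.re) :
    IntegrableOn (fun x : ℝ => (Complex.exp (-(r * x)) - 1) * ((x ^ (-α) : ℝ) : ℂ)) (Set.Ioi 0) := by
  refine Integrable.mono' ((integrable_levyWeight h1 h2).integrableOn.const_mul (2 * (‖r‖ + 1)))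
    (aestronglyMeasurable_laplace_integrand α r) ?_
  filter_upwards [ae_restrict_mem measurableSet_Ioi] with x hx
  exact norm_laplace_integrand_le hr hx (by linarith) (by linarith [norm_nonneg r])

/-- Dominated convergence works up to and including the imaginary axis, because only `|e^(-z) - 1| ≤
2 min(|z|,1)` is used. The value of interest lies on that axis. -/
theorem continuousOn_laplaceKernel {α : ℝ} (h1 : 1 < α) (h2 : α < 2) :
    ContinuousOn (laplaceKernel α) {r : ℂ | 0 ≤ r.re} := by
  intro r0 hr0
  unfold laplaceKernel
  refine tendsto_integral_filter_of_dominated_convergence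
    (fun x => 2 * (‖r0‖ + 1) * levyWeight α x) ?_ ?_ ?_ ?_
  · exact Eventually.of_forall fun r => aestronglyMeasurable_laplace_integrand α r
  · have : ∀ᶠ r in 𝓝[{r : ℂ | 0 ≤ r.re}] r0, ‖r‖ < ‖r0‖ + 1 :=
      (continuous_norm.continuousWithinAt (s := {r : ℂ | 0 ≤ r.re}) (x := r0)).eventually_lt_const
        (by linarith)
    filter_upwards [this, self_mem_nhdsWithin] with r hr hr'
    filter_upwards [ae_restrict_mem measurableSet_Ioi] with x hx
    exact norm_laplace_integrand_le hr' hx hr.le (by linarith [norm_nonneg r0])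
  · exact ((integrable_levyWeight h1 h2).integrableOn).const_mul _
  · refine Eventually.of_forall fun x => ?_
    apply ContinuousWithinAt.tendsto (f := fun r : ℂ => (Complex.exp (-(r * x)) - 1) * ((x ^ (-α) : ℝ) : ℂ))
    apply Continuous.continuousWithinAt
    fun_prop

/-- The differentiated integrand has size `x^(1-α) e^(-x Re r)`, which needs the exponential to be
integrable at infinity; hence the open half-plane only. -/
theorem differentiableAt_laplaceKernel {α : ℝ} (h1 : 1 < α) (h2 : α < 2) {r : ℂ} (hr : 0 < r.re) :
    DifferentiableAt ℂ (laplaceKernel α) r := by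
  have hs : {z : ℂ | r.re / 2 < z.re} ∈ 𝓝 r :=
    (isOpen_lt continuous_const Complex.continuous_re).mem_nhds (by simpa using hr)
  have key := hasDerivAt_integral_of_dominated_loc_of_deriv_le (μ := volume.restrict (Set.Ioi (0:ℝ)))
    (F := fun (r : ℂ) (x : ℝ) => (Complex.exp (-(r * x)) - 1) * ((x ^ (-α) : ℝ) : ℂ))
    (F' := fun (r : ℂ) (x : ℝ) => (Complex.exp (-(r * x)) * (-(x : ℂ))) * ((x ^ (-α) : ℝ) : ℂ))
    (bound := fun x => x ^ (1 - α) * Real.exp (-(r.re / 2) * x))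
    hs (Eventually.of_forall fun r => aestronglyMeasurable_laplace_integrand α r)
    (integrableOn_laplace_integrand h1 h2 hr.le) ?_ ?_ ?_ ?_
  · exact key.2.differentiableAt
  · apply Measurable.aestronglyMeasurable
    fun_prop
  · filter_upwards [ae_restrict_mem measurableSet_Ioi] with x hx z hz
    have hx' : 0 < x := hx
    have hz' : r.re / 2 < z.re := hz
    rw [norm_mul, norm_mul, norm_neg, Complex.norm_real, Complex.norm_real, Complex.norm_exp,
      Real.norm_of_nonneg hx'.le, Real.norm_of_nonneg (Real.rpow_nonneg hx'.le _),
      sub_eq_add_neg, Real.rpow_add hx', Real.rpow_one]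
    have : Real.exp ((-(z * x) : ℂ).re) ≤ Real.exp (-(r.re / 2) * x) := by
      apply Real.exp_le_exp.2
      simp
      nlinarith
    have hp : 0 ≤ x ^ (-α) := Real.rpow_nonneg hx'.le _
    calc _ ≤ Real.exp (-(r.re / 2) * x) * x * x ^ (-α) := by gcongr
      _ = _ := by ring
  · have := integrableOn_rpow_mul_exp_neg_mul_rpow (p := 1) (s := 1 - α) (b := r.re / 2)
      (by linarith) one_pos (by linarith)
    simpa [IntegrableOn] using this
  · refine Eventually.of_forall fun x z _ => ?_
    have : HasDerivAt (fun z : ℂ => -(z * (x:ℂ))) (-(x:ℂ)) z := by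
      have := ((hasDerivAt_id z).mul_const (x:ℂ)).neg
      rw [one_mul] at this
      exact this
    exact (this.cexp.sub_const 1).mul_const _

/-- Homogeneity of degree `α - 1`, by the substitution `x ↦ r x`. -/
theorem laplaceKernel_real_mul {α : ℝ} {r : ℝ} (hr : 0 < r) (z : ℂ) :
    laplaceKernel α (r * z) = laplaceKernel α z * ((r ^ (α - 1) : ℝ) : ℂ) := by
  unfold laplaceKernel
  have h := integral_comp_mul_left_Ioi
    (fun x : ℝ => (Complex.exp (-(z * x)) - 1) * ((x ^ (-α) : ℝ) : ℂ)) 0 hr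
  rw [mul_zero] at h
  have h' : ∫ x in Set.Ioi (0:ℝ), (Complex.exp (-((r * z) * x)) - 1) * ((x ^ (-α) : ℝ) : ℂ)
      = ((r ^ α : ℝ) : ℂ) * ∫ x in Set.Ioi (0:ℝ),
        (Complex.exp (-(z * ((r * x : ℝ):ℂ))) - 1) * (((r * x) ^ (-α) : ℝ) : ℂ) := by
    rw [← integral_const_mul]
    refine setIntegral_congr_fun measurableSet_Ioi fun x hx => ?_
    have hx' : 0 < x := hx
    rw [Real.mul_rpow hr.le hx'.le, Real.rpow_neg hr.le]
    have : ((r ^ α : ℝ) : ℂ) ≠ 0 := by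
      exact_mod_cast (Real.rpow_pos_of_pos hr α).ne'
    push_cast
    rw [show z * (r * x : ℂ) = r * z * x by ring]
    field_simp
  rw [h', h, sub_eq_add_neg α 1, Real.rpow_add hr, Real.rpow_neg_one]
  simp
  ring

theorem laplaceKernel_ofReal {α : ℝ} {r : ℝ} (hr : 0 < r) :
    laplaceKernel α r = laplaceKernel α 1 * ((r ^ (α - 1) : ℝ) : ℂ) := by
  simpa using laplaceKernel_real_mul (α := α) hr 1

theorem conj_laplaceKernel (α : ℝ) (r : ℂ) :
    (starRingEnd ℂ) (laplaceKernel α r) = laplaceKernel α ((starRingEnd ℂ) r) := by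
  unfold laplaceKernel
  rw [← integral_conj]
  congr 1 with x
  simp [← Complex.exp_conj]

/-- Both sides are analytic on the right half-plane and agree on the positive reals by homogeneity,
so the identity theorem applies. -/
theorem laplaceKernel_eq {α : ℝ} (h1 : 1 < α) (h2 : α < 2) {r : ℂ} (hr : 0 < r.re) :
    laplaceKernel α r = laplaceKernel α 1 * r ^ ((α : ℂ) - 1) := by
  have hopen : IsOpen {z : ℂ | 0 < z.re} := isOpen_lt continuous_const Complex.continuous_re
  have hA : AnalyticOnNhd ℂ (laplaceKernel α) {z : ℂ | 0 < z.re} :=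
    DifferentiableOn.analyticOnNhd
      (fun z hz => (differentiableAt_laplaceKernel h1 h2 hz).differentiableWithinAt) hopen
  have hB : AnalyticOnNhd ℂ (fun r : ℂ => laplaceKernel α 1 * r ^ ((α : ℂ) - 1))
      {z : ℂ | 0 < z.re} := by
    refine DifferentiableOn.analyticOnNhd (fun z hz => ?_) hopen
    refine DifferentiableAt.differentiableWithinAt ?_
    refine (differentiableAt_id.cpow_const (Or.inl hz)).const_mul _
  have hpc : IsPreconnected {z : ℂ | 0 < z.re} := (convex_halfSpace_re_gt 0).isPreconnected
  refine hA.eqOn_of_preconnected_of_frequently_eq hB hpc (z₀ := 1) (by simp) ?_ hr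
  -- A sequence of positive reals different from `1` and converging to `1`, which supplies the
  -- accumulation point.
  have hseq : Tendsto (fun n : ℕ => (((1 : ℝ) + 1 / ((n:ℝ) + 1) : ℝ) : ℂ)) atTop (𝓝[≠] 1) := by
    refine tendsto_nhdsWithin_iff.2 ⟨?_, Eventually.of_forall fun n => ?_⟩
    · have := (tendsto_one_div_add_atTop_nhds_zero_nat (𝕜 := ℝ)).const_add 1
      rw [add_zero] at this
      exact (Complex.continuous_ofReal.tendsto _).comp this
    · have : (0:ℝ) < 1 / ((n:ℝ) + 1) := by positivity
      intro h
      have h' : (1 : ℝ) + 1 / ((n:ℝ) + 1) = 1 := Complex.ofReal_injective (by simpa using h)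
      linarith
  refine hseq.frequently (Frequently.of_forall fun n => ?_)
  have hn : (0:ℝ) < (1 : ℝ) + 1 / ((n:ℝ) + 1) := by positivity
  rw [laplaceKernel_ofReal hn, Complex.ofReal_cpow hn.le]
  simp

/-- The formula passes to the boundary along `1/(n+1) - i`: the kernel is continuous on the closed
half-plane, and `-i` is off the branch cut of the power. -/
theorem laplaceKernel_neg_I {α : ℝ} (h1 : 1 < α) (h2 : α < 2) :
    laplaceKernel α (-Complex.I) = laplaceKernel α 1 * (-Complex.I) ^ ((α : ℂ) - 1) := by
  have hseq : Tendsto (fun n : ℕ => ((1 / ((n:ℝ) + 1) : ℝ) : ℂ) + -Complex.I) atTop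
      (𝓝[{r : ℂ | 0 ≤ r.re}] (-Complex.I)) := by
    refine tendsto_nhdsWithin_iff.2 ⟨?_, Eventually.of_forall fun n => ?_⟩
    · have := (Complex.continuous_ofReal.tendsto _).comp
        (tendsto_one_div_add_atTop_nhds_zero_nat (𝕜 := ℝ))
      simpa using this.add_const (-Complex.I)
    · have : (0:ℝ) < 1 / ((n:ℝ) + 1) := by positivity
      simp only [Set.mem_ofPred_eq, Complex.add_re, Complex.ofReal_re, Complex.neg_re, Complex.I_re]
      linarith
  have l1 := (continuousOn_laplaceKernel h1 h2 (-Complex.I) (by simp)).tendsto.comp hseq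
  have hc : ContinuousAt (fun r : ℂ => laplaceKernel α 1 * r ^ ((α : ℂ) - 1)) (-Complex.I) := by
    refine ContinuousAt.mul continuousAt_const ?_
    refine continuousAt_id.cpow continuousAt_const ?_
    simp [Complex.mem_slitPlane_iff]
  have l2 := hc.tendsto.comp (hseq.mono_right nhdsWithin_le_nhds)
  refine tendsto_nhds_unique l1 (l2.congr fun n => ?_)
  simp only [Function.comp]
  have : (0:ℝ) < 1 / ((n:ℝ) + 1) := by positivity
  refine (laplaceKernel_eq h1 h2 ?_).symm
  simpa only [Complex.add_re, Complex.ofReal_re, Complex.neg_re, Complex.I_re, neg_zero,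
    add_zero] using this

theorem neg_I_cpow (α : ℝ) : (-Complex.I) ^ ((α : ℂ) - 1) =
    ((Real.sin (Real.pi * α / 2) : ℝ) : ℂ) + ((Real.cos (Real.pi * α / 2) : ℝ) : ℂ) * Complex.I := by
  rw [Complex.cpow_def_of_ne_zero (by simp), Complex.log_neg_I]
  rw [show -(Real.pi / 2 : ℂ) * Complex.I * ((α : ℂ) - 1)
    = ((Real.pi / 2 - Real.pi * α / 2 : ℝ) : ℂ) * Complex.I by push_cast; ring]
  rw [Complex.exp_mul_I, ← Complex.ofReal_cos, ← Complex.ofReal_sin, Real.cos_pi_div_two_sub,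
    Real.sin_pi_div_two_sub]

/-! ### The cosine integral behind the normalizing constant. -/

/-- The constant `∫_ℝ (1 - cos y) / |y|^{1+α} dy`. -/
def cosIntegral (α : ℝ) : ℝ := ∫ y : ℝ, (1 - Real.cos y) / |y| ^ (1 + α)

theorem one_sub_cos_le {y : ℝ} : 1 - Real.cos y ≤ 2 * (y * min y 1) := by
  rcases le_total y 1 with h | h
  · rw [min_eq_left h]
    nlinarith [Real.one_sub_sq_div_two_le_cos (x := y)]
  · rw [min_eq_right h]
    nlinarith [Real.neg_one_le_cos y]

theorem one_sub_cos_div_le {α y : ℝ} (hy : 0 < y) :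
    (1 - Real.cos y) / |y| ^ (1 + α) ≤ 2 * levyWeight α y := by
  rw [levyWeight_of_pos hy, abs_of_pos hy, Real.rpow_add hy, Real.rpow_one, Real.rpow_neg hy.le]
  have hp := Real.rpow_pos_of_pos hy α
  rw [div_le_iff₀ (by positivity)]
  calc _ ≤ 2 * (y * min y 1) := one_sub_cos_le
    _ = _ := by field_simp

theorem one_sub_cos_div_nonneg (α y : ℝ) : 0 ≤ (1 - Real.cos y) / |y| ^ (1 + α) :=
  div_nonneg (by linarith [Real.cos_le_one y]) (by positivity)

theorem integrable_one_sub_cos_div {α : ℝ} (h1 : 1 < α) (h2 : α < 2) :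
    Integrable (fun y : ℝ => (1 - Real.cos y) / |y| ^ (1 + α)) := by
  refine Integrable.mono' ((integrable_levyWeight h1 h2).const_mul 2)
    (by apply Measurable.aestronglyMeasurable; fun_prop) ?_
  have h0 : ∀ᵐ y : ℝ, y ≠ 0 := Measure.ae_ne volume 0
  filter_upwards [h0] with y hy
  rw [Real.norm_of_nonneg (one_sub_cos_div_nonneg α y)]
  have := one_sub_cos_div_le (α := α) (abs_pos.2 hy)
  rwa [Real.cos_abs, abs_abs, levyWeight_abs] at this

theorem cosIntegral_pos {α : ℝ} (h1 : 1 < α) (h2 : α < 2) : 0 < cosIntegral α := by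
  unfold cosIntegral
  rw [integral_pos_iff_support_of_nonneg (one_sub_cos_div_nonneg α)
    (integrable_one_sub_cos_div h1 h2)]
  refine lt_of_lt_of_le ?_ (measure_mono (s := Set.Ioo (0:ℝ) 1) ?_)
  · simp
  · intro y hy
    have hc : Real.cos y < 1 := by
      have := Real.cos_lt_cos_of_nonneg_of_le_pi (x := 0) (y := y) le_rfl
        (by linarith [hy.2, Real.pi_gt_three]) hy.1
      simpa using this
    have : 0 < |y| ^ (1 + α) := Real.rpow_pos_of_pos (abs_pos.2 hy.1.ne') _
    exact (div_pos (by linarith) this).ne'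

theorem integrableOn_sin_mul_rpow {α : ℝ} (h1 : 1 < α) (h2 : α < 2) :
    IntegrableOn (fun y : ℝ => Real.sin y * y ^ (-α)) (Set.Ioi 0) := by
  refine Integrable.mono' (integrable_levyWeight h1 h2).integrableOn
    (by apply Measurable.aestronglyMeasurable; fun_prop) ?_
  filter_upwards [ae_restrict_mem measurableSet_Ioi] with y hy
  have hy' : 0 < y := hy
  have hp := Real.rpow_nonneg hy'.le (-α)
  rw [norm_mul, Real.norm_of_nonneg hp, levyWeight_of_pos hy']
  gcongr
  refine le_min ?_ (Real.abs_sin_le_one y)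
  simpa [abs_of_pos hy'] using Real.abs_sin_le_abs (x := y)

/-- Integration by parts with `1 - cos y` as primitive of `sin y`; the boundary terms are
`O(y^(2-α))` at `0` and `O(y^(-α))` at infinity. This links the imaginary part of the kernel at `-i`
to the constant in `σ`. -/
theorem two_mul_integral_sin_mul_rpow {α : ℝ} (h1 : 1 < α) (h2 : α < 2) :
    2 * ∫ y in Set.Ioi (0:ℝ), Real.sin y * y ^ (-α) = α * cosIntegral α := by
  have hJ : cosIntegral α = 2 * ∫ y in Set.Ioi (0:ℝ), (1 - Real.cos y) / y ^ (1 + α) := by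
    have := integral_comp_abs (f := fun y => (1 - Real.cos y) / y ^ (1 + α))
    simpa only [cosIntegral, Real.cos_abs] using this
  have hcv : ∀ y ∈ Set.Ioi (0:ℝ), (1 - Real.cos y) * (-α * y ^ (-α - 1))
      = -α * ((1 - Real.cos y) / y ^ (1 + α)) := by
    intro y hy
    have hy' : 0 < y := hy
    rw [show -α - 1 = -(1 + α) by ring, Real.rpow_neg hy'.le]
    ring
  have hi1 : IntegrableOn ((fun y => 1 - Real.cos y) * fun y => -α * y ^ (-α - 1)) (Set.Ioi 0) := by
    refine IntegrableOn.congr_fun (f := fun y => -α * ((1 - Real.cos y) / |y| ^ (1 + α)))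
      ((integrable_one_sub_cos_div h1 h2).integrableOn.const_mul _) ?_ measurableSet_Ioi
    intro y hy
    have := hcv y hy
    simp only [Pi.mul_apply]
    rw [this, abs_of_pos (show (0:ℝ) < y from hy)]
  have hz : Tendsto ((fun y => 1 - Real.cos y) * fun y : ℝ => y ^ (-α)) (𝓝[>] 0) (𝓝 0) := by
    have hb : Tendsto (fun y : ℝ => 2 * y ^ (2 - α)) (𝓝[>] 0) (𝓝 0) := by
      have : ContinuousAt (fun y : ℝ => 2 * y ^ (2 - α)) 0 :=
        continuousAt_const.mul (Real.continuousAt_rpow_const _ _ (Or.inr (by linarith)))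
      have h := this.tendsto
      rw [Real.zero_rpow (by linarith), mul_zero] at h
      exact h.mono_left nhdsWithin_le_nhds
    refine squeeze_zero' ?_ ?_ hb
    · filter_upwards [self_mem_nhdsWithin] with y hy
      exact mul_nonneg (by linarith [Real.cos_le_one y]) (Real.rpow_nonneg (le_of_lt hy) _)
    · filter_upwards [self_mem_nhdsWithin] with y hy
      have hy' : 0 < y := hy
      have hp := Real.rpow_nonneg hy'.le (-α)
      simp only [Pi.mul_apply]
      rw [sub_eq_add_neg 2 α, Real.rpow_add hy', Real.rpow_two]
      have := Real.one_sub_sq_div_two_le_cos (x := y)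
      nlinarith [sq_nonneg y]
  have hinf : Tendsto ((fun y => 1 - Real.cos y) * fun y : ℝ => y ^ (-α)) atTop (𝓝 0) := by
    have hb : Tendsto (fun y : ℝ => 2 * y ^ (-α)) atTop (𝓝 0) := by
      simpa using (tendsto_rpow_neg_atTop (by linarith : 0 < α)).const_mul 2
    refine squeeze_zero' ?_ ?_ hb
    · filter_upwards [eventually_gt_atTop 0] with y hy
      exact mul_nonneg (by linarith [Real.cos_le_one y]) (Real.rpow_nonneg hy.le _)
    · filter_upwards [eventually_gt_atTop 0] with y hy
      simp only [Pi.mul_apply]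
      have hp := Real.rpow_nonneg hy.le (-α)
      gcongr
      linarith [Real.neg_one_le_cos y]
  have key := integral_Ioi_mul_deriv_eq_deriv_mul (a := 0) (u := fun y => 1 - Real.cos y)
    (v := fun y : ℝ => y ^ (-α)) (u' := fun y => Real.sin y) (v' := fun y => -α * y ^ (-α - 1))
    (fun y _ => by simpa using (Real.hasDerivAt_cos y).const_sub 1)
    (fun y hy => Real.hasDerivAt_rpow_const (Or.inl (ne_of_gt hy)))
    hi1 (integrableOn_sin_mul_rpow h1 h2) hz hinf
  rw [setIntegral_congr_fun measurableSet_Ioi hcv, integral_const_mul] at key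
  rw [hJ]
  linarith

theorem cos_pi_mul_div_two_neg {α : ℝ} (h1 : 1 < α) (h2 : α < 2) :
    Real.cos (Real.pi * α / 2) < 0 := by
  have := Real.pi_pos
  exact Real.cos_neg_of_pi_div_two_lt_of_lt (by nlinarith) (by nlinarith)

/-! ### The Lévy-Khintchine formula for the derivative of the stable exponent. -/

/-- The first-order kernel of the generator of the standard stable process: the tail function of
its Lévy measure, with sign. -/
def stableKernel (α β x : ℝ) : ℝ :=
  (if 0 < x then 1 + β else -(1 - β)) * |x| ^ (-α) / (α * cosIntegral α)

/-- The derivative of the characteristic exponent of the stable law, where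
`θ = β tan (π α / 2)`. -/
def stableExponentDeriv (α θ t : ℝ) : ℂ :=
  -((α * |t| ^ (α - 1) : ℝ) : ℂ) * ((Real.sign t : ℝ) - Complex.I * θ)

theorem measurable_stableKernel (α β : ℝ) : Measurable (stableKernel α β) := by
  unfold stableKernel
  refine Measurable.div_const (Measurable.mul ?_ (by fun_prop)) _
  exact Measurable.ite measurableSet_Ioi measurable_const measurable_const

theorem abs_stableKernel_le {α β : ℝ} (h1 : 1 < α) (h2 : α < 2) (hβ : β ∈ Set.Icc (-1 : ℝ) 1)
    (x : ℝ) : |stableKernel α β x| ≤ 2 / (α * cosIntegral α) * |x| ^ (-α) := by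
  have hJ := cosIntegral_pos h1 h2
  have hp : 0 ≤ |x| ^ (-α) := by positivity
  unfold stableKernel
  rw [abs_div, abs_mul, abs_of_nonneg hp, abs_of_pos (by positivity : 0 < α * cosIntegral α),
    div_mul_eq_mul_div]
  gcongr
  split_ifs
  · rw [abs_le]; constructor <;> linarith [hβ.1, hβ.2]
  · rw [abs_le]; constructor <;> linarith [hβ.1, hβ.2]

/-- The value at `1` never has to be computed. It is a real number `v`, so the value at `-i` is `v
(sin(πα/2) + i cos(πα/2))`. Its imaginary part is the sine integral, which fixes `v`, and the ratio
of real to imaginary part is the tangent. -/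
theorem laplaceKernel_I {α : ℝ} (h1 : 1 < α) (h2 : α < 2) :
    laplaceKernel α (-Complex.I) = ((α * cosIntegral α / 2 : ℝ) : ℂ) *
      ((Real.tan (Real.pi * α / 2) : ℝ) + Complex.I) := by
  -- Conjugation commutes with the kernel, so a real argument gives a real value.
  obtain ⟨v, hv⟩ : ∃ v : ℝ, (v : ℂ) = laplaceKernel α 1 := by
    refine Complex.conj_eq_iff_real.1 ?_ |>.imp fun v hv => hv.symm
    rw [conj_laplaceKernel]; simp
  have hc := (cos_pi_mul_div_two_neg h1 h2).ne
  have hmain := laplaceKernel_neg_I h1 h2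
  rw [neg_I_cpow, ← hv] at hmain
  have him : (laplaceKernel α (-Complex.I)).im = α * cosIntegral α / 2 := by
    unfold laplaceKernel
    have := integral_im (𝕜 := ℂ) (integrableOn_laplace_integrand h1 h2 (r := -Complex.I) (by simp))
    have h2' : (∫ x in Set.Ioi (0:ℝ), (Complex.exp (-(-Complex.I * x)) - 1) *
        ((x ^ (-α) : ℝ) : ℂ)).im = ∫ x in Set.Ioi (0:ℝ),
        ((Complex.exp (-(-Complex.I * x)) - 1) * ((x ^ (-α) : ℝ) : ℂ)).im := this.symm
    rw [h2', ← two_mul_integral_sin_mul_rpow h1 h2, mul_div_cancel_left₀ _ two_ne_zero]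
    refine setIntegral_congr_fun measurableSet_Ioi fun x _ => ?_
    simp [Complex.exp_im]
  have him2 : α * cosIntegral α / 2 = v * Real.cos (Real.pi * α / 2) := by
    rw [← him, hmain]
    simp [Complex.mul_im, -Complex.ofReal_cos, -Complex.ofReal_sin]
  rw [hmain, him2, Real.tan_eq_sin_div_cos]
  have hc' : ((Real.cos (Real.pi * α / 2) : ℝ) : ℂ) ≠ 0 := by exact_mod_cast hc
  rw [Complex.ofReal_mul, Complex.ofReal_div]
  field_simp

theorem integrable_stableKernel_mul {α β : ℝ} (h1 : 1 < α) (h2 : α < 2)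
    (hβ : β ∈ Set.Icc (-1 : ℝ) 1) {E : Type*} [NormedAddCommGroup E] [NormedSpace ℝ E]
    {f : ℝ → E} (hf : AEStronglyMeasurable f) {C : ℝ} (hC : ∀ x, ‖f x‖ ≤ C * min |x| 1) :
    Integrable (fun x => stableKernel α β x • f x) := by
  refine Integrable.mono' ((integrable_levyWeight h1 h2).const_mul (2 / (α * cosIntegral α) * C))
    ((measurable_stableKernel α β).aestronglyMeasurable.smul hf) (ae_of_all _ fun x => ?_)
  rw [norm_smul, Real.norm_eq_abs, levyWeight]
  have hJ := cosIntegral_pos h1 h2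
  calc _ ≤ (2 / (α * cosIntegral α) * |x| ^ (-α)) * (C * min |x| 1) := by
        gcongr
        · exact abs_stableKernel_le h1 h2 hβ x
        · exact hC x
    _ = _ := by ring

theorem norm_exp_mul_I_sub_one_le (t x : ℝ) :
    ‖Complex.exp (t * x * Complex.I) - 1‖ ≤ 2 * (|t| + 1) * min |x| 1 := by
  have h := norm_exp_neg_sub_one_le (z := -(t * x * Complex.I)) (by simp)
  rw [neg_neg] at h
  refine h.trans (le_of_le_of_eq (mul_le_mul_of_nonneg_left ?_ zero_le_two)
    (mul_assoc _ _ _).symm)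
  rw [mul_min_of_nonneg _ _ (by positivity)]
  refine min_le_min ?_ (by linarith [abs_nonneg t])
  simp only [norm_neg, norm_mul, Complex.norm_real, Complex.norm_I, mul_one, Real.norm_eq_abs]
  gcongr; linarith

theorem integrable_stableKernel_char {α β : ℝ} (h1 : 1 < α) (h2 : α < 2)
    (hβ : β ∈ Set.Icc (-1 : ℝ) 1) (t : ℝ) :
    Integrable (fun x : ℝ => (stableKernel α β x : ℂ) * (Complex.exp (t * x * Complex.I) - 1)) := by
  have := integrable_stableKernel_mul h1 h2 hβ (f := fun x : ℝ => Complex.exp (t * x * Complex.I) - 1)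
    (Continuous.aestronglyMeasurable (by fun_prop)) (norm_exp_mul_I_sub_one_le t)
  simpa using this

theorem integral_stableKernel_char_eq {α β : ℝ} (h1 : 1 < α) (h2 : α < 2)
    (hβ : β ∈ Set.Icc (-1 : ℝ) 1) (t : ℝ) :
    ∫ x : ℝ, (stableKernel α β x : ℂ) * (Complex.exp (t * x * Complex.I) - 1) =
      ((1 + β : ℝ) * laplaceKernel α (-(t * Complex.I)) - (1 - β : ℝ) * laplaceKernel α (t * Complex.I))
        / (α * cosIntegral α : ℝ) := by
  have hint := integrable_stableKernel_char h1 h2 hβ t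
  have hneg := integral_comp_neg_Ioi 0 (fun x : ℝ => (stableKernel α β x : ℂ) *
      (Complex.exp (t * x * Complex.I) - 1))
  rw [neg_zero] at hneg
  rw [← integral_add_compl (measurableSet_Iic (a := 0)) hint, Set.compl_Iic, ← hneg, add_comm,
    sub_div]
  unfold laplaceKernel
  rw [sub_eq_add_neg]
  congr 1
  · rw [mul_div_assoc, mul_comm, div_mul_eq_mul_div, ← integral_mul_const, ← integral_div]
    refine setIntegral_congr_fun measurableSet_Ioi fun x hx => ?_
    have hx' : 0 < x := hx
    simp only [stableKernel, if_pos hx', abs_of_pos hx']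
    rw [show -(-(t * Complex.I) * (x:ℂ)) = t * x * Complex.I by ring]
    push_cast
    ring
  · rw [← neg_div, ← neg_mul, ← integral_const_mul, ← integral_div]
    refine setIntegral_congr_fun measurableSet_Ioi fun x hx => ?_
    have hx' : 0 < x := hx
    simp only [stableKernel, if_neg (by linarith : ¬ 0 < -x), abs_neg, abs_of_pos hx']
    rw [show -((t * Complex.I) * (x:ℂ)) = t * ((-x : ℝ):ℂ) * Complex.I by push_cast; ring]
    push_cast
    ring

/-- The Lévy-Khintchine formula of the stable law, in first-order form. -/
theorem integral_stableKernel_char {α β : ℝ} (h1 : 1 < α) (h2 : α < 2)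
    (hβ : β ∈ Set.Icc (-1 : ℝ) 1) (t : ℝ) :
    α * Complex.I * ∫ x : ℝ, (stableKernel α β x : ℂ) * (Complex.exp (t * x * Complex.I) - 1) =
      stableExponentDeriv α (β * Real.tan (Real.pi * α / 2)) t := by
  have hJ := cosIntegral_pos h1 h2
  have hα : α ≠ 0 := by linarith
  have hJ' : (cosIntegral α : ℂ) ≠ 0 := by exact_mod_cast hJ.ne'
  have hα' : (α : ℂ) ≠ 0 := by exact_mod_cast hα
  have hL := laplaceKernel_I h1 h2
  have hL' : laplaceKernel α Complex.I = ((α * cosIntegral α / 2 : ℝ) : ℂ) *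
      ((Real.tan (Real.pi * α / 2) : ℝ) - Complex.I) := by
    have := congrArg (starRingEnd ℂ) hL
    rw [conj_laplaceKernel] at this
    simpa [sub_eq_add_neg, -Complex.ofReal_tan, Complex.conj_ofNat] using this
  rw [integral_stableKernel_char_eq h1 h2 hβ]
  unfold stableExponentDeriv
  rcases lt_trichotomy t 0 with ht | rfl | ht
  · rw [Real.sign_of_neg ht, abs_of_neg ht,
      show -(t * Complex.I) = ((-t : ℝ) : ℂ) * Complex.I by push_cast; ring,
      show (t * Complex.I) = ((-t : ℝ) : ℂ) * (-Complex.I) by push_cast; ring,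
      laplaceKernel_real_mul (by linarith), laplaceKernel_real_mul (by linarith), hL, hL']
    push_cast
    field_simp
    ring_nf
    simp only [Complex.I_sq]
    ring
  · have h0 : laplaceKernel α 0 = 0 := by simp [laplaceKernel]
    simp [h0, Real.zero_rpow (by linarith : α - 1 ≠ 0)]
  · rw [Real.sign_of_pos ht, abs_of_pos ht,
      show -((t:ℂ) * Complex.I) = ((t : ℝ) : ℂ) * (-Complex.I) by ring,
      laplaceKernel_real_mul ht, laplaceKernel_real_mul ht, hL, hL']
    push_cast
    field_simp
    ring_nf
    simp only [Complex.I_sq]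
    ring

/-! ### Fourier transforms of functions that are differentiable off the origin. -/

/-- The Fourier transform `z ↦ ∫ e^{-iξz} f(ξ) dξ`. -/
def fourierInt (f : ℝ → ℂ) (z : ℝ) : ℂ := ∫ t : ℝ, Complex.exp (-(t * z * Complex.I)) * f t

theorem norm_exp_neg_mul_I (t z : ℝ) : ‖Complex.exp (-(t * z * Complex.I))‖ = 1 := by
  rw [Complex.norm_exp]; simp

theorem integrable_exp_mul {f : ℝ → ℂ} (hf : Integrable f) (z : ℝ) :
    Integrable (fun t : ℝ => Complex.exp (-(t * z * Complex.I)) * f t) := by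
  refine hf.norm.mono' ?_ (ae_of_all _ fun t => ?_)
  · exact (Continuous.aestronglyMeasurable (by fun_prop)).mul hf.aestronglyMeasurable
  · rw [norm_mul, norm_exp_neg_mul_I, one_mul]

theorem norm_fourierInt_le (f : ℝ → ℂ) (z : ℝ) : ‖fourierInt f z‖ ≤ ∫ t, ‖f t‖ := by
  refine (norm_integral_le_integral_norm _).trans_eq ?_
  congr 1 with t
  rw [norm_mul, norm_exp_neg_mul_I, one_mul]

theorem continuous_fourierInt {f : ℝ → ℂ} (hf : Integrable f) : Continuous (fourierInt f) := by
  refine continuous_of_dominated (bound := fun t => ‖f t‖)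
    (fun z => (integrable_exp_mul hf z).aestronglyMeasurable)
    (fun z => ae_of_all _ fun t => ?_) hf.norm (ae_of_all _ fun t => by fun_prop)
  rw [norm_mul, norm_exp_neg_mul_I, one_mul]

/-- The fundamental theorem on each half-line; the two values at `0` cancel by continuity. No
derivative at `0` is required, which accommodates the singularity `|t|^(α-2)` of the second
derivative of the stable characteristic function. -/
theorem integral_eq_zero_of_hasDerivAt_off_zero {g g' : ℝ → ℂ} (hg : Continuous g)
    (hd : ∀ t, t ≠ 0 → HasDerivAt g (g' t) t) (hi : Integrable g) (hi' : Integrable g') :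
    ∫ t, g' t = 0 := by
  have h1 := integral_Ioi_of_hasDerivAt_of_tendsto (a := 0) hg.continuousWithinAt
    (fun x hx => hd x (ne_of_gt hx)) hi'.integrableOn
    (tendsto_zero_of_hasDerivAt_of_integrableOn_Ioi (a := 0) (fun x hx => hd x (ne_of_gt hx))
      hi'.integrableOn hi.integrableOn)
  have h2 := integral_Iic_of_hasDerivAt_of_tendsto (a := 0) hg.continuousWithinAt
    (fun x hx => hd x (ne_of_lt hx)) hi'.integrableOn
    (tendsto_zero_of_hasDerivAt_of_integrableOn_Iic (a := -1)
      (fun x hx => hd x (ne_of_lt (lt_of_le_of_lt hx (by norm_num))))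
      hi'.integrableOn hi.integrableOn)
  rw [← integral_add_compl (measurableSet_Iic (a := 0)) hi', Set.compl_Iic, h1, h2]
  ring

theorem fourierInt_deriv {f f' : ℝ → ℂ} (hf : Continuous f)
    (hd : ∀ t, t ≠ 0 → HasDerivAt f (f' t) t) (hi : Integrable f) (hi' : Integrable f') (z : ℝ) :
    fourierInt f' z = Complex.I * z * fourierInt f z := by
  have hE : ∀ t : ℝ, HasDerivAt (fun t : ℝ => Complex.exp (-(t * z * Complex.I)))
      (Complex.exp (-(t * z * Complex.I)) * (-(z * Complex.I))) t := by
    intro t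
    have h := (((hasDerivAt_id (t:ℂ)).mul_const (z * Complex.I)).neg.cexp).comp_ofReal
    simp only [id, one_mul] at h
    convert h using 1
    · ext s; simp [mul_assoc]
    · simp [mul_assoc]
  have h := integral_eq_zero_of_hasDerivAt_off_zero
    (g := fun t => Complex.exp (-(t * z * Complex.I)) * f t)
    (g' := fun t => Complex.exp (-(t * z * Complex.I)) * (-(z * Complex.I)) * f t
      + Complex.exp (-(t * z * Complex.I)) * f' t) (by fun_prop)
    (fun t ht => (hE t).mul (hd t ht)) (integrable_exp_mul hi z) ?_
  · rw [integral_add] at h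
    · have e : ∀ t : ℝ, Complex.exp (-(t * z * Complex.I)) * (-(z * Complex.I)) * f t
        = -(z * Complex.I) * (Complex.exp (-(t * z * Complex.I)) * f t) := fun t => by ring
      simp only [e] at h
      rw [integral_const_mul] at h
      unfold fourierInt
      linear_combination h
    · refine ((integrable_exp_mul hi z).const_mul (-(z * Complex.I))).congr (ae_of_all _ fun t => ?_)
      simp only; ring
    · exact integrable_exp_mul hi' z
  · refine Integrable.add ?_ (integrable_exp_mul hi' z)
    refine ((integrable_exp_mul hi z).const_mul (-(z * Complex.I))).congr (ae_of_all _ fun t => ?_)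
    simp only; ring

/-- The transform of the second derivative is `-z²` times the transform; the two trivial bounds are
added. -/
theorem norm_fourierInt_decay {f f1 f2 : ℝ → ℂ} (hf : Continuous f) (hf1 : Continuous f1)
    (hd : ∀ t, t ≠ 0 → HasDerivAt f (f1 t) t) (hd1 : ∀ t, t ≠ 0 → HasDerivAt f1 (f2 t) t)
    (hi : Integrable f) (hi1 : Integrable f1) (hi2 : Integrable f2) (z : ℝ) :
    ‖fourierInt f z‖ ≤ ((∫ t, ‖f t‖) + ∫ t, ‖f2 t‖) * (1 + z ^ 2)⁻¹ := by
  have h : fourierInt f2 z = -(z ^ 2 : ℝ) * fourierInt f z := by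
    rw [fourierInt_deriv hf1 hd1 hi1 hi2, fourierInt_deriv hf hd hi hi1]
    push_cast
    linear_combination (z ^ 2 * fourierInt f z) * Complex.I_sq
  have h2 := norm_fourierInt_le f2 z
  rw [h, norm_mul, norm_neg, Complex.norm_real, Real.norm_of_nonneg (sq_nonneg z)] at h2
  have h1 := norm_fourierInt_le f z
  rw [← div_eq_mul_inv, le_div_iff₀ (by positivity)]
  linarith

/-! ### The stable characteristic function and its first two derivatives. -/

/-- The characteristic function of the stable law, with `θ = β tan (π α / 2)`. -/
def stableChar (α θ t : ℝ) : ℂ :=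
  Complex.exp (-((|t| ^ α : ℝ) : ℂ) * (1 - Complex.I * ((θ * Real.sign t : ℝ) : ℂ)))

/-- The second derivative of the characteristic exponent. -/
def stableExponentDeriv2 (α θ t : ℝ) : ℂ :=
  -((α * (α - 1) * |t| ^ (α - 2) * Real.sign t : ℝ) : ℂ) * ((Real.sign t : ℝ) - Complex.I * θ)

/-- The derivative of the characteristic function of the stable law. -/
def stableChar1 (α θ t : ℝ) : ℂ := stableChar α θ t * stableExponentDeriv α θ t

/-- The second derivative of the characteristic function of the stable law. -/
def stableChar2 (α θ t : ℝ) : ℂ :=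
  stableChar1 α θ t * stableExponentDeriv α θ t + stableChar α θ t * stableExponentDeriv2 α θ t

theorem norm_stableChar (α θ t : ℝ) : ‖stableChar α θ t‖ = Real.exp (-|t| ^ α) := by
  rw [stableChar, Complex.norm_exp]
  simp

theorem abs_sign_le_one (t : ℝ) : |Real.sign t| ≤ 1 := by
  rcases Real.sign_apply_eq t with h | h | h <;> simp [h]

theorem norm_sign_sub_le (θ t : ℝ) : ‖((Real.sign t : ℝ) : ℂ) - Complex.I * θ‖ ≤ 1 + |θ| := by
  refine (norm_sub_le _ _).trans ?_
  rw [Complex.norm_real, norm_mul, Complex.norm_I, one_mul, Complex.norm_real]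
  exact add_le_add (abs_sign_le_one t) le_rfl

theorem norm_stableExponentDeriv_le {α : ℝ} (h1 : 1 < α) (θ t : ℝ) :
    ‖stableExponentDeriv α θ t‖ ≤ α * (1 + |θ|) * |t| ^ (α - 1) := by
  rw [stableExponentDeriv, norm_mul, norm_neg, Complex.norm_real, Real.norm_of_nonneg (by positivity)]
  calc _ ≤ α * |t| ^ (α - 1) * (1 + |θ|) := by gcongr; exact norm_sign_sub_le θ t
    _ = _ := by ring

theorem norm_stableExponentDeriv2_le {α : ℝ} (h1 : 1 < α) (θ t : ℝ) :
    ‖stableExponentDeriv2 α θ t‖ ≤ α * (α - 1) * (1 + |θ|) * |t| ^ (α - 2) := by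
  have hp : 0 ≤ α * (α - 1) * |t| ^ (α - 2) :=
    mul_nonneg (mul_nonneg (by linarith) (by linarith)) (by positivity)
  rw [stableExponentDeriv2, norm_mul, norm_neg, Complex.norm_real, norm_mul, Real.norm_of_nonneg hp]
  calc _ ≤ α * (α - 1) * |t| ^ (α - 2) * 1 * (1 + |θ|) := by
        gcongr
        · exact abs_sign_le_one t
        · exact norm_sign_sub_le θ t
    _ = _ := by ring

theorem norm_stableChar1_le {α : ℝ} (h1 : 1 < α) (θ t : ℝ) :
    ‖stableChar1 α θ t‖ ≤ α * (1 + |θ|) * (|t| ^ (α - 1) * Real.exp (-|t| ^ α)) := by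
  rw [stableChar1, norm_mul, norm_stableChar]
  calc _ ≤ Real.exp (-|t| ^ α) * (α * (1 + |θ|) * |t| ^ (α - 1)) := by
        gcongr; exact norm_stableExponentDeriv_le h1 θ t
    _ = _ := by ring

theorem norm_stableChar2_le {α : ℝ} (h1 : 1 < α) (θ t : ℝ) :
    ‖stableChar2 α θ t‖ ≤
      (α * (1 + |θ|)) ^ 2 * (|t| ^ (α - 1) * |t| ^ (α - 1) * Real.exp (-|t| ^ α)) +
      α * (α - 1) * (1 + |θ|) * (|t| ^ (α - 2) * Real.exp (-|t| ^ α)) := by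
  rw [stableChar2]
  refine (norm_add_le _ _).trans (add_le_add ?_ ?_)
  · rw [norm_mul]
    calc _ ≤ (α * (1 + |θ|) * (|t| ^ (α - 1) * Real.exp (-|t| ^ α))) *
          (α * (1 + |θ|) * |t| ^ (α - 1)) := by
          gcongr
          · exact norm_stableChar1_le h1 θ t
          · exact norm_stableExponentDeriv_le h1 θ t
      _ = _ := by ring
  · rw [norm_mul, norm_stableChar]
    calc _ ≤ Real.exp (-|t| ^ α) * (α * (α - 1) * (1 + |θ|) * |t| ^ (α - 2)) := by
          gcongr; exact norm_stableExponentDeriv2_le h1 θ t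
      _ = _ := by ring

theorem hasDerivAt_abs_rpow_of_ne_zero (a : ℝ) {t : ℝ} (ht : t ≠ 0) :
    HasDerivAt (fun t : ℝ => |t| ^ a) (a * |t| ^ (a - 1) * Real.sign t) t := by
  rcases lt_or_gt_of_ne ht with h | h
  · rw [Real.sign_of_neg h]
    have h2 := (hasDerivAt_abs ht).rpow_const (p := a) (Or.inl (abs_ne_zero.2 ht))
    convert h2 using 1
    rw [_root_.sign_neg h]
    simp
  · rw [Real.sign_of_pos h]
    have h2 := (hasDerivAt_abs ht).rpow_const (p := a) (Or.inl (abs_ne_zero.2 ht))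
    convert h2 using 1
    rw [_root_.sign_pos h]
    simp

theorem hasDerivAt_sign {t : ℝ} (ht : t ≠ 0) : HasDerivAt Real.sign 0 t := by
  rcases lt_or_gt_of_ne ht with h | h
  · refine (hasDerivAt_const t (-1 : ℝ)).congr_of_eventuallyEq ?_
    filter_upwards [Iio_mem_nhds h] with s hs using Real.sign_of_neg hs
  · refine (hasDerivAt_const t (1 : ℝ)).congr_of_eventuallyEq ?_
    filter_upwards [Ioi_mem_nhds h] with s hs using Real.sign_of_pos hs

theorem sign_sq_eq_one {t : ℝ} (ht : t ≠ 0) : Real.sign t ^ 2 = 1 := by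
  rcases Real.sign_apply_eq_of_ne_zero t ht with h | h <;> simp [h]

theorem hasDerivAt_stableChar (α θ : ℝ) {t : ℝ} (ht : t ≠ 0) :
    HasDerivAt (stableChar α θ) (stableChar1 α θ t) t := by
  have h1 := (hasDerivAt_abs_rpow_of_ne_zero α ht).ofReal_comp
  have h2 := ((hasDerivAt_sign ht).const_mul θ).ofReal_comp
  have h3 := (h1.neg.mul ((h2.const_mul Complex.I).const_sub 1)).cexp
  refine HasDerivAt.congr_deriv (f := stableChar α θ) h3 ?_
  simp only [stableChar1, stableChar, Pi.mul_apply, Pi.neg_apply]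
  congr 1
  have hs : ((Real.sign t : ℝ) : ℂ) ^ 2 = 1 := by exact_mod_cast sign_sq_eq_one ht
  unfold stableExponentDeriv
  push_cast
  linear_combination (α * ((|t| ^ (α - 1) : ℝ) : ℂ) * Complex.I * θ) * hs

theorem hasDerivAt_stableExponentDeriv (α θ : ℝ) {t : ℝ} (ht : t ≠ 0) :
    HasDerivAt (stableExponentDeriv α θ) (stableExponentDeriv2 α θ t) t := by
  have h1 := ((hasDerivAt_abs_rpow_of_ne_zero (α - 1) ht).const_mul α).ofReal_comp
  have h2 := (hasDerivAt_sign ht).ofReal_comp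
  have h3 := h1.neg.mul (h2.sub_const (Complex.I * θ))
  refine HasDerivAt.congr_deriv (f := stableExponentDeriv α θ) h3 ?_
  simp only [stableExponentDeriv2, Pi.neg_apply]
  rw [show α - 1 - 1 = α - 2 by ring]
  push_cast
  ring

theorem hasDerivAt_stableChar1 (α θ : ℝ) {t : ℝ} (ht : t ≠ 0) :
    HasDerivAt (stableChar1 α θ) (stableChar2 α θ t) t :=
  (hasDerivAt_stableChar α θ ht).mul (hasDerivAt_stableExponentDeriv α θ ht)

theorem continuousAt_zero_of_norm_le_rpow {f : ℝ → ℂ} (hf0 : f 0 = 0) {C a : ℝ} (ha : 0 < a)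
    (h : ∀ t, ‖f t‖ ≤ C * |t| ^ a) : ContinuousAt f 0 := by
  have hc : Continuous fun t : ℝ => C * |t| ^ a :=
    continuous_const.mul (continuous_abs.rpow_const fun _ => Or.inr ha.le)
  have := hc.tendsto 0
  rw [abs_zero, Real.zero_rpow ha.ne', mul_zero] at this
  rw [ContinuousAt, hf0]
  exact squeeze_zero_norm h this

theorem continuous_stableChar {α : ℝ} (h1 : 1 < α) (θ : ℝ) : Continuous (stableChar α θ) := by
  refine continuous_iff_continuousAt.2 fun t => ?_
  rcases eq_or_ne t 0 with rfl | ht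
  · refine ContinuousAt.cexp (continuousAt_zero_of_norm_le_rpow (C := 1 + |θ|) (a := α) ?_ (by linarith)
      fun t => ?_)
    · simp [Real.zero_rpow (by linarith : α ≠ 0)]
    · rw [norm_mul, norm_neg, Complex.norm_real, Real.norm_of_nonneg (by positivity), mul_comm]
      gcongr
      refine (norm_sub_le _ _).trans ?_
      rw [norm_one, norm_mul, Complex.norm_I, one_mul, Complex.norm_real, norm_mul]
      have := mul_le_mul_of_nonneg_left (abs_sign_le_one t) (abs_nonneg θ)
      simpa using this
  · exact (hasDerivAt_stableChar α θ ht).continuousAt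

theorem continuous_stableExponentDeriv {α : ℝ} (h1 : 1 < α) (θ : ℝ) :
    Continuous (stableExponentDeriv α θ) := by
  refine continuous_iff_continuousAt.2 fun t => ?_
  rcases eq_or_ne t 0 with rfl | ht
  · refine continuousAt_zero_of_norm_le_rpow (a := α - 1) ?_ (by linarith)
      (norm_stableExponentDeriv_le h1 θ)
    simp [stableExponentDeriv, Real.zero_rpow (by linarith : α - 1 ≠ 0)]
  · exact (hasDerivAt_stableExponentDeriv α θ ht).continuousAt

theorem continuous_stableChar1 {α : ℝ} (h1 : 1 < α) (θ : ℝ) : Continuous (stableChar1 α θ) :=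
  (continuous_stableChar h1 θ).mul (continuous_stableExponentDeriv h1 θ)

theorem measurable_stableChar2 {α : ℝ} (h1 : 1 < α) (θ : ℝ) : Measurable (stableChar2 α θ) := by
  have hs : Measurable Real.sign := by
    unfold Real.sign
    exact Measurable.ite measurableSet_Iio measurable_const
      (Measurable.ite measurableSet_Ioi measurable_const measurable_const)
  have h2 : Measurable (stableExponentDeriv2 α θ) := by
    unfold stableExponentDeriv2
    fun_prop
  exact ((continuous_stableChar1 h1 θ).mul (continuous_stableExponentDeriv h1 θ)).measurable.add
    ((continuous_stableChar h1 θ).measurable.mul h2)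

theorem integrable_abs_rpow_mul_exp {α s : ℝ} (h1 : 1 < α) (hs : -1 < s) :
    Integrable (fun t : ℝ => |t| ^ s * Real.exp (-|t| ^ α)) :=
  integrable_comp_abs (integrableOn_rpow_mul_exp_neg_rpow hs (by linarith))

theorem integrable_stableChar {α : ℝ} (h1 : 1 < α) (θ : ℝ) : Integrable (stableChar α θ) := by
  refine (integrable_abs_rpow_mul_exp h1 (s := 0) (by norm_num)).mono'
    (continuous_stableChar h1 θ).aestronglyMeasurable (ae_of_all _ fun t => ?_)
  rw [norm_stableChar]; simp

theorem integrable_id_mul_stableChar {α : ℝ} (h1 : 1 < α) (θ : ℝ) :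
    Integrable (fun t : ℝ => t * stableChar α θ t) := by
  refine (integrable_abs_rpow_mul_exp h1 (s := 1) (by norm_num)).mono'
    (by have := continuous_stableChar h1 θ; exact Continuous.aestronglyMeasurable (by fun_prop))
    (ae_of_all _ fun t => ?_)
  rw [norm_mul, norm_stableChar]; simp

theorem integrable_stableChar1 {α : ℝ} (h1 : 1 < α) (θ : ℝ) : Integrable (stableChar1 α θ) :=
  ((integrable_abs_rpow_mul_exp h1 (s := α - 1) (by linarith)).const_mul _).mono'
    (continuous_stableChar1 h1 θ).aestronglyMeasurable (ae_of_all _ (norm_stableChar1_le h1 θ))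

theorem integrable_stableChar2 {α : ℝ} (h1 : 1 < α) (θ : ℝ) : Integrable (stableChar2 α θ) := by
  refine (((integrable_abs_rpow_mul_exp h1 (s := (α - 1) + (α - 1)) (by linarith)).const_mul
    ((α * (1 + |θ|)) ^ 2)).add
    ((integrable_abs_rpow_mul_exp h1 (s := α - 2) (by linarith)).const_mul
    (α * (α - 1) * (1 + |θ|)))).mono'
    (measurable_stableChar2 h1 θ).aestronglyMeasurable ?_
  filter_upwards [Measure.ae_ne volume (0 : ℝ)] with t ht
  refine (norm_stableChar2_le h1 θ t).trans_eq ?_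
  simp only [Pi.add_apply]
  rw [Real.rpow_add (abs_pos.2 ht)]

theorem integrable_id_mul_stableChar2 {α : ℝ} (h1 : 1 < α) (θ : ℝ) :
    Integrable (fun t : ℝ => t * stableChar2 α θ t) := by
  refine (((integrable_abs_rpow_mul_exp h1 (s := 1 + ((α - 1) + (α - 1))) (by linarith)).const_mul
    ((α * (1 + |θ|)) ^ 2)).add
    ((integrable_abs_rpow_mul_exp h1 (s := 1 + (α - 2)) (by linarith)).const_mul
    (α * (α - 1) * (1 + |θ|)))).mono'
    ((Complex.measurable_ofReal.mul (measurable_stableChar2 h1 θ)).aestronglyMeasurable) ?_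
  filter_upwards [Measure.ae_ne volume (0 : ℝ)] with t ht
  rw [norm_mul, Complex.norm_real, Real.norm_eq_abs]
  refine (mul_le_mul_of_nonneg_left (norm_stableChar2_le h1 θ t) (abs_nonneg t)).trans_eq ?_
  have ht' := abs_pos.2 ht
  simp only [Pi.add_apply]
  rw [Real.rpow_add ht', Real.rpow_add ht', Real.rpow_add ht', Real.rpow_one]
  ring

/-! ### Fourier inversion, the stable density, and its translations in `L¹`. -/

open scoped FourierTransform in
theorem fourierInt_inversion {f : ℝ → ℂ} (hf : Continuous f) (hi : Integrable f)
    (hF : Integrable (fourierInt f)) (t : ℝ) :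
    ∫ z : ℝ, Complex.exp (t * z * Complex.I) * fourierInt f z = 2 * Real.pi * f t := by
  have hpi : (0:ℝ) < 2 * Real.pi := by positivity
  have h𝓕 : (𝓕 f : ℝ → ℂ) = fun w => fourierInt f (2 * Real.pi * w) := by
    ext w
    rw [Real.fourier_eq']
    unfold fourierInt
    congr 1 with v
    simp only [smul_eq_mul]
    congr 2
    simp
    ring
  have hF' : Integrable (𝓕 f : ℝ → ℂ) := by
    rw [h𝓕]
    exact hF.comp_mul_left' hpi.ne'
  have hinv := congrFun (hf.fourierInv_fourier_eq hi hF') t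
  rw [Real.fourierInv_eq', h𝓕] at hinv
  have hs := Measure.integral_comp_mul_left
    (fun z : ℝ => Complex.exp (t * z * Complex.I) * fourierInt f z) (2 * Real.pi)
  rw [abs_of_pos (by positivity)] at hs
  have : ∫ v : ℝ, Complex.exp (((2 * Real.pi * inner ℝ v t : ℝ) : ℂ) * Complex.I) •
      fourierInt f (2 * Real.pi * v) = ∫ v : ℝ, Complex.exp (t * ((2 * Real.pi * v : ℝ) : ℂ) * Complex.I)
        * fourierInt f (2 * Real.pi * v) := by
    congr 1 with v
    simp only [smul_eq_mul]
    congr 2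
    simp
    ring
  rw [this, hs] at hinv
  rw [← hinv]
  have hpi' : (Real.pi : ℂ) ≠ 0 := by exact_mod_cast Real.pi_ne_zero
  rw [Complex.real_smul, ← mul_assoc]
  push_cast
  rw [mul_inv_cancel₀ (by simp [hpi']), one_mul]

/-- The density of the stable law with `θ = β tan (π α / 2)`. -/
def stableDensity (α θ z : ℝ) : ℝ := (fourierInt (stableChar α θ) z).re / (2 * Real.pi)

theorem continuous_stableDensity {α : ℝ} (h1 : 1 < α) (θ : ℝ) : Continuous (stableDensity α θ) :=
  (Complex.continuous_re.comp (continuous_fourierInt (integrable_stableChar h1 θ))).div_const _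

theorem norm_fourierInt_stableChar_le {α : ℝ} (h1 : 1 < α) (θ : ℝ) :
    ∃ C : ℝ, 0 ≤ C ∧ ∀ z, ‖fourierInt (stableChar α θ) z‖ ≤ C * (1 + z ^ 2)⁻¹ :=
  ⟨_, by positivity, norm_fourierInt_decay (continuous_stableChar h1 θ) (continuous_stableChar1 h1 θ)
    (fun _ => hasDerivAt_stableChar α θ) (fun _ => hasDerivAt_stableChar1 α θ)
    (integrable_stableChar h1 θ) (integrable_stableChar1 h1 θ) (integrable_stableChar2 h1 θ)⟩

theorem integrable_fourierInt_stableChar {α : ℝ} (h1 : 1 < α) (θ : ℝ) :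
    Integrable (fourierInt (stableChar α θ)) := by
  obtain ⟨C, -, hC⟩ := norm_fourierInt_stableChar_le h1 θ
  exact (integrable_inv_one_add_sq.const_mul C).mono'
    (continuous_fourierInt (integrable_stableChar h1 θ)).aestronglyMeasurable (ae_of_all _ hC)

theorem integrable_stableDensity {α : ℝ} (h1 : 1 < α) (θ : ℝ) :
    Integrable (stableDensity α θ) :=
  (integrable_fourierInt_stableChar h1 θ).re.div_const _

theorem norm_exp_mul_I_sub_one_le_abs (t x : ℝ) :
    ‖Complex.exp (t * x * Complex.I) - 1‖ ≤ |t| * |x| := by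
  have := Real.norm_exp_I_mul_ofReal_sub_one_le (x := t * x)
  rw [Complex.ofReal_mul, mul_comm] at this
  simpa [abs_mul] using this

theorem norm_exp_mul_I (t x : ℝ) : ‖Complex.exp (t * x * Complex.I)‖ = 1 := by
  rw [Complex.norm_exp]; simp

theorem fourierInt_sub_shift {f : ℝ → ℂ} (hf : Integrable f) (x z : ℝ) :
    fourierInt f (z - x) - fourierInt f z =
      fourierInt (fun t => (Complex.exp (t * x * Complex.I) - 1) * f t) z := by
  unfold fourierInt
  rw [← integral_sub (integrable_exp_mul hf _) (integrable_exp_mul hf _)]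
  congr 1 with t
  rw [show -((t:ℂ) * ((z - x : ℝ) : ℂ) * Complex.I)
    = -(t * z * Complex.I) + t * x * Complex.I by push_cast; ring, Complex.exp_add]
  ring

/-- The modulus of continuity of the Fourier transform of the stable characteristic function. -/
theorem norm_fourierInt_stableChar_shift_le {α : ℝ} (h1 : 1 < α) (θ : ℝ) :
    ∃ C : ℝ, 0 ≤ C ∧ ∀ x z : ℝ, |x| ≤ 1 →
      ‖fourierInt (stableChar α θ) (z - x) - fourierInt (stableChar α θ) z‖ ≤
        C * |x| * (1 + z ^ 2)⁻¹ := by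
  have i0 := integrable_stableChar h1 θ
  have i1 := integrable_stableChar1 h1 θ
  have i2 := integrable_stableChar2 h1 θ
  have j0 := integrable_id_mul_stableChar h1 θ
  have j2 := integrable_id_mul_stableChar2 h1 θ
  have c0 := continuous_stableChar h1 θ
  have c1 := continuous_stableChar1 h1 θ
  have m2 := measurable_stableChar2 h1 θ
  refine ⟨(∫ t : ℝ, ‖t * stableChar α θ t‖) + ∫ t : ℝ, (‖stableChar α θ t‖ +
    2 * ‖stableChar1 α θ t‖ + ‖t * stableChar2 α θ t‖), by positivity, fun x z hx => ?_⟩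
  have hE : ∀ t : ℝ, HasDerivAt (fun t : ℝ => Complex.exp (t * x * Complex.I))
      (Complex.exp (t * x * Complex.I) * (x * Complex.I)) t := by
    intro t
    have h := (((hasDerivAt_id (t:ℂ)).mul_const (x * Complex.I)).cexp).comp_ofReal
    simp only [id, one_mul] at h
    convert h using 1
    · ext s; simp [mul_assoc]
    · simp [mul_assoc]
  set E : ℝ → ℂ := fun t => Complex.exp (t * x * Complex.I) with hEdef
  have cE : Continuous E := by fun_prop
  have nE : ∀ t, ‖E t‖ = 1 := fun t => norm_exp_mul_I t x
  have nE1 : ∀ t, ‖E t - 1‖ ≤ |t| * |x| := fun t => norm_exp_mul_I_sub_one_le_abs t x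
  have nE2 : ∀ t, ‖E t - 1‖ ≤ 2 := fun t => by
    refine (norm_sub_le _ _).trans ?_
    rw [nE t, norm_one]; norm_num
  have iE0 : Integrable (fun t => (E t - 1) * stableChar α θ t) := by
    refine (i0.norm.const_mul 2).mono' (by fun_prop) (ae_of_all _ fun t => ?_)
    rw [norm_mul]; gcongr; exact nE2 t
  have iE1 : Integrable (fun t => E t * (x * Complex.I) * stableChar α θ t
      + (E t - 1) * stableChar1 α θ t) := by
    refine Integrable.add ?_ ?_
    · refine (i0.norm.const_mul |x|).mono' (by fun_prop) (ae_of_all _ fun t => ?_)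
      rw [norm_mul, norm_mul, nE t, norm_mul, Complex.norm_I, Complex.norm_real]; simp
    · refine (i1.norm.const_mul 2).mono' (by fun_prop) (ae_of_all _ fun t => ?_)
      rw [norm_mul]; gcongr; exact nE2 t
  -- Every term of the second derivative of `(e^(itx) - 1) φ(t)` carries a factor `|x|`: it comes
  -- either from differentiating the exponential or, when both derivatives fall on `φ`, from
  -- `|e^(itx) - 1| ≤ |t| |x|`. The term in `x²` is where `|x| ≤ 1` enters.
  have bnd2 : ∀ t : ℝ, ‖(E t * (x * Complex.I) * (x * Complex.I) * stableChar α θ t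
        + E t * (x * Complex.I) * stableChar1 α θ t)
      + (E t * (x * Complex.I) * stableChar1 α θ t + (E t - 1) * stableChar2 α θ t)‖ ≤
      |x| * (‖stableChar α θ t‖ + 2 * ‖stableChar1 α θ t‖ + ‖t * stableChar2 α θ t‖) := by
    intro t
    refine (norm_add_le _ _).trans ?_
    refine (add_le_add (norm_add_le _ _) (norm_add_le _ _)).trans ?_
    simp only [norm_mul, nE t, Complex.norm_I, Complex.norm_real, Real.norm_eq_abs, one_mul, mul_one]
    have e1 : |x| * |x| * ‖stableChar α θ t‖ ≤ |x| * ‖stableChar α θ t‖ := by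
      gcongr
      nlinarith [abs_nonneg x]
    have e2 : ‖E t - 1‖ * ‖stableChar2 α θ t‖ ≤ |t| * |x| * ‖stableChar2 α θ t‖ := by
      gcongr; exact nE1 t
    linarith
  have i3 : Integrable (fun t : ℝ => ‖stableChar α θ t‖ + 2 * ‖stableChar1 α θ t‖ +
      ‖t * stableChar2 α θ t‖) := (i0.norm.add (i1.norm.const_mul 2)).add j2.norm
  rw [fourierInt_sub_shift i0]
  refine (norm_fourierInt_decay (f1 := fun t => E t * (x * Complex.I) * stableChar α θ t
      + (E t - 1) * stableChar1 α θ t)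
    (f2 := fun t => (E t * (x * Complex.I) * (x * Complex.I) * stableChar α θ t
        + E t * (x * Complex.I) * stableChar1 α θ t)
      + (E t * (x * Complex.I) * stableChar1 α θ t + (E t - 1) * stableChar2 α θ t))
    (by fun_prop) (by fun_prop) (fun t ht => ((hE t).sub_const 1).mul (hasDerivAt_stableChar α θ ht))
    (fun t ht => (((hE t).mul_const (x * Complex.I)).mul (hasDerivAt_stableChar α θ ht)).add
      (((hE t).sub_const 1).mul (hasDerivAt_stableChar1 α θ ht)))
    iE0 iE1 ?_ z).trans ?_
  · exact (i3.const_mul |x|).mono' (Measurable.aestronglyMeasurable (by fun_prop)) (ae_of_all _ bnd2)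
  · gcongr
    rw [add_mul, ← integral_mul_const, ← integral_mul_const]
    refine add_le_add ?_ ?_
    · refine integral_mono iE0.norm (j0.norm.mul_const _) fun t => ?_
      have e : ‖(E t - 1) * stableChar α θ t‖ ≤ ‖t * stableChar α θ t‖ * |x| := by
        rw [norm_mul, norm_mul, Complex.norm_real, Real.norm_eq_abs]
        exact (mul_le_mul_of_nonneg_right (nE1 t) (norm_nonneg _)).trans_eq (by ring)
      exact e
    · refine integral_mono_of_nonneg (ae_of_all _ fun t => norm_nonneg _) (i3.mul_const _)
        (ae_of_all _ fun t => ?_)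
      simp only
      rw [mul_comm _ |x|]
      exact bnd2 t

theorem abs_stableDensity_shift_le_norm (α θ x z : ℝ) :
    |stableDensity α θ (z - x) - stableDensity α θ z| ≤
      ‖fourierInt (stableChar α θ) (z - x) - fourierInt (stableChar α θ) z‖ := by
  have hpi := Real.pi_gt_three
  unfold stableDensity
  rw [← sub_div, ← Complex.sub_re, abs_div, abs_of_pos (by positivity : 0 < 2 * Real.pi)]
  refine (div_le_self (abs_nonneg _) (by linarith)).trans (Complex.abs_re_le_norm _)

/-- Translations of the stable density are Lipschitz in total variation. -/
theorem integral_abs_stableDensity_shift_le {α : ℝ} (h1 : 1 < α) (θ : ℝ) :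
    ∃ C : ℝ, 0 ≤ C ∧ ∀ x : ℝ,
      ∫ z, |stableDensity α θ (z - x) - stableDensity α θ z| ≤ C * min |x| 1 := by
  obtain ⟨C, hC0, hC⟩ := norm_fourierInt_stableChar_shift_le h1 θ
  have ip := integrable_stableDensity h1 θ
  set A := ∫ z, |stableDensity α θ z| with hA
  have hA0 : 0 ≤ A := integral_nonneg fun _ => abs_nonneg _
  have ix : ∀ x, Integrable (fun z => |stableDensity α θ (z - x) - stableDensity α θ z|) :=
    fun x => ((ip.comp_sub_right x).sub ip).abs
  -- `C π` serves `|x| ≤ 1`, as `∫ (1+z²)⁻¹ dz = π`; `2 A`, twice the `L¹` norm, serves `|x| ≥ 1`.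
  refine ⟨C * Real.pi + 2 * A, by positivity, fun x => ?_⟩
  rcases le_total |x| 1 with hx | hx
  · rw [min_eq_left hx]
    calc _ ≤ ∫ z : ℝ, C * |x| * (1 + z ^ 2)⁻¹ := by
          refine integral_mono (ix x) (integrable_inv_one_add_sq.const_mul _) fun z => ?_
          exact (abs_stableDensity_shift_le_norm α θ x z).trans (hC x z hx)
      _ = C * Real.pi * |x| := by
          rw [integral_const_mul, integral_univ_inv_one_add_sq]; ring
      _ ≤ _ := by
          have := abs_nonneg x
          gcongr; linarith
  · rw [min_eq_right hx]
    calc _ ≤ ∫ z, (|stableDensity α θ (z - x)| + |stableDensity α θ z|) := by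
          refine integral_mono (ix x) ((ip.comp_sub_right x).abs.add ip.abs) fun z => ?_
          exact abs_sub _ _
      _ = 2 * A := by
          rw [integral_add (ip.comp_sub_right x).abs ip.abs,
            integral_sub_right_eq_self (fun z => |stableDensity α θ z|) x]
          ring
      _ ≤ _ := by
          have := Real.pi_pos
          nlinarith [mul_nonneg hC0 this.le]

/-- The density is defined as a real part, so inversion is applied to the transform and to its
conjugate. The second follows from the first at `-t`, since `φ(-t)` is the conjugate of `φ(t)`. -/
theorem integral_exp_mul_stableDensity {α : ℝ} (h1 : 1 < α) (θ t : ℝ) :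
    ∫ z : ℝ, Complex.exp (t * z * Complex.I) * (stableDensity α θ z : ℂ) = stableChar α θ t := by
  set F := fourierInt (stableChar α θ) with hF
  have iF : Integrable F := integrable_fourierInt_stableChar h1 θ
  have hpi : (Real.pi : ℂ) ≠ 0 := by exact_mod_cast Real.pi_ne_zero
  have inv : ∀ t : ℝ, ∫ z : ℝ, Complex.exp (t * z * Complex.I) * F z = 2 * Real.pi * stableChar α θ t :=
    fourierInt_inversion (continuous_stableChar h1 θ) (integrable_stableChar h1 θ) iF
  have hconjchar : (starRingEnd ℂ) (stableChar α θ (-t)) = stableChar α θ t := by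
    simp [stableChar, ← Complex.exp_conj, Real.sign_neg, sub_eq_add_neg]
  have inv2 : ∫ z : ℝ, Complex.exp (t * z * Complex.I) * (starRingEnd ℂ) (F z)
      = 2 * Real.pi * stableChar α θ t := by
    have h := congrArg (starRingEnd ℂ) (inv (-t))
    rw [← integral_conj, map_mul, hconjchar] at h
    simpa [← Complex.exp_conj, Complex.conj_ofNat] using h
  have ie : ∀ G : ℝ → ℂ, Integrable G → Integrable (fun z : ℝ => Complex.exp (t * z * Complex.I) * G z) := by
    intro G hG
    refine hG.norm.mono' ((Continuous.aestronglyMeasurable (by fun_prop)).mul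
      hG.aestronglyMeasurable) (ae_of_all _ fun z => ?_)
    rw [norm_mul, norm_exp_mul_I, one_mul]
  have iF' : Integrable (fun z => (starRingEnd ℂ) (F z)) := by
    refine iF.norm.mono' (Complex.continuous_conj.comp_aestronglyMeasurable iF.aestronglyMeasurable)
      (ae_of_all _ fun z => ?_)
    simp
  have e : ∀ z : ℝ, Complex.exp (t * z * Complex.I) * (stableDensity α θ z : ℂ)
      = (1 / (4 * Real.pi)) * (Complex.exp (t * z * Complex.I) * F z
        + Complex.exp (t * z * Complex.I) * (starRingEnd ℂ) (F z)) := by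
    intro z
    rw [← mul_add, Complex.add_conj]
    unfold stableDensity
    push_cast
    field_simp
    ring
  simp only [e]
  rw [integral_const_mul, integral_add (ie F iF) (ie _ iF'), inv, inv2]
  field_simp
  ring

/-! ### A stable law has the inverted density. -/

theorem charFun_withDensity_ofReal {p : ℝ → ℝ} (hm : Measurable p) (t : ℝ) :
    charFun (volume.withDensity fun z => ENNReal.ofReal (p z)) t =
      ∫ z : ℝ, Complex.exp (t * z * Complex.I) * ((max (p z) 0 : ℝ) : ℂ) := by
  rw [charFun_apply_real, integral_withDensity_eq_integral_toReal_smul (by fun_prop) (by simp)]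
  congr 1 with z
  rw [ENNReal.toReal_ofReal', Complex.real_smul, mul_comm]

theorem integrable_exp_mul_ofReal {p : ℝ → ℝ} (hp : Integrable p) (t : ℝ) :
    Integrable (fun z : ℝ => Complex.exp (t * z * Complex.I) * (p z : ℂ)) := by
  refine hp.norm.mono' ((Continuous.aestronglyMeasurable (by fun_prop)).mul
    hp.ofReal.aestronglyMeasurable) (ae_of_all _ fun z => ?_)
  rw [norm_mul, norm_exp_mul_I, one_mul, Complex.norm_real]

theorem isFiniteMeasure_withDensity_ofReal_of_integrable {p : ℝ → ℝ} (hp : Integrable p) :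
    IsFiniteMeasure (volume.withDensity fun z => ENNReal.ofReal (p z)) :=
  isFiniteMeasure_withDensity_ofReal hp.2

/-- A finite measure whose characteristic function is the Fourier transform of an integrable
function has that function as density, which is then nonnegative. -/
theorem eq_withDensity_of_charFun {ν : Measure ℝ} [IsFiniteMeasure ν] {p : ℝ → ℝ}
    (hm : Measurable p) (hp : Integrable p)
    (h : ∀ t : ℝ, charFun ν t = ∫ z : ℝ, Complex.exp (t * z * Complex.I) * (p z : ℂ)) :
    (∀ᵐ z, 0 ≤ p z) ∧ ν = volume.withDensity fun z => ENNReal.ofReal (p z) := by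
  set μ1 := volume.withDensity fun z => ENNReal.ofReal (p z) with hμ1
  set μ2 := volume.withDensity fun z => ENNReal.ofReal (-p z) with hμ2
  have f1 : IsFiniteMeasure μ1 := isFiniteMeasure_withDensity_ofReal_of_integrable hp
  have f2 : IsFiniteMeasure μ2 := isFiniteMeasure_withDensity_ofReal_of_integrable hp.neg
  -- The sign of `p` is not known beforehand, so the negative part is moved to the other side, where
  -- uniqueness of characteristic functions applies to finite measures. Evaluation on `{p < 0}`,
  -- which is null for `μ1`, then shows that `μ2` vanishes.
  have hsum : ν + μ2 = μ1 := by
    refine Measure.ext_of_charFun (funext fun t => ?_)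
    have hadd : charFun (ν + μ2) t = charFun ν t + charFun μ2 t := by
      simp only [charFun_apply_real]
      refine integral_add_measure ?_ ?_ <;>
      · refine (integrable_const (1:ℝ)).mono' (Continuous.aestronglyMeasurable (by fun_prop))
          (ae_of_all _ fun z => ?_)
        rw [norm_exp_mul_I]
    have i1 : Integrable (fun z => max (p z) 0) := hp.pos_part
    have i2 : Integrable (fun z => max (-p z) 0) := hp.neg_part
    rw [hadd, h t, hμ1, hμ2, charFun_withDensity_ofReal hm,
      charFun_withDensity_ofReal (p := fun z => -p z) hm.neg,
      ← integral_add (integrable_exp_mul_ofReal hp t) (integrable_exp_mul_ofReal i2 t)]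
    congr 1 with z
    rw [← mul_add, ← Complex.ofReal_add]
    congr 2
    rcases le_total (p z) 0 with h | h
    · rw [max_eq_left (by linarith), max_eq_right h]; ring
    · rw [max_eq_right (by linarith), max_eq_left h]; ring
  have hS : MeasurableSet {z | p z < 0} := measurableSet_lt hm measurable_const
  have h10 : μ1 {z | p z < 0} = 0 := by
    rw [hμ1, withDensity_apply _ hS]
    rw [setLIntegral_congr_fun hS (g := fun _ => 0)]
    · simp
    · intro z hz
      exact ENNReal.ofReal_of_nonpos (le_of_lt hz)
  have h20 : μ2 {z | p z < 0} = 0 := by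
    have : (ν + μ2) {z | p z < 0} = 0 := by rw [hsum, h10]
    rw [Measure.add_apply] at this
    exact (add_eq_zero.1 this).2
  have hpos : ∀ᵐ z, 0 ≤ p z := by
    rw [hμ2, withDensity_apply _ hS, setLIntegral_eq_zero_iff hS (by fun_prop)] at h20
    filter_upwards [h20] with z hz
    by_contra hneg
    have h0 := hz (not_le.1 hneg)
    have := ENNReal.ofReal_eq_zero.1 h0
    linarith [not_le.1 hneg]
  refine ⟨hpos, ?_⟩
  have h2z : μ2 = 0 := by
    rw [hμ2, withDensity_eq_zero_iff (by fun_prop)]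
    filter_upwards [hpos] with z hz
    exact ENNReal.ofReal_of_nonpos (by linarith)
  rw [← hsum, h2z, add_zero]

/-- The skewness parameter `β tan (π α / 2)` of the stable law. -/
def stableSkew (α β : ℝ) : ℝ := β * Real.tan (Real.pi * α / 2)

theorem IsStableLaw.charFun_eq_stableChar {α β : ℝ} {ν : Measure ℝ} (h : IsStableLaw α 1 β ν)
    (t : ℝ) : charFun ν t = stableChar α (stableSkew α β) t := by
  rw [h.charFun_eq, stableChar, stableSkew, Real.one_rpow, one_mul, mul_right_comm]

theorem IsStableLaw.eq_withDensity {α β : ℝ} (h1 : 1 < α) {ν : Measure ℝ}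
    (h : IsStableLaw α 1 β ν) :
    (∀ᵐ z, 0 ≤ stableDensity α (stableSkew α β) z) ∧
      ν = volume.withDensity fun z => ENNReal.ofReal (stableDensity α (stableSkew α β) z) := by
  have := h.isProbabilityMeasure
  refine eq_withDensity_of_charFun (continuous_stableDensity h1 _).measurable
    (integrable_stableDensity h1 _) fun t => ?_
  rw [h.charFun_eq_stableChar, integral_exp_mul_stableDensity h1]

theorem IsStableLaw.integral_eq {α β : ℝ} (h1 : 1 < α) {ν : Measure ℝ}
    (h : IsStableLaw α 1 β ν) (f : ℝ → ℝ) :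
    ∫ y, f y ∂ν = ∫ z, stableDensity α (stableSkew α β) z * f z := by
  obtain ⟨hpos, hν⟩ := h.eq_withDensity h1
  have hm := (continuous_stableDensity h1 (stableSkew α β)).measurable
  rw [hν, integral_withDensity_eq_integral_toReal_smul (by fun_prop) (by simp)]
  refine integral_congr_ae ?_
  filter_upwards [hpos] with z hz
  rw [ENNReal.toReal_ofReal hz, smul_eq_mul]

theorem IsStableLaw.integrable_iff {α β : ℝ} (h1 : 1 < α) {ν : Measure ℝ}
    (h : IsStableLaw α 1 β ν) (f : ℝ → ℝ) :
    Integrable f ν ↔ Integrable fun z => stableDensity α (stableSkew α β) z * f z := by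
  obtain ⟨hpos, hν⟩ := h.eq_withDensity h1
  have hm := (continuous_stableDensity h1 (stableSkew α β)).measurable
  rw [hν, integrable_withDensity_iff_integrable_smul' (by fun_prop) (by simp)]
  refine integrable_congr ?_
  filter_upwards [hpos] with z hz
  rw [ENNReal.toReal_ofReal hz, smul_eq_mul]

/-! ### Stein's equation and identity, the first moment, and smoothing. -/

/-- Integrating in `z` first leaves `|k(x)|` times an `L¹` translation norm, which is `O(min(|x|,1)
|x|^(-α))`. This licenses Fubini in Stein's identity and yields the first moment. -/
theorem stableDensity_integrable_stein {α β : ℝ} (h1 : 1 < α) (h2 : α < 2)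
    (hβ : β ∈ Set.Icc (-1 : ℝ) 1) (θ : ℝ) :
    Integrable (Function.uncurry fun z x : ℝ => stableKernel α β x *
      (stableDensity α θ (z - x) - stableDensity α θ z)) (volume.prod volume) := by
  obtain ⟨C, hC0, hC⟩ := integral_abs_stableDensity_shift_le h1 θ
  have ip := integrable_stableDensity h1 θ
  have cp := continuous_stableDensity h1 θ
  have mk := measurable_stableKernel α β
  have hmeas : AEStronglyMeasurable (Function.uncurry fun z x : ℝ => stableKernel α β x *
      (stableDensity α θ (z - x) - stableDensity α θ z)) (volume.prod volume) := by
    apply Measurable.aestronglyMeasurable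
    have := cp.measurable
    unfold Function.uncurry
    fun_prop
  rw [integrable_prod_iff' hmeas]
  refine ⟨ae_of_all _ fun x => ?_, ?_⟩
  · have : Integrable (fun z => stableDensity α θ (z - x) - stableDensity α θ z) :=
      (ip.comp_sub_right x).sub ip
    exact this.const_mul (stableKernel α β x)
  · have hk := integrable_stableKernel_mul h1 h2 hβ
      (f := fun x => ∫ z, |stableDensity α θ (z - x) - stableDensity α θ z|)
      ?_ (C := C) ?_
    · have hk' := hk.norm
      refine hk'.congr (ae_of_all _ fun x => ?_)
      have hn : 0 ≤ ∫ z, |stableDensity α θ (z - x) - stableDensity α θ z| :=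
        integral_nonneg fun _ => abs_nonneg _
      simp only [Function.uncurry, norm_mul, smul_eq_mul, Real.norm_eq_abs, abs_of_nonneg hn]
      rw [integral_const_mul]
    · have : StronglyMeasurable (Function.uncurry fun x z : ℝ =>
          |stableDensity α θ (z - x) - stableDensity α θ z|) :=
        Continuous.stronglyMeasurable (by unfold Function.uncurry; fun_prop)
      exact this.integral_prod_right.aestronglyMeasurable
    · intro x
      rw [Real.norm_of_nonneg (integral_nonneg fun _ => abs_nonneg _)]
      exact hC x

/-- The Stein equation for the stable density. -/
theorem mul_stableDensity_eq {α β : ℝ} (h1 : 1 < α) (h2 : α < 2) (hβ : β ∈ Set.Icc (-1 : ℝ) 1)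
    (z : ℝ) :
    z * stableDensity α (stableSkew α β) z = α * ∫ x, stableKernel α β x *
      (stableDensity α (stableSkew α β) (z - x) - stableDensity α (stableSkew α β) z) := by
  set θ := stableSkew α β with hθ
  set F := fourierInt (stableChar α θ) with hF
  have i0 := integrable_stableChar h1 θ
  have i1 := integrable_stableChar1 h1 θ
  have j0 := integrable_id_mul_stableChar h1 θ
  have hα : (α : ℂ) ≠ 0 := by exact_mod_cast (by linarith : α ≠ 0)
  have hlk : ∀ t : ℝ, stableChar1 α θ t = α * Complex.I *
      ∫ x : ℝ, stableChar α θ t * ((stableKernel α β x : ℂ) * (Complex.exp (t * x * Complex.I) - 1)) := by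
    intro t
    rw [integral_const_mul, stableChar1, hθ, stableSkew, ← integral_stableKernel_char h1 h2 hβ t]
    ring
  have hjoint : Integrable (Function.uncurry fun t x : ℝ => Complex.exp (-(t * z * Complex.I)) *
      (stableChar α θ t * ((stableKernel α β x : ℂ) * (Complex.exp (t * x * Complex.I) - 1))))
      (volume.prod volume) := by
    have hb := ((j0.norm.add i0.norm).const_mul (2 * (2 / (α * cosIntegral α)))).mul_prod
      (integrable_levyWeight h1 h2)
    refine hb.mono' ?_ (ae_of_all _ fun ⟨t, x⟩ => ?_)
    · apply Measurable.aestronglyMeasurable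
      have := (continuous_stableChar h1 θ).measurable
      have := measurable_stableKernel α β
      unfold Function.uncurry
      fun_prop
    · simp only [Function.uncurry, Pi.add_apply, norm_mul, norm_exp_neg_mul_I, one_mul,
        Complex.norm_real, Real.norm_eq_abs]
      have hJ := cosIntegral_pos h1 h2
      calc ‖stableChar α θ t‖ * (|stableKernel α β x| * ‖Complex.exp (t * x * Complex.I) - 1‖)
          ≤ ‖stableChar α θ t‖ * ((2 / (α * cosIntegral α) * |x| ^ (-α)) *
            (2 * (|t| + 1) * min |x| 1)) := by
            gcongr
            · exact abs_stableKernel_le h1 h2 hβ x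
            · exact norm_exp_mul_I_sub_one_le t x
        _ = _ := by unfold levyWeight; ring
  have hFsub : ∀ x : ℝ, ∫ t : ℝ, Complex.exp (-(t * z * Complex.I)) *
      (stableChar α θ t * ((stableKernel α β x : ℂ) * (Complex.exp (t * x * Complex.I) - 1)))
      = (stableKernel α β x : ℂ) * (F (z - x) - F z) := by
    intro x
    rw [hF, fourierInt_sub_shift i0, fourierInt, ← integral_const_mul]
    congr 1 with t
    ring
  -- The transform of `φ'` computed twice: as `i z F(z)`, and through `φ' = φ ψ'` with the
  -- Lévy-Khintchine formula for `ψ'`, where multiplication by `e^(itx)` becomes translation by `x`.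
  have key : Complex.I * z * F z = α * Complex.I *
      ∫ x : ℝ, (stableKernel α β x : ℂ) * (F (z - x) - F z) := by
    rw [hF, ← fourierInt_deriv (continuous_stableChar h1 θ)
      (fun _ => hasDerivAt_stableChar α θ) i0 i1, ← hF]
    simp only [← hFsub]
    rw [← integral_integral_swap hjoint, ← integral_const_mul]
    unfold fourierInt
    congr 1 with t
    rw [hlk t]
    simp only [integral_const_mul]
    ring
  have key2 : (z : ℂ) * F z = α * ∫ x : ℝ, (stableKernel α β x : ℂ) * (F (z - x) - F z) := by
    have := mul_left_cancel₀ Complex.I_ne_zero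
      (show Complex.I * (z * F z) = Complex.I * (α * ∫ x : ℝ, (stableKernel α β x : ℂ) *
        (F (z - x) - F z)) by rw [← mul_assoc, key]; ring)
    exact this
  have iK : Integrable (fun x : ℝ => (stableKernel α β x : ℂ) * (F (z - x) - F z)) := by
    have := hjoint.integral_prod_right
    simpa only [Function.uncurry, hFsub] using this
  have hre := congrArg Complex.re key2
  rw [Complex.re_ofReal_mul, Complex.re_ofReal_mul] at hre
  have hre2 : (∫ x : ℝ, (stableKernel α β x : ℂ) * (F (z - x) - F z)).re
      = ∫ x : ℝ, stableKernel α β x * ((F (z - x)).re - (F z).re) := by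
    have h := integral_re (𝕜 := ℂ) iK
    refine h.symm.trans ?_
    congr 1 with x
    simp
  rw [hre2] at hre
  unfold stableDensity
  rw [← hF, mul_div_assoc', hre, mul_div_assoc, ← integral_div]
  congr 2 with x
  ring

/-- The stable law of exponent `α > 1` has a finite first moment. -/
theorem IsStableLaw.integrable_id {α β : ℝ} (h1 : 1 < α) (h2 : α < 2)
    (hβ : β ∈ Set.Icc (-1 : ℝ) 1) {ν : Measure ℝ} (h : IsStableLaw α 1 β ν) :
    Integrable (fun x : ℝ => x) ν := by
  rw [h.integrable_iff h1]
  -- By Stein's equation `z p(z)` is a partial integral of a jointly integrable function. The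
  -- pointwise decay `O((1+z²)⁻¹)` alone would not give the first moment.
  have := (stableDensity_integrable_stein h1 h2 hβ (stableSkew α β)).integral_prod_left.const_mul α
  refine this.congr (ae_of_all _ fun z => ?_)
  simp only [Function.uncurry]
  rw [← mul_stableDensity_eq h1 h2 hβ, mul_comm]

/-- The Stein identity of the stable law. -/
theorem IsStableLaw.integral_mul_eq {α β : ℝ} (h1 : 1 < α) (h2 : α < 2)
    (hβ : β ∈ Set.Icc (-1 : ℝ) 1) {ν : Measure ℝ} (h : IsStableLaw α 1 β ν) {f : ℝ → ℝ}
    (hf : Continuous f) {B : ℝ} (hB : ∀ y, |f y| ≤ B) :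
    ∫ y, y * f y ∂ν = α * ∫ x, stableKernel α β x * ((∫ y, f (y + x) ∂ν) - ∫ y, f y ∂ν) := by
  set p := stableDensity α (stableSkew α β) with hp
  have cp : Continuous p := continuous_stableDensity h1 _
  have ip : Integrable p := integrable_stableDensity h1 _
  have hst := stableDensity_integrable_stein h1 h2 hβ (stableSkew α β)
  rw [← hp] at hst
  have hj : Integrable (Function.uncurry fun z x : ℝ => (stableKernel α β x *
      (p (z - x) - p z)) * f z) (volume.prod volume) := by
    refine hst.mul_bdd (c := B) (g := fun q : ℝ × ℝ => f q.1) ?_ (ae_of_all _ fun q => hB q.1)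
    exact Continuous.aestronglyMeasurable (by fun_prop)
  have ipf : ∀ x, Integrable (fun z => p z * f (z + x)) := fun x =>
    ip.mul_bdd (c := B) (Continuous.aestronglyMeasurable (by fun_prop)) (ae_of_all _ fun q => hB _)
  have ipf' : ∀ x, Integrable (fun z => p (z - x) * f z) := fun x => by
    have := (ipf x).comp_sub_right x
    simpa using this
  rw [h.integral_eq h1]
  have e1 : ∀ z, p z * (z * f z) = α * ∫ x, stableKernel α β x * (p (z - x) - p z) * f z := by
    intro z
    rw [integral_mul_const, ← mul_assoc α, ← mul_stableDensity_eq h1 h2 hβ, ← hp]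
    ring
  simp only [← hp, e1]
  rw [integral_const_mul, integral_integral_swap hj]
  congr 2 with x
  rw [h.integral_eq h1, h.integral_eq h1, ← hp]
  have e2 : ∫ z, p z * f (z + x) = ∫ z, p (z - x) * f z := by
    have := integral_sub_right_eq_self (μ := volume) (fun z => p z * f (z + x)) x
    simpa using this.symm
  have e3 := ipf 0
  simp only [add_zero] at e3
  rw [e2, ← integral_sub (ipf' x) e3, ← integral_const_mul]
  congr 1 with z
  ring

/-- Smoothing by the stable law. -/
theorem IsStableLaw.abs_integral_shift_sub_le {α β : ℝ} (h1 : 1 < α) :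
    ∃ C : ℝ, 0 ≤ C ∧ ∀ ν : Measure ℝ, IsStableLaw α 1 β ν → ∀ f : ℝ → ℝ, Continuous f →
      (∀ y, |f y| ≤ 1) → ∀ x : ℝ, |(∫ y, f (y + x) ∂ν) - ∫ y, f y ∂ν| ≤ C * |x| := by
  obtain ⟨C, hC0, hC⟩ := integral_abs_stableDensity_shift_le h1 (stableSkew α β)
  refine ⟨C, hC0, fun ν h f hf hB x => ?_⟩
  set p := stableDensity α (stableSkew α β) with hp
  have cp : Continuous p := continuous_stableDensity h1 _
  have ip : Integrable p := integrable_stableDensity h1 _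
  have ipf : ∀ x, Integrable (fun z => p z * f (z + x)) := fun x =>
    ip.mul_bdd (c := 1) (Continuous.aestronglyMeasurable (by fun_prop)) (ae_of_all _ fun q => hB _)
  have ipf' : ∀ x, Integrable (fun z => p (z - x) * f z) := fun x => by
    have := (ipf x).comp_sub_right x
    simpa using this
  have e3 := ipf 0
  simp only [add_zero] at e3
  have e2 : ∫ z, p z * f (z + x) = ∫ z, p (z - x) * f z := by
    have := integral_sub_right_eq_self (μ := volume) (fun z => p z * f (z + x)) x
    simpa using this.symm
  rw [h.integral_eq h1, h.integral_eq h1, ← hp, e2, ← integral_sub (ipf' x) e3]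
  calc _ ≤ ∫ z, |p (z - x) * f z - p z * f z| := abs_integral_le_integral_abs
    _ ≤ ∫ z, |p (z - x) - p z| := by
        have i1 : Integrable fun z => |p (z - x) * f z - p z * f z| := ((ipf' x).sub e3).abs
        have i2 : Integrable fun z => |p (z - x) - p z| := ((ip.comp_sub_right x).sub ip).abs
        refine integral_mono i1 i2 fun z => ?_
        simp only
        rw [← sub_mul, abs_mul]
        exact mul_le_of_le_one_right (abs_nonneg _) (hB z)
    _ ≤ C * min |x| 1 := hC x
    _ ≤ C * |x| := by gcongr; exact min_le_left _ _

/-! ### Smooth test functions. -/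

theorem abs_integral_le_of_abs_le {Ω : Type*} [MeasurableSpace Ω] {P : Measure Ω}
    {f b : Ω → ℝ} (hb : Integrable b P) (h : ∀ x, |f x| ≤ b x) : |∫ x, f x ∂P| ≤ ∫ x, b x ∂P := by
  rw [← Real.norm_eq_abs]
  exact norm_integral_le_of_norm_le hb (ae_of_all _ h)

theorem abs_integral_le_of_abs_le_const {Ω : Type*} [MeasurableSpace Ω] {P : Measure Ω}
    [IsProbabilityMeasure P] {f : Ω → ℝ} {C : ℝ} (h : ∀ x, |f x| ≤ C) : |∫ x, f x ∂P| ≤ C :=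
  (abs_integral_le_of_abs_le (integrable_const C) h).trans_eq (by simp)

/-- `g` has derivative `G`, bounded by one, with modulus of continuity `M * min |x| 1`. -/
structure IsSmoothTest (M : ℝ) (g G : ℝ → ℝ) : Prop where
  hasDerivAt : ∀ x, HasDerivAt g (G x) x
  abs_le_one : ∀ x, |G x| ≤ 1
  abs_sub_le : ∀ w x, |G (w + x) - G w| ≤ M * min |x| 1

theorem abs_sub_le_of_hasDerivAt {g G : ℝ → ℝ} (hd : ∀ x, HasDerivAt g (G x) x)
    (hb : ∀ x, |G x| ≤ 1) (x y : ℝ) : |g x - g y| ≤ |x - y| := by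
  have := convex_univ.norm_image_sub_le_of_norm_hasDerivWithin_le (f := g) (f' := G) (C := 1)
    (fun x _ => (hd x).hasDerivWithinAt) (fun x _ => hb x) (Set.mem_univ y) (Set.mem_univ x)
  simpa using this

theorem IsSmoothTest.nonneg {M : ℝ} {g G : ℝ → ℝ} (h : IsSmoothTest M g G) : 0 ≤ M := by
  have := h.abs_sub_le 0 1
  simp only [abs_one, min_self, mul_one] at this
  exact (abs_nonneg _).trans this

theorem IsSmoothTest.lipschitz {M : ℝ} {g G : ℝ → ℝ} (h : IsSmoothTest M g G) (x y : ℝ) :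
    |G x - G y| ≤ M * |x - y| := by
  have := h.abs_sub_le y (x - y)
  rw [add_sub_cancel] at this
  exact this.trans (mul_le_mul_of_nonneg_left (min_le_left _ _) h.nonneg)

theorem IsSmoothTest.continuous {M : ℝ} {g G : ℝ → ℝ} (h : IsSmoothTest M g G) :
    Continuous G := by
  have : LipschitzWith (Real.toNNReal M) G := LipschitzWith.of_dist_le_mul fun x y => by
    rw [Real.dist_eq, Real.dist_eq, Real.coe_toNNReal _ h.nonneg]
    exact h.lipschitz x y
  exact this.continuous

theorem continuous_of_hasDerivAt {g G : ℝ → ℝ} (hd : ∀ x, HasDerivAt g (G x) x) : Continuous g :=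
  continuous_iff_continuousAt.2 fun x => (hd x).continuousAt

/-- A `1`-Lipschitz function of an integrable random variable is integrable. -/
theorem integrable_comp_of_abs_sub_le {Ω : Type*} [MeasurableSpace Ω] {P : Measure Ω}
    [IsFiniteMeasure P] {g : ℝ → ℝ} (hg : ∀ x y, |g x - g y| ≤ |x - y|) {Y : Ω → ℝ}
    (hY : Integrable Y P) : Integrable (fun ω => g (Y ω)) P := by
  have hc : Continuous g := by
    have : LipschitzWith 1 g := LipschitzWith.of_dist_le_mul fun x y => by
      simpa [Real.dist_eq] using hg x y
    exact this.continuous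
  refine ((integrable_const |g 0|).add hY.abs).mono'
    (hc.comp_aestronglyMeasurable hY.aestronglyMeasurable) (ae_of_all _ fun ω => ?_)
  have := hg (Y ω) 0
  simp only [sub_zero] at this
  simp only [Pi.add_apply, Real.norm_eq_abs]
  have h2 := abs_sub_abs_le_abs_sub (g (Y ω)) (g 0)
  linarith

/-! ### The generator and the short-time expansion of the stable semigroup. -/

/-- The generator of the stable process, as a functional of the derivative of a function. -/
def stableGenerator (α β : ℝ) (G : ℝ → ℝ) (w : ℝ) : ℝ :=
  ∫ x, stableKernel α β x * (G (w + x) - G w)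

/-- The first absolute moment of the stable law. -/
def stableAbsMoment (α β : ℝ) : ℝ := ∫ z, stableDensity α (stableSkew α β) z * |z|

theorem IsStableLaw.integral_abs {α β : ℝ} (h1 : 1 < α) {ν : Measure ℝ}
    (h : IsStableLaw α 1 β ν) : ∫ y, |y| ∂ν = stableAbsMoment α β :=
  h.integral_eq h1 _

theorem stableKernel_mul {α β s : ℝ} (hs : 0 < s) (x : ℝ) :
    stableKernel α β (s * x) = s ^ (-α) * stableKernel α β x := by
  unfold stableKernel
  have : 0 < s * x ↔ 0 < x := by
    constructor
    · intro h; exact (mul_pos_iff_of_pos_left hs).1 h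
    · intro h; positivity
  rw [abs_mul, abs_of_pos hs, Real.mul_rpow hs.le (abs_nonneg x)]
  simp only [this]
  ring

theorem integral_stableKernel_mul_comp {α β s : ℝ} (hs : 0 < s) (D : ℝ → ℝ) :
    ∫ x, stableKernel α β x * D (s * x) = s ^ (α - 1) * ∫ x, stableKernel α β x * D x := by
  have h := Measure.integral_comp_mul_left (fun x => stableKernel α β x * D x) s
  have e : ∀ x, stableKernel α β x * D (s * x)
      = s ^ α * (stableKernel α β (s * x) * D (s * x)) := by
    intro x
    rw [stableKernel_mul hs, Real.rpow_neg hs.le]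
    have : s ^ α ≠ 0 := (Real.rpow_pos_of_pos hs α).ne'
    field_simp
  simp only [e]
  rw [integral_const_mul, h, Real.rpow_sub_one hs.ne', abs_of_pos (by positivity), smul_eq_mul]
  ring

theorem integral_levyWeight_scale {α a : ℝ} (ha : 0 < a) :
    ∫ x, min |x| a * |x| ^ (-α) = a ^ (2 - α) * ∫ x, levyWeight α x := by
  have h := Measure.integral_comp_mul_left (fun x => min |x| a * |x| ^ (-α)) a
  have e : ∀ x : ℝ, min |a * x| a * |a * x| ^ (-α) = a ^ (1 - α) * levyWeight α x := by
    intro x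
    rw [abs_mul, abs_of_pos ha, Real.mul_rpow ha.le (abs_nonneg x), sub_eq_add_neg,
      Real.rpow_add ha, Real.rpow_one, levyWeight]
    have : min (a * |x|) a = a * min |x| 1 := by
      rw [mul_min_of_nonneg _ _ ha.le, mul_one]
    rw [this]; ring
  simp only [e] at h
  rw [integral_const_mul, abs_of_pos (by positivity), smul_eq_mul] at h
  have h2 : ∫ x, min |x| a * |x| ^ (-α) = a * (a ^ (1 - α) * ∫ x, levyWeight α x) := by
    rw [h]; field_simp
  rw [h2, ← mul_assoc, show 2 - α = 1 + (1 - α) by ring, Real.rpow_add ha 1, Real.rpow_one]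

theorem integrable_min_mul_rpow {α a : ℝ} (h1 : 1 < α) (h2 : α < 2) (ha : 0 < a) :
    Integrable (fun x : ℝ => min |x| a * |x| ^ (-α)) := by
  refine ((integrable_levyWeight h1 h2).const_mul (a + 1)).mono'
    (Measurable.aestronglyMeasurable (by fun_prop)) (ae_of_all _ fun x => ?_)
  rw [Real.norm_of_nonneg (by positivity), levyWeight, ← mul_assoc]
  gcongr
  rw [mul_min_of_nonneg _ _ (by positivity)]
  refine min_le_min ?_ (by linarith)
  nlinarith [abs_nonneg x]

/-- Truncation at level `a` instead of `1` gains the factor `a^(2-α)`, by scaling of `min(|x|,a)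
|x|^(-α)`. -/
theorem abs_integral_stableKernel_le {α β : ℝ} (h1 : 1 < α) (h2 : α < 2)
    (hβ : β ∈ Set.Icc (-1 : ℝ) 1) {D : ℝ → ℝ} {C a : ℝ} (ha : 0 < a)
    (hD : ∀ x, |D x| ≤ C * min |x| a) :
    |∫ x, stableKernel α β x * D x| ≤
      2 / (α * cosIntegral α) * C * (a ^ (2 - α) * ∫ x, levyWeight α x) := by
  have hJ := cosIntegral_pos h1 h2
  rw [← integral_levyWeight_scale ha, ← integral_const_mul]
  refine abs_integral_le_of_abs_le ((integrable_min_mul_rpow h1 h2 ha).const_mul _) fun x => ?_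
  rw [abs_mul]
  calc _ ≤ (2 / (α * cosIntegral α) * |x| ^ (-α)) * (C * min |x| a) := by
        gcongr
        · exact abs_stableKernel_le h1 h2 hβ x
        · exact hD x
    _ = _ := by ring

theorem hasDerivAt_integral_stable {ν : Measure ℝ} [IsProbabilityMeasure ν]
    (hν : Integrable (fun y : ℝ => y) ν) {g G : ℝ → ℝ} (hd : ∀ x, HasDerivAt g (G x) x)
    (hb : ∀ x, |G x| ≤ 1) (hG : Continuous G) (w s : ℝ) :
    HasDerivAt (fun s => ∫ y, g (w + s * y) ∂ν) (∫ y, y * G (w + s * y) ∂ν) s := by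
  have hgc := continuous_of_hasDerivAt hd
  refine (hasDerivAt_integral_of_dominated_loc_of_deriv_le (μ := ν) (s := Set.univ)
    (F := fun s y => g (w + s * y)) (F' := fun s y => y * G (w + s * y)) (bound := fun y => |y|)
    univ_mem (Eventually.of_forall fun s => Continuous.aestronglyMeasurable (by fun_prop)) ?_
    (Continuous.aestronglyMeasurable (by fun_prop)) ?_ hν.abs ?_).2
  · exact integrable_comp_of_abs_sub_le (abs_sub_le_of_hasDerivAt hd hb)
      ((integrable_const w).add (hν.const_mul s))
  · refine ae_of_all _ fun y s _ => ?_
    rw [norm_mul, Real.norm_eq_abs, Real.norm_eq_abs]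
    exact mul_le_of_le_one_right (abs_nonneg y) (hb _)
  · refine ae_of_all _ fun y s _ => ?_
    have h1 : HasDerivAt (fun s : ℝ => w + s * y) y s := by
      simpa using ((hasDerivAt_id s).mul_const y).const_add w
    have := (hd (w + s * y)).comp s h1
    rw [mul_comm] at this
    exact this

/-- Short-time expansion of the stable semigroup. -/
theorem IsStableLaw.abs_integral_sub_generator_le {α β : ℝ} (h1 : 1 < α) (h2 : α < 2)
    (hβ : β ∈ Set.Icc (-1 : ℝ) 1) :
    ∃ C : ℝ, 0 ≤ C ∧ ∀ ν : Measure ℝ, IsStableLaw α 1 β ν → ∀ (M : ℝ) (g G : ℝ → ℝ),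
      IsSmoothTest M g G → ∀ w s : ℝ, 0 < s →
        |(∫ y, g (w + s * y) ∂ν) - g w - s ^ α * stableGenerator α β G w| ≤ C * M * s ^ 2 := by
  have hJ := cosIntegral_pos h1 h2
  set W := ∫ x, levyWeight α x with hW
  have hW0 : 0 ≤ W := integral_nonneg fun x => levyWeight_nonneg α x
  -- The constant is chosen before any stable law is given, so the sign of the moment integral is
  -- not yet available. The `+ 1` keeps the truncation level `c m` positive.
  set m := |stableAbsMoment α β| + 1 with hm
  have hm0 : 0 < m := by positivity
  refine ⟨α * (2 / (α * cosIntegral α) * 2 * (m ^ (2 - α) * W)), by positivity,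
    fun ν h M g G hT w S hS => ?_⟩
  have := h.isProbabilityMeasure
  have hid := h.integrable_id h1 h2 hβ
  have hM := hT.nonneg
  have hG := hT.continuous
  have hmν : ∫ y, |y| ∂ν ≤ m := by
    rw [h.integral_abs h1]
    linarith [le_abs_self (stableAbsMoment α β)]
  set L := stableGenerator α β G w with hL
  have hder : ∀ s : ℝ, HasDerivAt (fun s => (∫ y, g (w + s * y) ∂ν) - s ^ α * L)
      ((∫ y, y * G (w + s * y) ∂ν) - α * s ^ (α - 1) * L) s := fun s =>
    (hasDerivAt_integral_stable hid hT.hasDerivAt hT.abs_le_one hG w s).sub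
      ((Real.hasDerivAt_rpow_const (Or.inr h1.le)).mul_const L)
  -- The mean value theorem in the scale variable reduces the claim to a bound `O(M S)` for the
  -- derivative at one point `c < S`, where Stein's identity gives a generator averaged over `c Y`.
  obtain ⟨c, hc, hslope⟩ := exists_hasDerivAt_eq_slope
    (fun s => (∫ y, g (w + s * y) ∂ν) - s ^ α * L) _ hS
    (fun s _ => (hder s).continuousAt.continuousWithinAt) (fun s _ => hder s)
  have hc0 : 0 < c := hc.1
  have iG : ∀ v : ℝ, Integrable (fun y => G (v + c * y)) ν := fun v =>
    (integrable_const (1:ℝ)).mono' (Continuous.aestronglyMeasurable (by fun_prop))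
      (ae_of_all _ fun y => hT.abs_le_one _)
  -- Stein's identity, rescaled
  have hstein : ∫ y, y * G (w + c * y) ∂ν = α * c ^ (α - 1) * ∫ x, stableKernel α β x *
      ((∫ y, G (w + x + c * y) ∂ν) - ∫ y, G (w + c * y) ∂ν) := by
    rw [h.integral_mul_eq h1 h2 hβ (f := fun y => G (w + c * y)) (by fun_prop)
      (fun y => hT.abs_le_one _), mul_assoc α, ← integral_stableKernel_mul_comp hc0
      (fun x => (∫ y, G (w + x + c * y) ∂ν) - ∫ y, G (w + c * y) ∂ν)]
    congr 2 with x
    congr 3 with y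
    congr 1
    ring
  have bD1 : ∀ x, |(∫ y, G (w + x + c * y) ∂ν) - ∫ y, G (w + c * y) ∂ν| ≤ M * min |x| 1 := by
    intro x
    rw [← integral_sub (iG _) (iG _)]
    refine abs_integral_le_of_abs_le_const fun y => ?_
    rw [show w + x + c * y = w + c * y + x by ring]
    exact hT.abs_sub_le _ _
  have mD : Measurable fun x => (∫ y, G (w + x + c * y) ∂ν) := by
    have : StronglyMeasurable (Function.uncurry fun x y : ℝ => G (w + x + c * y)) :=
      Continuous.stronglyMeasurable (by unfold Function.uncurry; fun_prop)
    exact (this.integral_prod_right (ν := ν)).measurable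
  have iK1 : Integrable (fun x => stableKernel α β x *
      ((∫ y, G (w + x + c * y) ∂ν) - ∫ y, G (w + c * y) ∂ν)) :=
    integrable_stableKernel_mul h1 h2 hβ
      (Measurable.aestronglyMeasurable (mD.sub measurable_const)) (C := M) bD1
  have iK2 : Integrable (fun x => stableKernel α β x * (G (w + x) - G w)) :=
    integrable_stableKernel_mul h1 h2 hβ
      (Continuous.aestronglyMeasurable (by fun_prop)) (C := M) (hT.abs_sub_le w)
  -- The second difference is small for two reasons: each `x`-increment is at most `M |x|`, and each
  -- averaging over `c Y` moves `G` by at most `M c m`. The resulting truncation at `c m` turns the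
  -- prefactor `c^(α-1)` into `c`.
  have bE : ∀ x, |((∫ y, G (w + x + c * y) ∂ν) - ∫ y, G (w + c * y) ∂ν) - (G (w + x) - G w)| ≤
      2 * M * min |x| (c * m) := by
    intro x
    rw [mul_min_of_nonneg _ _ (by positivity)]
    refine le_min ?_ ?_
    · calc _ ≤ |(∫ y, G (w + x + c * y) ∂ν) - ∫ y, G (w + c * y) ∂ν| + |G (w + x) - G w| :=
            abs_sub _ _
        _ ≤ M * min |x| 1 + M * min |x| 1 := add_le_add (bD1 x) (hT.abs_sub_le w x)
        _ ≤ M * |x| + M * |x| := by gcongr <;> exact min_le_left _ _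
        _ = _ := by ring
    · have hsh : ∀ v : ℝ, |(∫ y, G (v + c * y) ∂ν) - G v| ≤ M * (c * m) := by
        intro v
        have e : (∫ y, G (v + c * y) ∂ν) - G v = ∫ y, (G (v + c * y) - G v) ∂ν := by
          rw [integral_sub (iG v) (integrable_const _)]; simp
        rw [e]
        refine (abs_integral_le_of_abs_le (hid.abs.const_mul (M * c)) fun y => ?_).trans ?_
        · have := hT.lipschitz (v + c * y) v
          rw [add_sub_cancel_left, abs_mul, abs_of_pos hc0, ← mul_assoc] at this
          exact this
        · rw [integral_const_mul, mul_assoc]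
          gcongr
      calc _ = |((∫ y, G (w + x + c * y) ∂ν) - G (w + x)) - ((∫ y, G (w + c * y) ∂ν) - G w)| := by
            congr 1; ring
        _ ≤ M * (c * m) + M * (c * m) := (abs_sub _ _).trans (add_le_add (hsh _) (hsh _))
        _ = _ := by ring
  have hdiff : (∫ y, y * G (w + c * y) ∂ν) - α * c ^ (α - 1) * L = α * c ^ (α - 1) *
      ∫ x, stableKernel α β x *
        (((∫ y, G (w + x + c * y) ∂ν) - ∫ y, G (w + c * y) ∂ν) - (G (w + x) - G w)) := by
    rw [hstein, hL, stableGenerator, ← mul_sub, ← integral_sub iK1 iK2]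
    congr 2 with x
    ring
  have hbound := abs_integral_stableKernel_le h1 h2 hβ (by positivity : 0 < c * m) bE
  have hfinal : |(∫ y, y * G (w + c * y) ∂ν) - α * c ^ (α - 1) * L| ≤
      α * (2 / (α * cosIntegral α) * 2 * (m ^ (2 - α) * W)) * M * S := by
    rw [hdiff, abs_mul, abs_of_nonneg (by positivity)]
    calc _ ≤ α * c ^ (α - 1) * (2 / (α * cosIntegral α) * (2 * M) * ((c * m) ^ (2 - α) * W)) := by
          gcongr
      _ = α * (2 / (α * cosIntegral α) * 2 * (m ^ (2 - α) * W)) * M * c := by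
          rw [Real.mul_rpow hc0.le hm0.le]
          have : c ^ (α - 1) * c ^ (2 - α) = c := by
            rw [← Real.rpow_add hc0]; norm_num
          linear_combination (α * (2 / (α * cosIntegral α) * 2 * (m ^ (2 - α) * W)) * M) * this
      _ ≤ _ := by
          have := hc.2.le
          gcongr
  simp only [zero_mul, add_zero, sub_zero, integral_const, probReal_univ, one_smul,
    Real.zero_rpow (by linarith : α ≠ 0)] at hslope
  rw [hslope, abs_div, abs_of_pos hS, div_le_iff₀ hS] at hfinal
  rw [show (∫ y, g (w + S * y) ∂ν) - g w - S ^ α * L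
    = (∫ y, g (w + S * y) ∂ν) - S ^ α * L - g w by ring]
  calc _ ≤ _ := hfinal
    _ = _ := by ring

/-! ### Self-similarity and smoothing by stable convolution. -/

theorem stableChar_mul_eq {α : ℝ} (h1 : 1 < α) (θ : ℝ) {a : ℝ} (ha : 0 ≤ a) (t : ℝ) :
    stableChar α θ (a * t) =
      Complex.exp (((a ^ α : ℝ) : ℂ) *
        (-((|t| ^ α : ℝ) : ℂ) * (1 - Complex.I * ((θ * Real.sign t : ℝ) : ℂ)))) := by
  unfold stableChar
  congr 1
  rcases ha.eq_or_lt with rfl | ha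
  · simp [Real.zero_rpow (by linarith : α ≠ 0)]
  · have hs : Real.sign (a * t) = Real.sign t := by
      rcases lt_trichotomy t 0 with h | rfl | h
      · rw [Real.sign_of_neg h, Real.sign_of_neg (mul_neg_of_pos_of_neg ha h)]
      · simp
      · rw [Real.sign_of_pos h, Real.sign_of_pos (by positivity)]
    rw [hs, abs_mul, abs_of_pos ha, Real.mul_rpow ha.le (abs_nonneg t)]
    push_cast
    ring

/-- The exponent is positively homogeneous of degree `α`, so independent summands add the `α`-th
powers of their scales. -/
theorem IsStableLaw.conv_eq {α β : ℝ} (h1 : 1 < α) {ν : Measure ℝ} (h : IsStableLaw α 1 β ν)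
    {a b c : ℝ} (ha : 0 ≤ a) (hb : 0 ≤ b) (hc : 0 ≤ c) (habc : c ^ α = a ^ α + b ^ α) :
    (ν.map (a * ·)) ∗ (ν.map (b * ·)) = ν.map (c * ·) := by
  have := h.isProbabilityMeasure
  have : ∀ a : ℝ, IsProbabilityMeasure (ν.map (a * ·)) := fun a =>
    Measure.isProbabilityMeasure_map (by fun_prop)
  refine Measure.ext_of_charFun (funext fun t => ?_)
  rw [charFun_conv, charFun_map_mul, charFun_map_mul, charFun_map_mul, h.charFun_eq_stableChar,
    h.charFun_eq_stableChar, h.charFun_eq_stableChar, stableChar_mul_eq h1 _ ha,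
    stableChar_mul_eq h1 _ hb, stableChar_mul_eq h1 _ hc, ← Complex.exp_add, habc]
  push_cast
  ring_nf

/-- The semigroup property of the stable law. -/
theorem IsStableLaw.integral_integral {α β : ℝ} (h1 : 1 < α) (h2 : α < 2)
    (hβ : β ∈ Set.Icc (-1 : ℝ) 1) {ν : Measure ℝ} (h : IsStableLaw α 1 β ν)
    {a b c : ℝ} (ha : 0 ≤ a) (hb : 0 ≤ b) (hc : 0 ≤ c) (habc : c ^ α = a ^ α + b ^ α)
    {f : ℝ → ℝ} (hf : ∀ x y, |f x - f y| ≤ |x - y|) (hfc : Continuous f) (x : ℝ) :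
    ∫ y, ∫ z, f (x + a * y + b * z) ∂ν ∂ν = ∫ y, f (x + c * y) ∂ν := by
  have := h.isProbabilityMeasure
  have hpm : ∀ a : ℝ, IsProbabilityMeasure (ν.map (a * ·)) := fun a =>
    Measure.isProbabilityMeasure_map (by fun_prop)
  have hid := h.integrable_id h1 h2 hβ
  have hi : Integrable (fun y => f (x + y)) ((ν.map (a * ·)) ∗ (ν.map (b * ·))) := by
    rw [h.conv_eq h1 ha hb hc habc, integrable_map_measure
      (Continuous.aestronglyMeasurable (by fun_prop)) (by fun_prop)]
    exact integrable_comp_of_abs_sub_le hf ((integrable_const x).add (hid.const_mul c))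
  have e := integral_conv hi
  rw [h.conv_eq h1 ha hb hc habc, integral_map (by fun_prop)
    (Continuous.aestronglyMeasurable (by fun_prop)), integral_map (by fun_prop)] at e
  · rw [e]
    congr 1 with y
    rw [integral_map (by fun_prop) (Continuous.aestronglyMeasurable (by fun_prop))]
    simp only [add_assoc]
  · have : StronglyMeasurable (Function.uncurry fun y z : ℝ => f (x + (y + z))) :=
      Continuous.stronglyMeasurable (by unfold Function.uncurry; fun_prop)
    exact (this.integral_prod_right (ν := ν.map (b * ·))).aestronglyMeasurable

/-- Convolution with a stable law turns a `C¹` function into a smooth test function. -/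
theorem IsStableLaw.isSmoothTest_integral {α β : ℝ} (h1 : 1 < α) (h2 : α < 2)
    (hβ : β ∈ Set.Icc (-1 : ℝ) 1) :
    ∃ C : ℝ, 0 ≤ C ∧ ∀ ν : Measure ℝ, IsStableLaw α 1 β ν → ∀ g G : ℝ → ℝ,
      (∀ x, HasDerivAt g (G x) x) → Continuous G → (∀ x, |G x| ≤ 1) → ∀ ρ : ℝ, 0 < ρ →
        IsSmoothTest (max (C / ρ) 2) (fun x => ∫ y, g (x + ρ * y) ∂ν)
          (fun x => ∫ y, G (x + ρ * y) ∂ν) := by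
  obtain ⟨C, hC0, hC⟩ := IsStableLaw.abs_integral_shift_sub_le (β := β) h1
  refine ⟨C, hC0, fun ν h g G hd hG hb ρ hρ => ?_⟩
  have := h.isProbabilityMeasure
  have hid := h.integrable_id h1 h2 hβ
  have hgc := continuous_of_hasDerivAt hd
  have hG1 : ∀ x, |∫ y, G (x + ρ * y) ∂ν| ≤ 1 := fun x =>
    abs_integral_le_of_abs_le_const fun y => hb _
  refine ⟨fun x => ?_, hG1, fun w x => ?_⟩
  · refine (hasDerivAt_integral_of_dominated_loc_of_deriv_le (μ := ν) (s := Set.univ)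
      (F := fun x y => g (x + ρ * y)) (F' := fun x y => G (x + ρ * y)) (bound := fun y => 1)
      univ_mem (Eventually.of_forall fun s => Continuous.aestronglyMeasurable (by fun_prop)) ?_
      (Continuous.aestronglyMeasurable (by fun_prop)) ?_ (integrable_const _) ?_).2
    · exact integrable_comp_of_abs_sub_le (abs_sub_le_of_hasDerivAt hd hb)
        ((integrable_const x).add (hid.const_mul ρ))
    · exact ae_of_all _ fun y s _ => hb _
    · refine ae_of_all _ fun y s _ => ?_
      simpa using (hd (s + ρ * y)).comp_add_const s (ρ * y)
  · rcases le_total |x| 1 with hx | hx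
    · rw [min_eq_left hx]
      -- A shift of `x` in the argument is a shift of `x / ρ` in the stable variable; this is the
      -- origin of the modulus `C / ρ`.
      have := hC ν h (fun y => G (w + ρ * y)) (by fun_prop) (fun y => hb _) (x / ρ)
      rw [abs_div, abs_of_pos hρ] at this
      have e : ∀ y, G (w + ρ * (y + x / ρ)) = G (w + x + ρ * y) := by
        intro y; congr 1; field_simp; ring
      simp only [e] at this
      calc _ ≤ C * (|x| / ρ) := this
        _ = C / ρ * |x| := by ring
        _ ≤ _ := by gcongr; exact le_max_left _ _
    · rw [min_eq_right hx]
      calc _ ≤ 1 + 1 := (abs_sub _ _).trans (add_le_add (hG1 _) (hG1 _))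
        _ = 2 := by norm_num
        _ ≤ _ := by rw [mul_one]; exact le_max_right _ _

/-! ### Taylor's formula in terms of tails. -/

/-- The signed tail function of a law on the line. -/
def signedTail (μ : Measure ℝ) (x : ℝ) : ℝ := if 0 < x then 1 - cdf μ x else -cdf μ x

/-- The signed indicator of the interval between `0` and `y`. -/
def signedIndicator (y x : ℝ) : ℝ :=
  (Set.Ioo 0 y).indicator (fun _ => 1) x - (Set.Ico y 0).indicator (fun _ => 1) x

theorem measurable_signedIndicator : Measurable (Function.uncurry signedIndicator) := by
  have h1 : MeasurableSet {q : ℝ × ℝ | 0 < q.2 ∧ q.2 < q.1} :=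
    (measurableSet_lt measurable_const measurable_snd).inter
      (measurableSet_lt measurable_snd measurable_fst)
  have h2 : MeasurableSet {q : ℝ × ℝ | q.1 ≤ q.2 ∧ q.2 < 0} :=
    (measurableSet_le measurable_fst measurable_snd).inter
      (measurableSet_lt measurable_snd measurable_const)
  exact ((measurable_const (a := (1:ℝ))).indicator h1).sub ((measurable_const (a := (1:ℝ))).indicator h2)

theorem integrable_mul_signedIndicator {k : ℝ → ℝ} (hk : Continuous k) (y : ℝ) :
    Integrable (fun x => k x * signedIndicator y x) := by
  have h1 : Integrable ((Set.Ioo 0 y).indicator k) :=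
    ((hk.integrableOn_Icc (a := 0) (b := y)).mono_set Set.Ioo_subset_Icc_self).integrable_indicator
      measurableSet_Ioo
  have h2 : Integrable ((Set.Ico y 0).indicator k) :=
    ((hk.integrableOn_Icc (a := y) (b := 0)).mono_set Set.Ico_subset_Icc_self).integrable_indicator
      measurableSet_Ico
  refine (h1.sub h2).congr (ae_of_all _ fun x => ?_)
  simp only [Pi.sub_apply, signedIndicator, Set.indicator_apply]
  split_ifs <;> ring

theorem integral_mul_signedIndicator {k : ℝ → ℝ} (hk : Continuous k) (y : ℝ) :
    ∫ x, k x * signedIndicator y x = ∫ x in (0:ℝ)..y, k x := by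
  have h1 : Integrable ((Set.Ioo 0 y).indicator k) :=
    ((hk.integrableOn_Icc (a := 0) (b := y)).mono_set Set.Ioo_subset_Icc_self).integrable_indicator
      measurableSet_Ioo
  have h2 : Integrable ((Set.Ico y 0).indicator k) :=
    ((hk.integrableOn_Icc (a := y) (b := 0)).mono_set Set.Ico_subset_Icc_self).integrable_indicator
      measurableSet_Ico
  rw [intervalIntegral, integral_Ioc_eq_integral_Ioo, integral_Ioc_eq_integral_Ioo,
    ← integral_Ico_eq_integral_Ioo (x := y), ← integral_indicator measurableSet_Ioo,
    ← integral_indicator measurableSet_Ico, ← integral_sub h1 h2]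
  congr 1 with x
  simp only [signedIndicator, Set.indicator_apply]
  split_ifs <;> ring

theorem integral_abs_signedIndicator (y : ℝ) : ∫ x, |signedIndicator y x| = |y| := by
  rcases le_total 0 y with h | h
  · have e : ∀ x, |signedIndicator y x| = (Set.Ioo 0 y).indicator (fun _ => 1) x := by
      intro x
      simp [signedIndicator, Set.Ico_eq_empty (not_lt.2 h), Set.indicator_apply]
      split_ifs <;> simp
    simp only [e]
    rw [integral_indicator measurableSet_Ioo]
    simp [h, abs_of_nonneg h]
  · have e : ∀ x, |signedIndicator y x| = (Set.Ico y 0).indicator (fun _ => 1) x := by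
      intro x
      simp [signedIndicator, Set.Ioo_eq_empty (not_lt.2 h), Set.indicator_apply]
      split_ifs <;> simp
    simp only [e]
    rw [integral_indicator measurableSet_Ico]
    simp [h, abs_of_nonpos h]

/-- The endpoints in `signedIndicator` are chosen so that its section at `x` is `{y > x}` for `x >
0` and `{y ≤ x}` for `x < 0`, exactly the events measured by the distribution function, atoms
included. At `x = 0` the indicator vanishes whereas the tail need not. -/
theorem integral_signedIndicator (μ : Measure ℝ) [IsProbabilityMeasure μ] {x : ℝ} (hx : x ≠ 0) :
    ∫ y, signedIndicator y x ∂μ = signedTail μ x := by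
  rcases lt_or_gt_of_ne hx with h | h
  · have e : ∀ y, signedIndicator y x = -(Set.Iic x).indicator (fun _ => (1:ℝ)) y := by
      intro y
      simp [signedIndicator, Set.indicator_apply, h, h.not_gt]
    simp only [e]
    rw [integral_neg, integral_indicator measurableSet_Iic, signedTail, if_neg h.not_gt, cdf_eq_real]
    simp
  · have e : ∀ y, signedIndicator y x = (Set.Ioi x).indicator (fun _ => (1:ℝ)) y := by
      intro y
      simp [signedIndicator, Set.indicator_apply, h, h.not_gt]
    simp only [e]
    rw [integral_indicator measurableSet_Ioi, signedTail, if_pos h, cdf_eq_real]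
    have : μ.real (Set.Ioi x) = 1 - μ.real (Set.Iic x) := by
      rw [← Set.compl_Iic, probReal_compl_eq_one_sub measurableSet_Iic]
    simp [this]

/-- The inner integral of the absolute value is at most `B |y|`, so the first moment is what makes
Fubini available. -/
theorem integrable_uncurry_mul_signedIndicator {μ : Measure ℝ} [IsProbabilityMeasure μ]
    (hμ : Integrable (fun y : ℝ => y) μ) {k : ℝ → ℝ} (hk : Continuous k) {B : ℝ}
    (bk : ∀ x, |k x| ≤ B) :
    Integrable (Function.uncurry fun y x : ℝ => k x * signedIndicator y x) (μ.prod volume) := by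
  have hmeas : AEStronglyMeasurable (Function.uncurry fun y x : ℝ =>
      k x * signedIndicator y x) (μ.prod volume) := by
    apply Measurable.aestronglyMeasurable
    have h1 : Measurable fun q : ℝ × ℝ => k q.2 := hk.measurable.comp measurable_snd
    exact h1.mul measurable_signedIndicator
  rw [integrable_prod_iff hmeas]
  refine ⟨ae_of_all _ fun y => integrable_mul_signedIndicator hk y, ?_⟩
  refine (hμ.abs.const_mul B).mono' hmeas.norm.integral_prod_right' (ae_of_all _ fun y => ?_)
  rw [Real.norm_of_nonneg (integral_nonneg fun _ => norm_nonneg _),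
    ← integral_abs_signedIndicator, ← integral_const_mul]
  refine integral_mono (integrable_mul_signedIndicator hk y).norm ?_ fun x => ?_
  · have := (integrable_mul_signedIndicator (k := fun _ => 1) continuous_const y).abs.const_mul B
    simpa using this
  · simp only [Function.uncurry, norm_mul, Real.norm_eq_abs]
    exact mul_le_mul_of_nonneg_right (bk x) (abs_nonneg _)

/-- Taylor's formula in expectation, in terms of the tails of the law. -/
theorem integral_taylor_eq {μ : Measure ℝ} [IsProbabilityMeasure μ]
    (hμ : Integrable (fun y : ℝ => y) μ) {M : ℝ} {g G : ℝ → ℝ} (hT : IsSmoothTest M g G) (w : ℝ) :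
    (∫ y, g (w + y) ∂μ) - g w - G w * ∫ y, y ∂μ = ∫ x, (G (w + x) - G w) * signedTail μ x := by
  have hG := hT.continuous
  have hk : Continuous fun x => G (w + x) - G w := by fun_prop
  have bk : ∀ x, |G (w + x) - G w| ≤ 2 := fun x =>
    (abs_sub _ _).trans (by linarith [hT.abs_le_one (w + x), hT.abs_le_one w])
  -- The Taylor remainder is the integral of `G(w+x) - G(w)` from `0` to `y`; averaging over `y` and
  -- exchanging the integrals turns the indicator into the tail.
  have hftc : ∀ y, ∫ x, (G (w + x) - G w) * signedIndicator y x = g (w + y) - g w - G w * y := by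
    intro y
    rw [integral_mul_signedIndicator hk]
    have hd : ∀ x ∈ Set.uIcc 0 y, HasDerivAt (fun x => g (w + x) - G w * x) (G (w + x) - G w) x := by
      intro x _
      have h1 := (hT.hasDerivAt (w + x)).comp_const_add w x
      have h2 := (hasDerivAt_id x).const_mul (G w)
      rw [mul_one] at h2
      exact h1.sub h2
    rw [intervalIntegral.integral_eq_sub_of_hasDerivAt hd (hk.intervalIntegrable _ _)]
    simp
    ring
  have hgi : Integrable (fun y => g (w + y)) μ := integrable_comp_of_abs_sub_le
    (abs_sub_le_of_hasDerivAt hT.hasDerivAt hT.abs_le_one) ((integrable_const w).add hμ)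
  have hlhs : (∫ y, g (w + y) ∂μ) - g w - G w * ∫ y, y ∂μ
      = ∫ y, (∫ x, (G (w + x) - G w) * signedIndicator y x) ∂μ := by
    simp only [hftc]
    have hgi' : Integrable (fun y => g (w + y) - g w) μ := hgi.sub (integrable_const _)
    rw [integral_sub hgi' (hμ.const_mul _), integral_sub hgi (integrable_const _),
      integral_const_mul]
    simp
  have hj := integrable_uncurry_mul_signedIndicator hμ hk bk
  rw [hlhs, integral_integral_swap hj]
  refine integral_congr_ae ?_
  filter_upwards [Measure.ae_ne volume (0 : ℝ)] with x hx
  rw [integral_const_mul, integral_signedIndicator μ hx]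

theorem cdf_map_div {μ : Measure ℝ} [IsProbabilityMeasure μ] {b : ℝ} (hb : 0 < b) (x : ℝ) :
    cdf (μ.map fun z => z / b) x = cdf μ (b * x) := by
  have : IsProbabilityMeasure (μ.map fun z => z / b) :=
    Measure.isProbabilityMeasure_map (by fun_prop)
  rw [cdf_eq_real, cdf_eq_real, map_measureReal_apply (by fun_prop) measurableSet_Iic]
  congr 1
  ext z
  simp [div_le_iff₀ hb, mul_comm]

theorem signedTail_map_div {μ : Measure ℝ} [IsProbabilityMeasure μ] {b : ℝ} (hb : 0 < b) (x : ℝ) :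
    signedTail (μ.map fun z => z / b) x = signedTail μ (b * x) := by
  unfold signedTail
  rw [cdf_map_div hb]
  have : 0 < b * x ↔ 0 < x := mul_pos_iff_of_pos_left hb
  simp only [this]

/-! ### Comparison of the tails with the stable Lévy measure. -/

/-- The tail correction, weighted by the mass `1 ± β` of its side. -/
def tailError (β : ℝ) (ε : ℝ → ℝ) (x : ℝ) : ℝ := (if 0 < x then 1 + β else 1 - β) * |ε x|

theorem tailError_nonneg {β : ℝ} (hβ : β ∈ Set.Icc (-1 : ℝ) 1) (ε : ℝ → ℝ) (x : ℝ) :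
    0 ≤ tailError β ε x := by
  unfold tailError
  split_ifs
  · exact mul_nonneg (by linarith [hβ.1]) (abs_nonneg _)
  · exact mul_nonneg (by linarith [hβ.2]) (abs_nonneg _)

theorem tailError_le {β : ℝ} (hβ : β ∈ Set.Icc (-1 : ℝ) 1) (ε : ℝ → ℝ) (x : ℝ) :
    tailError β ε x ≤ 2 * |ε x| := by
  unfold tailError
  split_ifs
  · exact mul_le_mul_of_nonneg_right (by linarith [hβ.2]) (abs_nonneg _)
  · exact mul_le_mul_of_nonneg_right (by linarith [hβ.1]) (abs_nonneg _)

theorem measurable_tailError (β : ℝ) {ε : ℝ → ℝ} (hε : Measurable ε) :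
    Measurable (tailError β ε) :=
  (Measurable.ite measurableSet_Ioi measurable_const measurable_const).mul hε.abs

/-- The rescaled discrepancy between the tails of the law and those of the stable Lévy measure. -/
def tailDiscrepancy (α β : ℝ) (ε : ℝ → ℝ) (b : ℝ) : ℝ :=
  ∫ x, levyWeight α x * tailError β ε (b * x)

theorem integrable_tailDiscrepancy {α β : ℝ} (h1 : 1 < α) (h2 : α < 2)
    (hβ : β ∈ Set.Icc (-1 : ℝ) 1) {ε : ℝ → ℝ} (hε : Measurable ε) (hB : ∃ B, ∀ x, |ε x| ≤ B)
    (b : ℝ) : Integrable fun x => levyWeight α x * tailError β ε (b * x) := by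
  obtain ⟨B, hB⟩ := hB
  refine (integrable_levyWeight h1 h2).mul_bdd (c := 2 * B) ?_ (ae_of_all _ fun x => ?_)
  · exact ((measurable_tailError β hε).comp (by fun_prop)).aestronglyMeasurable
  · rw [Real.norm_of_nonneg (tailError_nonneg hβ _ _)]
    exact (tailError_le hβ _ _).trans (by linarith [hB (b * x)])

theorem InNormalAttraction.signedTail_eq {α β A : ℝ} {ε : ℝ → ℝ} {μ : Measure ℝ}
    (h : InNormalAttraction α β A ε μ) {x : ℝ} (hx : x ≠ 0) :
    signedTail μ x = (if 0 < x then 1 + β else -(1 - β)) * ((A + ε x) * |x| ^ (-α)) := by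
  unfold signedTail
  rw [Real.rpow_neg (abs_nonneg x)]
  rcases lt_or_gt_of_ne hx with h0 | h0
  · rw [if_neg h0.not_gt, if_neg h0.not_gt, h.cdf_neg x h0]; ring
  · rw [if_pos h0, if_pos h0, h.cdf_pos x h0]; ring

/-- The value of `r` makes the `A`-part of the tail cancel exactly against the kernel, which leaves
only the `ε`-part. -/
theorem InNormalAttraction.abs_signedTail_sub_le {α β A : ℝ} (h1 : 1 < α) (h2 : α < 2)
    (hβ : β ∈ Set.Icc (-1 : ℝ) 1) {ε : ℝ → ℝ} {μ : Measure ℝ}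
    (h : InNormalAttraction α β A ε μ) {b r : ℝ} (hb : 0 < b)
    (hr : r = A * α * cosIntegral α * b ^ (-α)) {x : ℝ} (hx : x ≠ 0) :
    |signedTail μ (b * x) - r * stableKernel α β x| ≤
      b ^ (-α) * (|x| ^ (-α) * tailError β ε (b * x)) := by
  have hJ := cosIntegral_pos h1 h2
  have hbx : 0 < b * x ↔ 0 < x := mul_pos_iff_of_pos_left hb
  rw [h.signedTail_eq (mul_ne_zero hb.ne' hx), stableKernel, hr, abs_mul, abs_of_pos hb,
    Real.mul_rpow hb.le (abs_nonneg x)]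
  have e : (if 0 < b * x then 1 + β else -(1 - β)) * ((A + ε (b * x)) * (b ^ (-α) * |x| ^ (-α))) -
      A * α * cosIntegral α * b ^ (-α) *
        ((if 0 < x then 1 + β else -(1 - β)) * |x| ^ (-α) / (α * cosIntegral α))
      = (if 0 < x then 1 + β else -(1 - β)) * ε (b * x) * (b ^ (-α) * |x| ^ (-α)) := by
    simp only [hbx]
    field_simp
    ring
  rw [e, abs_mul, abs_of_nonneg (by positivity : 0 ≤ b ^ (-α) * |x| ^ (-α)), tailError, abs_mul]
  simp only [hbx]
  refine le_of_eq ?_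
  split_ifs
  · rw [abs_of_nonneg (by linarith [hβ.1])]; ring
  · rw [abs_neg, abs_of_nonneg (by linarith [hβ.2])]; ring

theorem integrable_mul_signedTail {μ : Measure ℝ} [IsProbabilityMeasure μ]
    (hμ : Integrable (fun y : ℝ => y) μ) {k : ℝ → ℝ} (hk : Continuous k) {B : ℝ}
    (bk : ∀ x, |k x| ≤ B) : Integrable fun x => k x * signedTail μ x := by
  have hj := integrable_uncurry_mul_signedIndicator hμ hk bk
  refine hj.integral_prod_right.congr ?_
  filter_upwards [Measure.ae_ne volume (0 : ℝ)] with x hx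
  simp only [Function.uncurry]
  rw [integral_const_mul, integral_signedIndicator μ hx]

/-- Comparison of a law in the domain of normal attraction with the stable generator. -/
theorem InNormalAttraction.abs_integral_sub_generator_le {α β A : ℝ} (h1 : 1 < α) (h2 : α < 2)
    (hβ : β ∈ Set.Icc (-1 : ℝ) 1) {ε : ℝ → ℝ} {μ : Measure ℝ} [IsProbabilityMeasure μ]
    (hμ : Integrable (fun y : ℝ => y) μ) (h : InNormalAttraction α β A ε μ) {b r : ℝ} (hb : 0 < b)
    (hr : r = A * α * cosIntegral α * b ^ (-α)) {M : ℝ} {g G : ℝ → ℝ} (hT : IsSmoothTest M g G)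
    (w : ℝ) :
    |(∫ z, g (w + z / b) ∂μ) - g w - G w * ((∫ z, z ∂μ) / b) - r * stableGenerator α β G w| ≤
      M * b ^ (-α) * tailDiscrepancy α β ε b := by
  have hG := hT.continuous
  have hgc := continuous_of_hasDerivAt hT.hasDerivAt
  have hk : Continuous fun x => G (w + x) - G w := by fun_prop
  have bk : ∀ x, |G (w + x) - G w| ≤ 2 := fun x =>
    (abs_sub _ _).trans (by linarith [hT.abs_le_one (w + x), hT.abs_le_one w])
  have hpm : IsProbabilityMeasure (μ.map fun z => z / b) :=
    Measure.isProbabilityMeasure_map (by fun_prop)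
  have hμ' : Integrable (fun y : ℝ => y) (μ.map fun z => z / b) := by
    rw [integrable_map_measure (by fun_prop) (by fun_prop)]
    exact hμ.div_const b
  have htaylor := integral_taylor_eq hμ' hT w
  rw [integral_map (by fun_prop) (by fun_prop), integral_map (by fun_prop) (by fun_prop),
    integral_div] at htaylor
  rw [htaylor, stableGenerator, ← integral_const_mul]
  have i1 : Integrable (fun x => (G (w + x) - G w) * signedTail (μ.map fun z => z / b) x) :=
    integrable_mul_signedTail hμ' hk bk
  have i2 : Integrable (fun x => r * (stableKernel α β x * (G (w + x) - G w))) :=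
    (integrable_stableKernel_mul h1 h2 hβ hk.aestronglyMeasurable (C := M)
      (hT.abs_sub_le w)).const_mul r
  rw [← integral_sub i1 i2, tailDiscrepancy, ← integral_const_mul, ← Real.norm_eq_abs]
  refine norm_integral_le_of_norm_le
    ((integrable_tailDiscrepancy h1 h2 hβ h.measurable h.bounded b).const_mul _) ?_
  filter_upwards [Measure.ae_ne volume (0 : ℝ)] with x hx
  rw [signedTail_map_div hb, Real.norm_eq_abs]
  calc _ = |G (w + x) - G w| * |signedTail μ (b * x) - r * stableKernel α β x| := by
        rw [← abs_mul]; congr 1; ring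
    _ ≤ (M * min |x| 1) * (b ^ (-α) * (|x| ^ (-α) * tailError β ε (b * x))) := by
        have := hT.nonneg
        gcongr
        · exact hT.abs_sub_le w x
        · exact h.abs_signedTail_sub_le h1 h2 hβ hb hr hx
    _ = _ := by unfold levyWeight; ring

/-! ### First moment of the attracted law. -/

theorem InNormalAttraction.measure_abs_gt_le {α β A K : ℝ} (hβ : β ∈ Set.Icc (-1 : ℝ) 1)
    {ε : ℝ → ℝ} {μ : Measure ℝ} [IsProbabilityMeasure μ] (h : InNormalAttraction α β A ε μ)
    (hK : ∀ x, 1 ≤ |x| → |ε x| ≤ K) {t : ℝ} (ht : 1 < t) :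
    μ {x | t < |x|} ≤ ENNReal.ofReal (2 * (A + K) * t ^ (-α)) := by
  have ht0 : 0 < t := by linarith
  have hsub : {x : ℝ | t < |x|} ⊆ Set.Ioi t ∪ Set.Iic (-t) := by
    intro x hx
    rcases lt_abs.1 (show t < |x| from hx) with h | h
    · exact Or.inl h
    · exact Or.inr (show x ≤ -t by linarith)
  have h1 : μ (Set.Ioi t) = ENNReal.ofReal ((A + ε t) * t ^ (-α) * (1 + β)) := by
    rw [← ofReal_measureReal, ← Set.compl_Iic, probReal_compl_eq_one_sub measurableSet_Iic,
      ← cdf_eq_real, h.cdf_pos t ht0, abs_of_pos ht0, Real.rpow_neg ht0.le]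
    congr 1; ring
  have h2 : μ (Set.Iic (-t)) = ENNReal.ofReal ((A + ε (-t)) * t ^ (-α) * (1 - β)) := by
    rw [← ofReal_measureReal, ← cdf_eq_real, h.cdf_neg (-t) (by linarith), abs_neg, abs_of_pos ht0,
      Real.rpow_neg ht0.le]
    congr 1
  have hp : 0 ≤ t ^ (-α) := by positivity
  have e1 := (le_abs_self _).trans (hK t (by rw [abs_of_pos ht0]; exact ht.le))
  have e2 := (le_abs_self _).trans (hK (-t) (by rw [abs_neg, abs_of_pos ht0]; exact ht.le))
  calc μ {x | t < |x|} ≤ μ (Set.Ioi t) + μ (Set.Iic (-t)) :=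
        (measure_mono hsub).trans (measure_union_le _ _)
    _ ≤ ENNReal.ofReal ((A + K) * t ^ (-α) * (1 + β)) +
        ENNReal.ofReal ((A + K) * t ^ (-α) * (1 - β)) := by
        have : 0 ≤ 1 + β := by linarith [hβ.1]
        have : 0 ≤ 1 - β := by linarith [hβ.2]
        rw [h1, h2]
        gcongr
    _ = _ := by
        by_cases hAK : 0 ≤ A + K
        · rw [← ENNReal.ofReal_add]
          · congr 1; ring
          · exact mul_nonneg (mul_nonneg hAK hp) (by linarith [hβ.1])
          · exact mul_nonneg (mul_nonneg hAK hp) (by linarith [hβ.2])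
        · have hneg : (A + K) * t ^ (-α) ≤ 0 := mul_nonpos_of_nonpos_of_nonneg (by linarith) hp
          rw [ENNReal.ofReal_of_nonpos, ENNReal.ofReal_of_nonpos, ENNReal.ofReal_of_nonpos, add_zero]
          · nlinarith
          · exact mul_nonpos_of_nonpos_of_nonneg hneg (by linarith [hβ.2])
          · exact mul_nonpos_of_nonpos_of_nonneg hneg (by linarith [hβ.1])

/-- A law in the domain of normal attraction of a stable law of exponent `α > 1` has a finite first
moment, bounded in terms of the tail constants. -/
theorem InNormalAttraction.integrable_id_and_le {α β A K : ℝ} (h1 : 1 < α)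
    (hβ : β ∈ Set.Icc (-1 : ℝ) 1) (hAK : 0 ≤ A + K)
    {ε : ℝ → ℝ} {μ : Measure ℝ} [IsProbabilityMeasure μ] (h : InNormalAttraction α β A ε μ)
    (hK : ∀ x, 1 ≤ |x| → |ε x| ≤ K) :
    Integrable (fun x : ℝ => x) μ ∧ ∫ x, |x| ∂μ ≤ 1 + 2 * (A + K) / (α - 1) := by
  have hlin : ∫⁻ x, ENNReal.ofReal |x| ∂μ ≤ ENNReal.ofReal (1 + 2 * (A + K) / (α - 1)) := by
    rw [lintegral_eq_lintegral_meas_lt μ (ae_of_all _ fun x => abs_nonneg x) (by fun_prop),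
      ← Set.Ioc_union_Ioi_eq_Ioi zero_le_one]
    refine (lintegral_union_le _ _ _).trans ?_
    rw [ENNReal.ofReal_add zero_le_one (div_nonneg (by linarith) (by linarith))]
    refine add_le_add ?_ ?_
    · calc _ ≤ ∫⁻ _ in Set.Ioc (0:ℝ) 1, 1 := lintegral_mono fun t => prob_le_one
        _ = _ := by simp
    · calc _ ≤ ∫⁻ t in Set.Ioi (1:ℝ), ENNReal.ofReal (2 * (A + K) * t ^ (-α)) := by
            refine setLIntegral_mono (by fun_prop) fun t ht => ?_
            exact h.measure_abs_gt_le hβ hK ht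
        _ = ENNReal.ofReal (∫ t in Set.Ioi (1:ℝ), 2 * (A + K) * t ^ (-α)) := by
            rw [ofReal_integral_eq_lintegral_ofReal]
            · exact (integrableOn_Ioi_rpow_of_lt (by linarith) one_pos).const_mul _
            · filter_upwards [ae_restrict_mem measurableSet_Ioi] with t ht
              have : (0:ℝ) < t := lt_trans one_pos ht
              exact mul_nonneg (by linarith) (by positivity)
        _ = _ := by
            rw [integral_const_mul, integral_Ioi_rpow_of_lt (by linarith) one_pos, Real.one_rpow]
            congr 1
            rw [show -α + 1 = -(α - 1) by ring, neg_div_neg_eq]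
            ring
  have hint : Integrable (fun x : ℝ => x) μ := by
    refine ⟨by fun_prop, ?_⟩
    rw [hasFiniteIntegral_iff_norm]
    exact hlin.trans_lt ENNReal.ofReal_lt_top
  refine ⟨hint, ?_⟩
  rw [← ofReal_integral_eq_lintegral_ofReal hint.abs (ae_of_all _ fun x => abs_nonneg x)] at hlin
  exact (ENNReal.ofReal_le_ofReal_iff (add_nonneg zero_le_one
    (div_nonneg (by linarith) (by linarith)))).1 hlin

/-! ### One exchange step. -/

/-- The slope is taken at `w` rather than at `v`, so that after averaging over `v = w + s y` the
drift term is still `G(w) d`; the displacement enters the error. The mean value inequality is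
applied to `g - G(w) id`. -/
theorem IsSmoothTest.abs_taylor_le {M : ℝ} {g G : ℝ → ℝ} (h : IsSmoothTest M g G) (w v d : ℝ) :
    |g (v + d) - g v - G w * d| ≤ M * (|d| + |v - w|) * |d| := by
  have hM := h.nonneg
  have hd : ∀ x ∈ Set.uIcc v (v + d),
      HasDerivWithinAt (fun x => g x - G w * x) (G x - G w) (Set.uIcc v (v + d)) x := by
    intro x _
    have h2 := (hasDerivAt_id x).const_mul (G w)
    rw [mul_one] at h2
    exact ((h.hasDerivAt x).sub h2).hasDerivWithinAt
  have := (convex_uIcc v (v + d)).norm_image_sub_le_of_norm_hasDerivWithin_le hd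
    (C := M * (|d| + |v - w|)) (fun x hx => ?_) Set.left_mem_uIcc Set.right_mem_uIcc
  · rw [Real.norm_eq_abs, Real.norm_eq_abs, add_sub_cancel_left] at this
    convert this using 2
    ring
  · refine (h.lipschitz x w).trans (mul_le_mul_of_nonneg_left ?_ hM)
    have h1 := Set.abs_sub_left_of_mem_uIcc hx
    rw [add_sub_cancel_left] at h1
    calc |x - w| = |(x - v) + (v - w)| := by ring_nf
      _ ≤ |x - v| + |v - w| := abs_add_le _ _
      _ ≤ _ := by gcongr

theorem IsSmoothTest.abs_integral_shift_le {M : ℝ} {g G : ℝ → ℝ} (h : IsSmoothTest M g G)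
    {ν : Measure ℝ} [IsProbabilityMeasure ν] (hν : Integrable (fun y : ℝ => y) ν) (w d : ℝ)
    {s : ℝ} (hs : 0 ≤ s) :
    |(∫ y, g (w + d + s * y) ∂ν) - (∫ y, g (w + s * y) ∂ν) - G w * d| ≤
      M * (|d| + s * ∫ y, |y| ∂ν) * |d| := by
  have hgl := abs_sub_le_of_hasDerivAt h.hasDerivAt h.abs_le_one
  have hi : ∀ v, Integrable (fun y => g (v + s * y)) ν := fun v =>
    integrable_comp_of_abs_sub_le hgl ((integrable_const v).add (hν.const_mul s))
  have e : (∫ y, g (w + d + s * y) ∂ν) - (∫ y, g (w + s * y) ∂ν) - G w * d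
      = ∫ y, (g (w + d + s * y) - g (w + s * y) - G w * d) ∂ν := by
    have i1 : Integrable (fun y => g (w + d + s * y) - g (w + s * y)) ν := (hi _).sub (hi _)
    rw [integral_sub i1 (integrable_const _), integral_sub (hi _) (hi _)]
    simp
  rw [e]
  refine (abs_integral_le_of_abs_le (b := fun y => M * (|d| + s * |y|) * |d|)
    ((((integrable_const _).add (hν.abs.const_mul s)).const_mul M).mul_const _) fun y => ?_).trans_eq ?_
  · have := h.abs_taylor_le w (w + s * y) d
    rw [add_sub_cancel_left, abs_mul, abs_of_nonneg hs, add_right_comm] at this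
    exact this
  · rw [integral_mul_const, integral_const_mul, integral_add (integrable_const _)
      (hν.abs.const_mul s), integral_const_mul]
    simp

theorem stableScale_pos {α A : ℝ} (h1 : 1 < α) (h2 : α < 2) (hA : 0 < A) : 0 < stableScale α A := by
  have hJ := cosIntegral_pos h1 h2
  exact Real.rpow_pos_of_pos (mul_pos (mul_pos hA (by linarith)) hJ) _

theorem stableScale_rpow {α A : ℝ} (h1 : 1 < α) (h2 : α < 2) (hA : 0 < A) :
    stableScale α A ^ α = A * α * cosIntegral α := by
  have hJ := cosIntegral_pos h1 h2
  show ((A * α * cosIntegral α) ^ (1 / α)) ^ α = _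
  rw [← Real.rpow_mul (mul_nonneg (mul_nonneg hA.le (by linarith)) hJ.le),
    one_div_mul_cancel (by linarith), Real.rpow_one]

/-- One step of the Lindeberg scheme, against a smooth test function. -/
theorem one_step_smooth {α β A K : ℝ} (h1 : 1 < α) (h2 : α < 2) (hβ : β ∈ Set.Icc (-1 : ℝ) 1)
    (hA : 0 < A) (hK : 0 < K) :
    ∃ C : ℝ, 0 ≤ C ∧ ∀ ν : Measure ℝ, IsStableLaw α 1 β ν → ∀ (μ : Measure ℝ) (ε : ℝ → ℝ),
      IsProbabilityMeasure μ → InNormalAttraction α β A ε μ → (∀ x, 1 ≤ |x| → |ε x| ≤ K) →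
      ∀ n : ℕ, 1 ≤ n → ∀ (M : ℝ) (g G : ℝ → ℝ), IsSmoothTest M g G → ∀ w : ℝ,
        |(∫ z, g (w + (z - ∫ x, x ∂μ) / (stableScale α A * (n : ℝ) ^ (1 / α))) ∂μ) -
          ∫ y, g (w + (n : ℝ) ^ (-(1 / α)) * y) ∂ν| ≤
        C * M * (((n : ℝ) ^ (-(1 / α))) ^ 2 + (n : ℝ)⁻¹ *
          tailDiscrepancy α β ε (stableScale α A * (n : ℝ) ^ (1 / α))) := by
  obtain ⟨C, hC0, hC⟩ := IsStableLaw.abs_integral_sub_generator_le h1 h2 hβ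
  have hJ := cosIntegral_pos h1 h2
  have hσ := stableScale_pos h1 h2 hA
  set σ := stableScale α A with hσdef
  set m0 := 1 + 2 * (A + K) / (α - 1) with hm0
  have hm0p : 0 ≤ m0 := add_nonneg zero_le_one (div_nonneg (by positivity) (by linarith))
  set m1 := |stableAbsMoment α β| with hm1
  set D := m0 / σ with hD
  have hD0 : 0 ≤ D := by positivity
  refine ⟨1 / (A * α * cosIntegral α) + C + (D + m1) * D, by positivity,
    fun ν hν μ ε hμp hμ hε n hn M g G hT w => ?_⟩
  have := hν.isProbabilityMeasure
  have hM := hT.nonneg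
  obtain ⟨hid, hmom⟩ := hμ.integrable_id_and_le h1 hβ (by positivity) hε
  have hνid := hν.integrable_id h1 h2 hβ
  have hn0 : (0:ℝ) < n := by exact_mod_cast hn
  set s := (n : ℝ) ^ (-(1 / α)) with hs
  have hs0 : 0 < s := Real.rpow_pos_of_pos hn0 _
  set b := σ * (n : ℝ) ^ (1 / α) with hb
  have hb0 : 0 < b := by positivity
  have hsα : s ^ α = (n : ℝ)⁻¹ := by
    rw [hs, ← Real.rpow_mul hn0.le, neg_mul, one_div_mul_cancel (by linarith), Real.rpow_neg_one]
  have hbs : b = σ / s := by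
    rw [hb, hs, Real.rpow_neg hn0.le, div_inv_eq_mul]
  have hbα : b ^ (-α) = 1 / (A * α * cosIntegral α) * (n : ℝ)⁻¹ := by
    rw [hbs, Real.rpow_neg (by positivity), Real.div_rpow hσ.le hs0.le, hsα, hσdef,
      stableScale_rpow h1 h2 hA]
    field_simp
  -- This is the purpose of the normalization by `σ`: the generator has the same coefficient `n⁻¹ =
  -- s^α` in both expansions.
  have hr : (n : ℝ)⁻¹ = A * α * cosIntegral α * b ^ (-α) := by
    rw [hbα]
    field_simp
  set m := ∫ x, x ∂μ with hm
  set d := m / b with hd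
  have hdD : |d| ≤ D * s := by
    have : |m| ≤ m0 := (abs_integral_le_integral_abs).trans hmom
    rw [hd, abs_div, abs_of_pos hb0, hbs, hD]
    calc |m| / (σ / s) = |m| / σ * s := by field_simp
      _ ≤ _ := by gcongr
  have hm1' : ∫ y, |y| ∂ν ≤ m1 := by
    rw [hν.integral_abs h1]; exact le_abs_self _
  set Q := tailDiscrepancy α β ε b with hQ
  have hQ0 : 0 ≤ Q := integral_nonneg fun x =>
    mul_nonneg (levyWeight_nonneg α x) (tailError_nonneg hβ _ _)
  have T1 := hμ.abs_integral_sub_generator_le h1 h2 hβ hid hb0 hr hT (w - d)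
  have T2 := hC ν hν M g G hT (w - d) s hs0
  have T3 := hT.abs_integral_shift_le hνid (w - d) d hs0.le
  rw [← hm, ← hd, ← hQ, hbα] at T1
  rw [hsα] at T2
  rw [sub_add_cancel] at T3
  have T3' : M * (|d| + s * ∫ y, |y| ∂ν) * |d| ≤ M * (D * s + s * m1) * (D * s) := by gcongr
  have e1 : ∫ z, g (w + (z - m) / b) ∂μ = ∫ z, g (w - d + z / b) ∂μ := by
    congr 1 with z
    congr 1
    rw [hd]; ring
  rw [e1]
  set I1 := ∫ z, g (w - d + z / b) ∂μ
  set I2 := ∫ y, g (w + s * y) ∂ν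
  set I3 := ∫ y, g (w - d + s * y) ∂ν
  set L := stableGenerator α β G (w - d)
  -- Everything is expanded at `w - d`, with `d` the rescaled mean. There the law of the summand
  -- need not be centered, and its drift `G(w-d) d` is matched by shifting the stable integral from
  -- `w - d` to `w`.
  have hsplit : I1 - I2 = (I1 - g (w - d) - G (w - d) * d - (n : ℝ)⁻¹ * L)
      - (I3 - g (w - d) - (n : ℝ)⁻¹ * L) - (I2 - I3 - G (w - d) * d) := by ring
  rw [hsplit]
  calc _ ≤ |I1 - g (w - d) - G (w - d) * d - (n : ℝ)⁻¹ * L|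
        + |I3 - g (w - d) - (n : ℝ)⁻¹ * L| + |I2 - I3 - G (w - d) * d| :=
        (abs_sub _ _).trans (add_le_add (abs_sub _ _) le_rfl)
    _ ≤ M * (1 / (A * α * cosIntegral α) * (n : ℝ)⁻¹) * Q + C * M * s ^ 2
        + M * (D * s + s * m1) * (D * s) := add_le_add (add_le_add T1 T2) (T3.trans T3')
    _ = M * (1 / (A * α * cosIntegral α)) * ((n : ℝ)⁻¹ * Q) + (C + (D + m1) * D) * M * s ^ 2 := by
        ring
    _ ≤ _ := by
        have a1 : 0 ≤ 1 / (A * α * cosIntegral α) * M * s ^ 2 := by positivity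
        have a2 : 0 ≤ (C + (D + m1) * D) * M * ((n : ℝ)⁻¹ * Q) := by positivity
        linarith

/-- One step of the Lindeberg scheme, against a `1`-Lipschitz function. -/
theorem one_step_lipschitz {α β A K : ℝ} (h1 : 1 < α) (h2 : α < 2) (hβ : β ∈ Set.Icc (-1 : ℝ) 1)
    (hA : 0 < A) (hK : 0 < K) :
    ∃ C : ℝ, 0 ≤ C ∧ ∀ ν : Measure ℝ, IsStableLaw α 1 β ν → ∀ (μ : Measure ℝ) (ε : ℝ → ℝ),
      IsProbabilityMeasure μ → InNormalAttraction α β A ε μ → (∀ x, 1 ≤ |x| → |ε x| ≤ K) →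
      ∀ n : ℕ, 1 ≤ n → ∀ g : ℝ → ℝ, (∀ x y, |g x - g y| ≤ |x - y|) → ∀ w : ℝ,
        |(∫ z, g (w + (z - ∫ x, x ∂μ) / (stableScale α A * (n : ℝ) ^ (1 / α))) ∂μ) -
          ∫ y, g (w + (n : ℝ) ^ (-(1 / α)) * y) ∂ν| ≤ C * (n : ℝ) ^ (-(1 / α)) := by
  have hσ := stableScale_pos h1 h2 hA
  set σ := stableScale α A with hσdef
  set m0 := 1 + 2 * (A + K) / (α - 1) with hm0
  have hm0p : 0 ≤ m0 := add_nonneg zero_le_one (div_nonneg (by positivity) (by linarith))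
  set m1 := |stableAbsMoment α β| with hm1
  refine ⟨2 * m0 / σ + m1, by positivity, fun ν hν μ ε hμp hμ hε n hn g hg w => ?_⟩
  have := hν.isProbabilityMeasure
  obtain ⟨hid, hmom⟩ := hμ.integrable_id_and_le h1 hβ (by positivity) hε
  have hνid := hν.integrable_id h1 h2 hβ
  have hn0 : (0:ℝ) < n := by exact_mod_cast hn
  set s := (n : ℝ) ^ (-(1 / α)) with hs
  have hs0 : 0 < s := Real.rpow_pos_of_pos hn0 _
  set b := σ * (n : ℝ) ^ (1 / α) with hb
  have hb0 : 0 < b := by positivity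
  have hbs : b = σ / s := by
    rw [hb, hs, Real.rpow_neg hn0.le, div_inv_eq_mul]
  set m := ∫ x, x ∂μ with hm
  have hmm : |m| ≤ m0 := (abs_integral_le_integral_abs).trans hmom
  have hm1' : ∫ y, |y| ∂ν ≤ m1 := by
    rw [hν.integral_abs h1]; exact le_abs_self _
  have B1 : |(∫ z, g (w + (z - m) / b) ∂μ) - g w| ≤ 2 * m0 / σ * s := by
    have hi : Integrable (fun z => g (w + (z - m) / b)) μ := integrable_comp_of_abs_sub_le hg
      ((integrable_const w).add ((hid.sub (integrable_const m)).div_const b))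
    have e : (∫ z, g (w + (z - m) / b) ∂μ) - g w = ∫ z, (g (w + (z - m) / b) - g w) ∂μ := by
      rw [integral_sub hi (integrable_const _)]; simp
    rw [e]
    refine (abs_integral_le_of_abs_le (b := fun z => (|z| + |m|) / b)
      ((hid.abs.add (integrable_const |m|)).div_const b) fun z => ?_).trans ?_
    · refine (hg _ _).trans ?_
      rw [add_sub_cancel_left, abs_div, abs_of_pos hb0]
      gcongr
      exact abs_sub _ _
    · rw [integral_div, integral_add hid.abs (integrable_const _), hbs]
      simp only [integral_const, probReal_univ, one_smul]
      calc ((∫ z, |z| ∂μ) + |m|) / (σ / s) = ((∫ z, |z| ∂μ) + |m|) / σ * s := by field_simp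
        _ ≤ (m0 + m0) / σ * s := by gcongr
        _ = _ := by ring
  have B2 : |(∫ y, g (w + s * y) ∂ν) - g w| ≤ m1 * s := by
    have hi : Integrable (fun y => g (w + s * y)) ν := integrable_comp_of_abs_sub_le hg
      ((integrable_const w).add (hνid.const_mul s))
    have e : (∫ y, g (w + s * y) ∂ν) - g w = ∫ y, (g (w + s * y) - g w) ∂ν := by
      rw [integral_sub hi (integrable_const _)]; simp
    rw [e]
    refine (abs_integral_le_of_abs_le (hνid.abs.const_mul s) fun y => ?_).trans ?_
    · refine (hg _ _).trans ?_
      rw [add_sub_cancel_left, abs_mul, abs_of_pos hs0]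
    · rw [integral_const_mul, mul_comm]
      gcongr
  calc _ = |((∫ z, g (w + (z - m) / b) ∂μ) - g w) - ((∫ y, g (w + s * y) ∂ν) - g w)| := by
        congr 1; ring
    _ ≤ 2 * m0 / σ * s + m1 * s := (abs_sub _ _).trans (add_le_add B1 B2)
    _ = _ := by ring

/-! ### Summation of the exchange steps. -/

/-- Induction, with Bernoulli's inequality for the exponent `1 - p` controlling each increment. The
term `j = 0` contributes `0`, because `0 ^ (-p) = 0` for `p ≠ 0`. -/
theorem sum_range_succ_rpow_neg_le {p : ℝ} (hp0 : 0 < p) (hp1 : p < 1) (n : ℕ) :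
    ∑ j ∈ Finset.range (n + 1), (j : ℝ) ^ (-p) ≤ (1 - p)⁻¹ * (n : ℝ) ^ (1 - p) := by
  induction n with
  | zero => simp [Real.zero_rpow (by linarith : -p ≠ 0), Real.zero_rpow (by linarith : 1 - p ≠ 0)]
  | succ n ih =>
    rw [Finset.sum_range_succ]
    have hn : (0:ℝ) < (n:ℝ) + 1 := by positivity
    have hq : 0 < 1 - p := by linarith
    push_cast
    have hbern : (n : ℝ) ^ (1 - p) ≤ ((n:ℝ) + 1) ^ (1 - p) - (1 - p) * ((n:ℝ) + 1) ^ (-p) := by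
      have h := rpow_one_add_le_one_add_mul_self (s := -(1 / ((n:ℝ) + 1))) (p := 1 - p)
        (by rw [neg_le_neg_iff, div_le_one hn]; linarith [n.cast_nonneg (α := ℝ)]) hq.le (by linarith)
      have e : 1 + -(1 / ((n:ℝ) + 1)) = n / (n + 1) := by field_simp; ring
      rw [e, Real.div_rpow n.cast_nonneg hn.le, div_le_iff₀ (Real.rpow_pos_of_pos hn _)] at h
      have e2 : ((n:ℝ) + 1) ^ (1 - p) = (n + 1) * ((n:ℝ) + 1) ^ (-p) := by
        rw [sub_eq_add_neg, Real.rpow_add hn, Real.rpow_one]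
      refine h.trans_eq ?_
      rw [e2]
      field_simp
      ring
    calc _ ≤ (1 - p)⁻¹ * (n : ℝ) ^ (1 - p) + ((n:ℝ) + 1) ^ (-p) := by gcongr
      _ ≤ (1 - p)⁻¹ * (((n:ℝ) + 1) ^ (1 - p) - (1 - p) * ((n:ℝ) + 1) ^ (-p))
          + ((n:ℝ) + 1) ^ (-p) := by gcongr
      _ = _ := by field_simp; ring

theorem integral_comp_add_of_indepFun {Ω : Type*} [MeasurableSpace Ω] {P : Measure Ω}
    [IsProbabilityMeasure P] {U V : Ω → ℝ} (hU : Integrable U P) (hV : Integrable V P)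
    (hi : IndepFun U V P) {f : ℝ → ℝ} (hf : ∀ x y, |f x - f y| ≤ |x - y|) (hfc : Continuous f) :
    ∫ ω, f (U ω + V ω) ∂P = ∫ ω, (∫ ω', f (U ω + V ω') ∂P) ∂P := by
  have hp := (indepFun_iff_map_prod_eq_prod_map_map hU.aemeasurable hV.aemeasurable).1 hi
  have hUV := hU.aemeasurable.prodMk hV.aemeasurable
  have p1 : IsProbabilityMeasure (P.map U) := Measure.isProbabilityMeasure_map hU.aemeasurable
  have p2 : IsProbabilityMeasure (P.map V) := Measure.isProbabilityMeasure_map hV.aemeasurable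
  have hc : Continuous fun q : ℝ × ℝ => f (q.1 + q.2) := by fun_prop
  have e1 : ∫ ω, f (U ω + V ω) ∂P = ∫ q, f (q.1 + q.2) ∂((P.map U).prod (P.map V)) := by
    rw [← hp, integral_map hUV hc.aestronglyMeasurable]
  have hint : Integrable (fun q : ℝ × ℝ => f (q.1 + q.2)) ((P.map U).prod (P.map V)) := by
    rw [← hp, integrable_map_measure hc.aestronglyMeasurable hUV]
    exact integrable_comp_of_abs_sub_le hf (hU.add hV)
  rw [e1, integral_prod _ hint, integral_map hU.aemeasurable]
  · congr 1 with ω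
    rw [integral_map hV.aemeasurable (Continuous.aestronglyMeasurable (by fun_prop))]
  · exact hint.aestronglyMeasurable.integral_prod_right'

theorem continuous_of_abs_sub_le {g : ℝ → ℝ} (hg : ∀ x y, |g x - g y| ≤ |x - y|) :
    Continuous g := by
  have : LipschitzWith 1 g := LipschitzWith.of_dist_le_mul fun x y => by
    simpa [Real.dist_eq] using hg x y
  exact this.continuous

/-- Averaging the translates of a `1`-Lipschitz function gives a `1`-Lipschitz function. -/
theorem abs_integral_add_sub_integral_add_le {Ω : Type*} [MeasurableSpace Ω] {P : Measure Ω}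
    [IsProbabilityMeasure P] {g : ℝ → ℝ} (hg : ∀ x y, |g x - g y| ≤ |x - y|) {V : Ω → ℝ}
    (hV : Integrable V P) (x y : ℝ) :
    |(∫ ω, g (x + V ω) ∂P) - ∫ ω, g (y + V ω) ∂P| ≤ |x - y| := by
  have hi : ∀ w, Integrable (fun ω => g (w + V ω)) P := fun w =>
    integrable_comp_of_abs_sub_le hg ((integrable_const w).add hV)
  rw [← integral_sub (hi x) (hi y)]
  refine abs_integral_le_of_abs_le_const fun ω => (hg _ _).trans_eq ?_
  rw [add_sub_add_right_eq_sub]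

theorem abs_integral_comp_add_sub_le {Ω : Type*} [MeasurableSpace Ω] {P : Measure Ω}
    [IsProbabilityMeasure P] {U V : Ω → ℝ} (hU : Integrable U P) (hV : Integrable V P)
    (hi : IndepFun U V P) {f k : ℝ → ℝ} (hf : ∀ x y, |f x - f y| ≤ |x - y|)
    (hk : ∀ x y, |k x - k y| ≤ |x - y|) {D : ℝ}
    (h : ∀ w, |(∫ ω, f (w + V ω) ∂P) - k w| ≤ D) :
    |(∫ ω, f (U ω + V ω) ∂P) - ∫ ω, k (U ω) ∂P| ≤ D := by
  rw [integral_comp_add_of_indepFun hU hV hi hf (continuous_of_abs_sub_le hf), ← integral_sub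
    (integrable_comp_of_abs_sub_le (g := fun w => ∫ ω, f (w + V ω) ∂P)
      (abs_integral_add_sub_integral_add_le hf hV) hU) (integrable_comp_of_abs_sub_le hk hU)]
  exact abs_integral_le_of_abs_le_const fun ω => h _

theorem normalizedSum_eq_sum {Ω : Type*} [MeasurableSpace Ω] (P : Measure Ω) (X : ℕ → Ω → ℝ)
    (α A : ℝ) (n : ℕ) (ω : Ω) :
    normalizedSum P X α A n ω =
      ∑ i ∈ Finset.range n, (X i ω - ∫ ω', X 0 ω' ∂P) / (stableScale α A * (n : ℝ) ^ (1 / α)) := by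
  rw [← Finset.sum_div, Finset.sum_sub_distrib, normalizedSum, Real.rpow_neg n.cast_nonneg]
  simp only [Finset.sum_const, Finset.card_range, nsmul_eq_mul]
  rw [div_eq_mul_inv _ (stableScale α A * _), mul_inv, one_div (stableScale α A), mul_comm]

/-- The Lindeberg scheme with stable smoothing, for continuously differentiable test functions. -/
theorem abs_integral_normalizedSum_sub_le {α β A K : ℝ} (h1 : 1 < α) (h2 : α < 2)
    (hβ : β ∈ Set.Icc (-1 : ℝ) 1) (hA : 0 < A) (hK : 0 < K) :
    ∃ C : ℝ, 0 ≤ C ∧ ∀ ν : Measure ℝ, IsStableLaw α 1 β ν →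
      ∀ (Ω : Type*) [MeasurableSpace Ω] (P : Measure Ω) [IsProbabilityMeasure P]
        (X : ℕ → Ω → ℝ) (ε : ℝ → ℝ), iIndepFun X P → (∀ i, IdentDistrib (X i) (X 0) P P) →
        InNormalAttraction α β A ε (P.map (X 0)) → (∀ x, 1 ≤ |x| → |ε x| ≤ K) →
        ∀ n : ℕ, 1 ≤ n → ∀ g G : ℝ → ℝ, (∀ x, HasDerivAt g (G x) x) → Continuous G →
          (∀ x, |G x| ≤ 1) →
          |(∫ ω, g (normalizedSum P X α A n ω) ∂P) - ∫ y, g y ∂ν| ≤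
            C * ((n : ℝ) ^ (1 - 2 / α) +
              tailDiscrepancy α β ε (stableScale α A * (n : ℝ) ^ (1 / α))) := by
  obtain ⟨C0, hC0, hLip⟩ := one_step_lipschitz h1 h2 hβ hA hK
  obtain ⟨C1, hC1, hSm⟩ := one_step_smooth h1 h2 hβ hA hK
  obtain ⟨C2, hC2, hTest⟩ := IsStableLaw.isSmoothTest_integral h1 h2 hβ
  have hα0 : 0 < α := by linarith
  have hp0 : 0 < 1 / α := by positivity
  have hp1 : 1 / α < 1 := (div_lt_one hα0).2 h1
  have hp1' : 0 < 1 - 1 / α := by linarith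
  refine ⟨C0 + C1 * (C2 + 2) * (1 - 1 / α)⁻¹, by positivity,
    fun ν hν Ω _ P _ X ε hind hid hμ hε n hn g G hd hGc hG1 => ?_⟩
  have hνp := hν.isProbabilityMeasure
  have hνid := hν.integrable_id h1 h2 hβ
  have hX0 : AEMeasurable (X 0) P := (hid 0).aemeasurable_snd
  have hμp : IsProbabilityMeasure (P.map (X 0)) := Measure.isProbabilityMeasure_map hX0
  have hμi := (hμ.integrable_id_and_le h1 hβ (by positivity) hε).1
  have hXi0 : Integrable (X 0) P := (integrable_map_measure (by fun_prop) hX0).1 hμi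
  have hXi : ∀ i, Integrable (X i) P := fun i => (hid i).integrable_iff.2 hXi0
  have hn0 : (0:ℝ) < n := by exact_mod_cast hn
  have hσ := stableScale_pos h1 h2 hA
  set s := (n : ℝ) ^ (-(1 / α)) with hs
  have hs0 : 0 < s := Real.rpow_pos_of_pos hn0 _
  have hsα : s ^ α = (n : ℝ)⁻¹ := by
    rw [hs, ← Real.rpow_mul hn0.le, neg_mul, one_div_mul_cancel hα0.ne', Real.rpow_neg_one]
  have hsinv : s⁻¹ = (n : ℝ) ^ (1 / α) := by rw [hs, Real.rpow_neg hn0.le, inv_inv]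
  set b := stableScale α A * (n : ℝ) ^ (1 / α) with hb
  set Q := tailDiscrepancy α β ε b with hQ
  have hQ0 : 0 ≤ Q := integral_nonneg fun x =>
    mul_nonneg (levyWeight_nonneg α x) (tailError_nonneg hβ _ _)
  set m := ∫ ω, X 0 ω ∂P with hm
  have hmμ : ∫ x, x ∂(P.map (X 0)) = m := integral_map hX0 (by fun_prop)
  have hgl := abs_sub_le_of_hasDerivAt hd hG1
  have hgc := continuous_of_hasDerivAt hd
  set V : ℕ → Ω → ℝ := fun i ω => (X i ω - m) / b with hV
  have hVi : ∀ i, Integrable (V i) P := fun i => ((hXi i).sub (integrable_const m)).div_const b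
  have hVind : iIndepFun V P := hind.comp (fun _ x => (x - m) / b) fun _ => by fun_prop
  set S : ℕ → Ω → ℝ := fun k => ∑ i ∈ Finset.range k, V i with hS
  have hSi : ∀ k, Integrable (S k) P := fun k => integrable_finsetSum' _ fun i _ => hVi i
  have hSV : ∀ k, IndepFun (S k) (V k) P := fun k =>
    hVind.indepFun_finsetSum_of_notMem₀ (fun i => (hVi i).aemeasurable) Finset.notMem_range_self
  set u : ℝ → ℝ → ℝ := fun ρ x => ∫ y, g (x + ρ * y) ∂ν with hu
  have hul : ∀ ρ x y, |u ρ x - u ρ y| ≤ |x - y| := fun ρ =>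
    abs_integral_add_sub_integral_add_le hgl (hνid.const_mul ρ)
  -- The scale `(j/n)^(1/α)` of a sum of `j` independent stable increments of scale `s`.
  set r : ℕ → ℝ := fun j => (j : ℝ) ^ (1 / α) * s with hr
  have hr0 : ∀ j, 0 ≤ r j := fun j => by positivity
  have hrα : ∀ j, r j ^ α = j * (n : ℝ)⁻¹ := fun j => by
    rw [hr, Real.mul_rpow (by positivity) hs0.le, hsα, ← Real.rpow_mul j.cast_nonneg,
      one_div_mul_cancel hα0.ne', Real.rpow_one]
  have hrsucc : ∀ j x, u (r (j + 1)) x = ∫ y, u (r j) (x + s * y) ∂ν := fun j x => by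
    refine (hν.integral_integral h1 h2 hβ hs0.le (hr0 j) (hr0 (j + 1)) ?_ hgl hgc x).symm
    rw [hrα, hrα, hsα]; push_cast; ring
  set E := C1 * (C2 + 2) * s⁻¹ * (s ^ 2 + (n : ℝ)⁻¹ * Q) with hE
  -- At `j = 0` no smoothing is left and only the Lipschitz bound `C0 s` is available; the second
  -- summand is then `0`, by the value of the power at `0`.
  set D : ℕ → ℝ := fun j => (if j = 0 then C0 * s else 0) + E * (j : ℝ) ^ (-(1 / α)) with hD
  have hVint : ∀ k j w, ∫ ω, u (r j) (w + V k ω) ∂P =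
      ∫ z, u (r j) (w + (z - m) / b) ∂(P.map (X 0)) := fun k j w => by
    have hc := continuous_of_abs_sub_le (hul (r j))
    rw [← (hid k).map_eq, integral_map (hid k).aemeasurable_fst
      (Continuous.aestronglyMeasurable (by fun_prop))]
  have hone : ∀ k j w, j < n → |(∫ ω, u (r j) (w + V k ω) ∂P) - u (r (j + 1)) w| ≤ D j := by
    intro k j w hj
    rw [hVint, hrsucc, ← hmμ]
    rcases Nat.eq_zero_or_pos j with rfl | hj0
    · refine (hLip ν hν _ ε hμp hμ hε n hn (u (r 0)) (hul _) w).trans_eq ?_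
      simp only [hD, if_true, Nat.cast_zero]
      rw [Real.zero_rpow (neg_ne_zero.2 hp0.ne'), mul_zero, add_zero]
    · have hj0' : (0:ℝ) < j := by exact_mod_cast hj0
      have hrj : 0 < r j := by positivity
      have hr1 : r j ≤ 1 := by
        show (j : ℝ) ^ (1 / α) * s ≤ 1
        rw [← div_inv_eq_mul, hsinv]
        refine div_le_one_of_le₀ (Real.rpow_le_rpow hj0'.le (by exact_mod_cast hj.le) hp0.le)
          (by positivity)
      refine (hSm ν hν _ ε hμp hμ hε n hn _ _ _ (hTest ν hν g G hd hGc hG1 (r j) hrj) w).trans ?_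
      -- As `r j ≤ 1`, the constant `2` is absorbed into a multiple of `1 / r j`.
      have hM : max (C2 / r j) 2 ≤ (C2 + 2) * (s⁻¹ * (j : ℝ) ^ (-(1 / α))) := by
        have e : s⁻¹ * (j : ℝ) ^ (-(1 / α)) = (r j)⁻¹ := by
          show _ = ((j : ℝ) ^ (1 / α) * s)⁻¹
          rw [mul_inv, Real.rpow_neg hj0'.le, mul_comm]
        have h1r : 1 ≤ (r j)⁻¹ := (one_le_inv₀ hrj).2 hr1
        rw [e]
        refine max_le ?_ ?_
        · rw [div_eq_mul_inv]; gcongr; linarith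
        · nlinarith
      rw [← hs, ← hb, ← hQ, hD]
      simp only [hj0.ne', if_false, zero_add]
      calc _ ≤ C1 * ((C2 + 2) * (s⁻¹ * (j : ℝ) ^ (-(1 / α)))) * (s ^ 2 + (n : ℝ)⁻¹ * Q) := by
            gcongr
        _ = _ := by rw [hE]; ring
  -- The hybrids: `k` summands of the original sequence and `n - k` stable increments. They run from
  -- the stable law at `k = 0` to the normalized sum at `k = n`.
  set a : ℕ → ℝ := fun k => ∫ ω, u (r (n - k)) (S k ω) ∂P with ha
  have hstep : ∀ k ∈ Finset.range n, |a (k + 1) - a k| ≤ D (n - 1 - k) := by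
    intro k hk
    have hkn := Finset.mem_range.1 hk
    have e1 : n - (k + 1) = n - 1 - k := by omega
    have e2 : n - k = n - 1 - k + 1 := by omega
    have e3 : ∀ ω, S (k + 1) ω = S k ω + V k ω := fun ω => by
      rw [hS]; simp only [Finset.sum_range_succ, Pi.add_apply]
    simp only [ha, e1, e2, e3]
    exact abs_integral_comp_add_sub_le (hSi k) (hVi k) (hSV k) (hul _) (hul _)
      fun w => hone k _ w (by omega)
  have ha0 : a 0 = ∫ y, g y ∂ν := by
    have : r n = 1 := by
      show (n : ℝ) ^ (1 / α) * s = 1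
      rw [← div_inv_eq_mul, hsinv]
      exact div_self (by positivity)
    simp [ha, hS, hu, this]
  have han : a n = ∫ ω, g (normalizedSum P X α A n ω) ∂P := by
    have : r 0 = 0 := by simp [hr, hα0.ne']
    simp only [ha, Nat.sub_self, this, hu, zero_mul, add_zero, integral_const, probReal_univ,
      one_smul]
    congr 1 with ω
    rw [normalizedSum_eq_sum, hS]
    simp [hV, hm, hb]
  rw [← ha0, ← han, ← Finset.sum_range_sub]
  have hE0 : 0 ≤ E := by positivity
  calc _ ≤ ∑ k ∈ Finset.range n, |a (k + 1) - a k| := Finset.abs_sum_le_sum_abs _ _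
    _ ≤ ∑ k ∈ Finset.range n, D (n - 1 - k) := Finset.sum_le_sum hstep
    _ = ∑ j ∈ Finset.range n, D j := Finset.sum_range_reflect D n
    _ = C0 * s + E * ∑ j ∈ Finset.range n, (j : ℝ) ^ (-(1 / α)) := by
        rw [hD, Finset.sum_add_distrib, Finset.mul_sum, Finset.sum_ite_eq' ]
        simp [Nat.pos_iff_ne_zero.1 hn]
    _ ≤ C0 * s + E * ((1 - 1 / α)⁻¹ * (n : ℝ) ^ (1 - 1 / α)) := by
        gcongr
        refine le_trans ?_ (sum_range_succ_rpow_neg_le hp0 hp1 n)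
        rw [Finset.sum_range_succ]
        exact le_add_of_nonneg_right (by positivity)
    _ = C0 * s + C1 * (C2 + 2) * (1 - 1 / α)⁻¹ * ((n : ℝ) ^ (1 - 2 / α) + Q) := by
        have e1 : s⁻¹ * (n : ℝ) ^ (1 - 1 / α) = n := by
          rw [hsinv, ← Real.rpow_add hn0, add_sub_cancel, Real.rpow_one]
        have e2 : (n : ℝ) * s ^ 2 = (n : ℝ) ^ (1 - 2 / α) := by
          rw [hs, ← Real.rpow_natCast, ← Real.rpow_mul hn0.le, ← Real.rpow_one_add' hn0.le]
          · congr 1; push_cast; ring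
          · have : 2 / α ≠ 1 := by rw [Ne, div_eq_one_iff_eq hα0.ne']; linarith
            push_cast
            intro h
            apply this
            linarith [show -(1 / α) * 2 = -(2 / α) by ring]
        rw [hE, ← e2]
        calc _ = C0 * s + C1 * (C2 + 2) * (1 - 1 / α)⁻¹ * (s⁻¹ * (n : ℝ) ^ (1 - 1 / α)) *
              (s ^ 2 + (n : ℝ)⁻¹ * Q) := by ring
          _ = _ := by rw [e1]; field_simp
    _ ≤ C0 * ((n : ℝ) ^ (1 - 2 / α) + Q) +
        C1 * (C2 + 2) * (1 - 1 / α)⁻¹ * ((n : ℝ) ^ (1 - 2 / α) + Q) := by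
        gcongr
        refine le_add_of_le_of_nonneg (Real.rpow_le_rpow_of_exponent_le (by exact_mod_cast hn) ?_) hQ0
        linarith [show 2 / α = 1 / α + 1 / α by ring]
    _ = _ := by ring

/-! ### Reduction to continuously differentiable test functions. -/

/-- It suffices to bound the Wasserstein distance on continuously differentiable functions. -/
theorem wassersteinDist_le_of_forall_hasDerivAt {μ ν : Measure ℝ} [IsProbabilityMeasure μ]
    [IsProbabilityMeasure ν] (hμ : Integrable (fun x : ℝ => x) μ)
    (hν : Integrable (fun x : ℝ => x) ν) {D : ℝ}
    (h : ∀ g G : ℝ → ℝ, (∀ x, HasDerivAt g (G x) x) → Continuous G → (∀ x, |G x| ≤ 1) →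
      |(∫ x, g x ∂μ) - ∫ x, g x ∂ν| ≤ D) :
    wassersteinDist μ ν ≤ ENNReal.ofReal D := by
  refine iSup_le fun f => iSup_le fun hf => ENNReal.ofReal_le_ofReal ?_
  have hfl : ∀ x y, |f x - f y| ≤ |x - y| := fun x y => by
    simpa [Real.dist_eq] using hf.dist_le_mul x y
  have hfc := hf.continuous
  refine le_of_forall_pos_le_add fun η hη => ?_
  set δ := η / 2 with hδ
  have hδ0 : 0 < δ := by positivity
  -- The average of `f` over `[x, x + δ]`. It is within `δ` of `f` uniformly, and its derivative is
  -- a difference quotient of `f`, hence bounded by `1`. With `δ = η / 2`, the two laws together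
  -- cost `η`.
  set g : ℝ → ℝ := fun x => δ⁻¹ * ((∫ t in (0:ℝ)..(x + δ), f t) - ∫ t in (0:ℝ)..x, f t) with hg
  set G : ℝ → ℝ := fun x => δ⁻¹ * (f (x + δ) - f x) with hG
  have hF : ∀ x, HasDerivAt (fun x => ∫ t in (0:ℝ)..x, f t) (f x) x := fun x =>
    intervalIntegral.integral_hasDerivAt_right (hfc.intervalIntegrable _ _)
      (hfc.stronglyMeasurableAtFilter _ _) hfc.continuousAt
  have hd : ∀ x, HasDerivAt g (G x) x := fun x =>
    (((hF (x + δ)).comp_add_const x δ).sub (hF x)).const_mul δ⁻¹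
  have hGc : Continuous G := by fun_prop
  have hG1 : ∀ x, |G x| ≤ 1 := fun x => by
    have := hfl (x + δ) x
    rw [add_sub_cancel_left, abs_of_pos hδ0] at this
    rw [hG, abs_mul, abs_of_pos (inv_pos.2 hδ0), inv_mul_le_one₀ hδ0]
    exact this
  have hgl := abs_sub_le_of_hasDerivAt hd hG1
  have hclose : ∀ x, |f x - g x| ≤ δ := fun x => by
    have e : f x - g x = -(δ⁻¹ * ∫ t in x..(x + δ), (f t - f x)) := by
      rw [intervalIntegral.integral_sub (hfc.intervalIntegrable _ _) (by simp), hg]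
      simp only
      rw [intervalIntegral.integral_interval_sub_left (hfc.intervalIntegrable _ _)
        (hfc.intervalIntegrable _ _)]
      simp
      field_simp
      ring
    rw [e, abs_neg, abs_mul, abs_of_pos (inv_pos.2 hδ0), inv_mul_le_iff₀ hδ0]
    have := intervalIntegral.norm_integral_le_of_norm_le_const (a := x) (b := x + δ)
      (f := fun t => f t - f x) (C := δ) fun t ht => by
        rw [Set.uIoc_of_le (by linarith)] at ht
        refine (hfl t x).trans ?_
        rw [abs_of_pos (by linarith [ht.1])]
        linarith [ht.2]
    rwa [add_sub_cancel_left, abs_of_pos hδ0] at this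
  have hdiff : ∀ κ : Measure ℝ, IsProbabilityMeasure κ → Integrable (fun x : ℝ => x) κ →
      |(∫ x, f x ∂κ) - ∫ x, g x ∂κ| ≤ δ := fun κ _ hκ => by
    rw [← integral_sub (integrable_comp_of_abs_sub_le hfl hκ) (integrable_comp_of_abs_sub_le hgl hκ)]
    exact abs_integral_le_of_abs_le_const hclose
  have a1 := abs_le.1 (hdiff μ inferInstance hμ)
  have a2 := abs_le.1 (hdiff ν inferInstance hν)
  have a3 := abs_le.1 (h g G hd hGc hG1)
  rw [abs_le]
  constructor <;> linarith [a1.1, a1.2, a2.1, a2.2, a3.1, a3.2]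

/-! ### Estimates of the tail discrepancy. -/

theorem integrableOn_abs_rpow {s : ℝ} (hs : -1 < s) (b : ℝ) :
    IntegrableOn (fun x : ℝ => |x| ^ s) (Set.Icc (-b) b) := by
  have h : IntegrableOn ((Set.Iic b).indicator fun x : ℝ => x ^ s) (Set.Ioi 0) := by
    rw [integrableOn_indicator_iff measurableSet_Iic, Set.Iic_inter_Ioi]
    rcases le_total 0 b with hb | hb
    · exact integrableOn_Ioc_rpow hs hb
    · rw [Set.Ioc_eq_empty (not_lt.2 hb)]; exact integrableOn_empty
  refine (integrable_comp_abs h).integrableOn.congr_fun (fun x hx => ?_) measurableSet_Icc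
  simp only
  rw [Set.indicator_of_mem (show |x| ∈ Set.Iic b from abs_le.2 hx)]

theorem integrableOn_abs_rpow_mul_tailError {α β : ℝ} (h2 : α < 2)
    (hβ : β ∈ Set.Icc (-1 : ℝ) 1) {ε : ℝ → ℝ} (hε : Measurable ε) (hB : ∃ B, ∀ x, |ε x| ≤ B)
    (b : ℝ) : IntegrableOn (fun x => |x| ^ (1 - α) * tailError β ε x) (Set.Icc (-b) b) := by
  obtain ⟨B, hB⟩ := hB
  refine Integrable.mul_bdd (c := 2 * B) (integrableOn_abs_rpow (by linarith) b)
    (measurable_tailError β hε).aestronglyMeasurable (ae_of_all _ fun x => ?_)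
  rw [Real.norm_of_nonneg (tailError_nonneg hβ _ _)]
  exact (tailError_le hβ _ _).trans (by linarith [hB x])

/-- The discrepancy splits into the part of the tail correction below the scale `b`, and its
supremum above. -/
theorem tailDiscrepancy_le {α β : ℝ} (h1 : 1 < α) (h2 : α < 2) (hβ : β ∈ Set.Icc (-1 : ℝ) 1)
    {ε : ℝ → ℝ} (hε : Measurable ε) (hB : ∃ B, ∀ x, |ε x| ≤ B) {b D : ℝ} (hb : 0 < b)
    (hD : ∀ x, b ≤ |x| → tailError β ε x ≤ D) :
    tailDiscrepancy α β ε b ≤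
      b ^ (α - 2) * (∫ x in Set.Icc (-b) b, |x| ^ (1 - α) * tailError β ε x)
        + 2 / (α - 1) * D := by
  set g : ℝ → ℝ := (Set.Icc (-b) b).indicator fun x => |x| ^ (1 - α) * tailError β ε x with hg
  set k : ℝ → ℝ := (Set.Ioi 1).indicator fun x => x ^ (-α) with hk
  have hgi : Integrable g :=
    (integrableOn_abs_rpow_mul_tailError h2 hβ hε hB b).integrable_indicator measurableSet_Icc
  have hki : Integrable fun x => k |x| :=
    integrable_comp_abs ((integrableOn_Ioi_rpow_of_lt (by linarith) one_pos).integrable_indicator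
      measurableSet_Ioi).integrableOn
  have i1 : Integrable fun x => b ^ (α - 1) * g (b * x) := (hgi.comp_mul_left' hb.ne').const_mul _
  have i2 : Integrable fun x => k |x| * D := hki.mul_const D
  -- For `|x| ≤ 1` the weight is `|x|^(1-α)`, and rescaling to `b x` costs `b^(α-1)`, to which the
  -- Jacobian will add `b⁻¹`. For `|x| > 1` the weight is `|x|^(-α)` and the error is at most `D`.
  have hpt : ∀ x, levyWeight α x * tailError β ε (b * x) ≤
      b ^ (α - 1) * g (b * x) + k |x| * D := by
    intro x
    have t0 := tailError_nonneg hβ ε (b * x)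
    have g0 : 0 ≤ g (b * x) := Set.indicator_nonneg
      (fun z _ => mul_nonneg (by positivity) (tailError_nonneg hβ ε z)) _
    have hD0 : 0 ≤ D := (tailError_nonneg hβ ε b).trans (hD b (le_abs_self b))
    have hbx : |b * x| = b * |x| := by rw [abs_mul, abs_of_pos hb]
    rcases le_or_gt |x| 1 with hx | hx
    · have k0 : 0 ≤ k |x| * D :=
        mul_nonneg (Set.indicator_nonneg (fun z hz => Real.rpow_nonneg
          (zero_le_one.trans (le_of_lt hz)) _) _) hD0
      refine le_add_of_le_of_nonneg ?_ k0
      have hm : b * x ∈ Set.Icc (-b) b := by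
        rw [Set.mem_Icc, ← abs_le, hbx]; nlinarith
      rw [hg, Set.indicator_of_mem hm, hbx, Real.mul_rpow hb.le (abs_nonneg x)]
      rcases eq_or_ne x 0 with rfl | hx0
      · simp only [levyWeight, abs_zero, zero_le_one, inf_of_le_left, zero_mul, mul_zero]
        have := tailError_nonneg hβ ε 0
        positivity
      · refine le_of_eq ?_
        have ax : 0 < |x| := abs_pos.2 hx0
        have e : b ^ (α - 1) * b ^ (1 - α) = 1 := by
          rw [← Real.rpow_add hb]; simp
        rw [levyWeight, min_eq_left hx, ← Real.rpow_one_add' ax.le (by linarith),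
          ← sub_eq_add_neg]
        linear_combination (-(|x| ^ (1 - α) * tailError β ε (b * x))) * e
    · refine le_add_of_nonneg_of_le (by positivity) ?_
      rw [hk, Set.indicator_of_mem (show |x| ∈ Set.Ioi 1 from hx), levyWeight, min_eq_right hx.le,
        one_mul]
      gcongr
      exact hD _ (by rw [hbx]; nlinarith)
  refine (integral_mono (integrable_tailDiscrepancy h1 h2 hβ hε hB b) (i1.add i2) hpt).trans_eq ?_
  simp only [Pi.add_apply]
  rw [integral_add i1 i2, integral_const_mul, integral_mul_const,
    Measure.integral_comp_mul_left g b, integral_comp_abs (f := k), hg,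
    integral_indicator measurableSet_Icc, abs_of_pos (inv_pos.2 hb), smul_eq_mul, hk,
    setIntegral_indicator measurableSet_Ioi,
    Set.inter_eq_right.2 (Set.Ioi_subset_Ioi zero_le_one),
    integral_Ioi_rpow_of_lt (by linarith) one_pos, ← mul_assoc, ← Real.rpow_neg_one b,
    ← Real.rpow_add hb, Real.one_rpow, show -α + 1 = -(α - 1) by ring, neg_div_neg_eq]
  ring_nf

/-- A distribution function lies in `[0,1]`. Near the origin this bounds the weighted `ε`
independently of the law, where neither `K |x|^(-γ)` with `γ > 0` nor the qualitative boundedness of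
`ε` gives a uniform constant. -/
theorem InNormalAttraction.mul_add_mem_Icc {α β A : ℝ} {ε : ℝ → ℝ} {μ : Measure ℝ}
    [IsProbabilityMeasure μ] (h : InNormalAttraction α β A ε μ) {x : ℝ} (hx : x ≠ 0) :
    (if 0 < x then 1 + β else 1 - β) * (A + ε x) ∈ Set.Icc 0 (|x| ^ α) := by
  have hp : 0 < |x| ^ α := Real.rpow_pos_of_pos (abs_pos.2 hx) _
  have c0 := cdf_nonneg μ x
  have c1 := cdf_le_one μ x
  rcases lt_or_gt_of_ne hx with h0 | h0
  · rw [h.cdf_neg x h0, div_mul_eq_mul_div] at c0 c1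
    rw [if_neg h0.not_gt, mul_comm]
    exact ⟨by simpa using (le_div_iff₀ hp).1 c0, by simpa using (div_le_iff₀ hp).1 c1⟩
  · rw [h.cdf_pos x h0, div_mul_eq_mul_div] at c0 c1
    rw [if_pos h0, mul_comm]
    exact ⟨by simpa using (le_div_iff₀ hp).1 (show 0 ≤ (A + ε x) * (1 + β) / |x| ^ α by linarith),
      by simpa using (div_le_iff₀ hp).1 (show (A + ε x) * (1 + β) / |x| ^ α ≤ 1 by linarith)⟩

/-- For `|x| ≤ 1` the range of the distribution function gives `1 + 2 A`; for `|x| ≥ 1` the decay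
hypothesis gives `2 K |x|^(-γ)`. The exponent may be weakened to any `δ` in `[0, γ]`: the values
`0`, `2 - α` and `γ` are all used later. -/
theorem InNormalAttraction.tailError_le_rpow {α β A K γ δ : ℝ} (hα : 0 < α)
    (hβ : β ∈ Set.Icc (-1 : ℝ) 1) (hA : 0 < A) (hK : 0 < K) {ε : ℝ → ℝ} {μ : Measure ℝ}
    [IsProbabilityMeasure μ] (h : InNormalAttraction α β A ε μ)
    (hε : ∀ x : ℝ, x ≠ 0 → |ε x| ≤ K / |x| ^ γ) (hδ0 : 0 ≤ δ) (hδ : δ ≤ γ) {x : ℝ} (hx : x ≠ 0) :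
    tailError β ε x ≤ (2 * K + (1 + 2 * A)) * |x| ^ (-δ) := by
  have ax : 0 < |x| := abs_pos.2 hx
  have hp : 0 ≤ |x| ^ (-δ) := by positivity
  rcases le_total |x| 1 with h1 | h1
  · obtain ⟨m0, m1⟩ := h.mul_add_mem_Icc hx
    have hw : (if 0 < x then 1 + β else 1 - β) ∈ Set.Icc (0:ℝ) 2 := by
      constructor <;> split_ifs <;> linarith [hβ.1, hβ.2]
    have ht : tailError β ε x ≤ 1 + 2 * A := by
      have hxα : |x| ^ α ≤ 1 := Real.rpow_le_one ax.le h1 hα.le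
      rw [tailError]
      set w := if 0 < x then 1 + β else 1 - β
      rcases abs_cases (ε x) with ⟨e, _⟩ | ⟨e, _⟩
      · rw [e]; nlinarith [mul_nonneg hw.1 hA.le]
      · rw [e]; nlinarith [mul_le_mul_of_nonneg_right hw.2 hA.le]
    have h1p : 1 ≤ |x| ^ (-δ) := Real.one_le_rpow_of_pos_of_le_one_of_nonpos ax h1 (by linarith)
    nlinarith
  · have hle : |x| ^ (-γ) ≤ |x| ^ (-δ) := Real.rpow_le_rpow_of_exponent_le h1 (by linarith)
    have e := hε x hx
    rw [div_eq_mul_inv, ← Real.rpow_neg ax.le] at e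
    have := tailError_le hβ ε x
    nlinarith

/-- The tail correction, integrated below the scale `b`. -/
theorem integral_tailError_le {α β γ C : ℝ} (h2 : α < 2) (hβ : β ∈ Set.Icc (-1 : ℝ) 1)
    {ε : ℝ → ℝ} (hε : Measurable ε) (hB : ∃ B, ∀ x, |ε x| ≤ B) (hC : 0 ≤ C)
    (hC0 : ∀ x, x ≠ 0 → tailError β ε x ≤ C) (hC1 : ∀ x, x ≠ 0 → tailError β ε x ≤ C * |x| ^ (-γ))
    (b : ℝ) :
    ∫ x in Set.Icc (-b) b, |x| ^ (1 - α) * tailError β ε x ≤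
      C * (2 * (1 / (2 - α) + ∫ x in Set.Ioc 1 (max b 1), x ^ (1 - α - γ))) := by
  set H : ℝ → ℝ := (Set.Ioc 0 1).indicator (fun x => x ^ (1 - α)) +
    (Set.Ioc 1 (max b 1)).indicator (fun x => x ^ (1 - α - γ)) with hH
  have i1 : Integrable ((Set.Ioc (0:ℝ) 1).indicator (fun x => x ^ (1 - α))) :=
    (integrableOn_Ioc_rpow (by linarith) zero_le_one).integrable_indicator measurableSet_Ioc
  have i2 : Integrable ((Set.Ioc 1 (max b 1)).indicator (fun x => x ^ (1 - α - γ))) := by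
    refine IntegrableOn.integrable_indicator ?_ measurableSet_Ioc
    refine ContinuousOn.integrableOn_Icc ?_ |>.mono_set Set.Ioc_subset_Icc_self
    exact ContinuousOn.rpow_const continuousOn_id fun x hx => Or.inl (by simp at hx ⊢; linarith [hx.1])
  have hHi : Integrable H := i1.add i2
  have hH0 : ∀ x, 0 ≤ H x := fun x => add_nonneg
    (Set.indicator_nonneg (fun z hz => Real.rpow_nonneg hz.1.le _) _)
    (Set.indicator_nonneg (fun z hz => Real.rpow_nonneg (zero_le_one.trans hz.1.le) _) _)
  have hHa := integrable_comp_abs hHi.integrableOn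
  calc _ ≤ ∫ x in Set.Icc (-b) b, C * H |x| := by
        refine setIntegral_mono_on_ae (integrableOn_abs_rpow_mul_tailError h2 hβ hε hB b)
          (hHa.const_mul C).integrableOn measurableSet_Icc ?_
        filter_upwards [Measure.ae_ne volume (0 : ℝ)] with x hx hxb
        have ax : 0 < |x| := abs_pos.2 hx
        rcases le_or_gt |x| 1 with h1 | h1
        · rw [hH, Pi.add_apply, Set.indicator_of_mem (show |x| ∈ Set.Ioc 0 1 from ⟨ax, h1⟩),
            Set.indicator_of_notMem (fun h => absurd h.1 (not_lt.2 h1)), add_zero, mul_comm]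
          exact mul_le_mul_of_nonneg_right (hC0 x hx) (by positivity)
        · rw [hH, Pi.add_apply, Set.indicator_of_notMem (fun h => absurd h.2 (not_le.2 h1)),
            Set.indicator_of_mem (show |x| ∈ Set.Ioc 1 (max b 1) from
              ⟨h1, (abs_le.2 hxb).trans (le_max_left _ _)⟩), zero_add, sub_eq_add_neg (1 - α),
            Real.rpow_add ax]
          calc _ ≤ |x| ^ (1 - α) * (C * |x| ^ (-γ)) :=
                mul_le_mul_of_nonneg_left (hC1 x hx) (by positivity)
            _ = _ := by ring
    _ ≤ ∫ x, C * H |x| := setIntegral_le_integral (hHa.const_mul C)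
        (ae_of_all _ fun x => mul_nonneg hC (hH0 _))
    _ = C * (2 * ∫ x in Set.Ioi 0, H x) := by
        rw [integral_const_mul, integral_comp_abs (f := H)]
    _ = _ := by
        rw [hH]
        simp only [Pi.add_apply]
        rw [integral_add i1.integrableOn i2.integrableOn,
          setIntegral_indicator measurableSet_Ioc, setIntegral_indicator measurableSet_Ioc,
          Set.inter_eq_right.2 Set.Ioc_subset_Ioi_self, Set.inter_eq_right.2
            (Set.Ioc_subset_Ioi_self.trans (Set.Ioi_subset_Ioi zero_le_one)),
          ← intervalIntegral.integral_of_le zero_le_one, integral_rpow (Or.inl (by linarith)),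
          Real.one_rpow, Real.zero_rpow (by linarith), sub_zero, show 1 - α + 1 = 2 - α by ring]

theorem scale_rpow {α A : ℝ} (h1 : 1 < α) (h2 : α < 2) (hA : 0 < A) (n : ℕ) (p : ℝ) :
    (stableScale α A * (n : ℝ) ^ (1 / α)) ^ p = stableScale α A ^ p * (n : ℝ) ^ (p / α) := by
  rw [Real.mul_rpow (stableScale_pos h1 h2 hA).le (by positivity), ← Real.rpow_mul n.cast_nonneg]
  congr 2; ring

theorem scale_rpow_sub_two {α A : ℝ} (h1 : 1 < α) (h2 : α < 2) (hA : 0 < A) (n : ℕ) :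
    (stableScale α A * (n : ℝ) ^ (1 / α)) ^ (α - 2) =
      stableScale α A ^ (α - 2) * (n : ℝ) ^ (1 - 2 / α) := by
  rw [scale_rpow h1 h2 hA]
  congr 2
  have : α ≠ 0 := by linarith
  field_simp

theorem scale_pos {α A : ℝ} (h1 : 1 < α) (h2 : α < 2) (hA : 0 < A) {n : ℕ} (hn : 1 ≤ n) :
    0 < stableScale α A * (n : ℝ) ^ (1 / α) :=
  mul_pos (stableScale_pos h1 h2 hA) (Real.rpow_pos_of_pos (by exact_mod_cast hn) _)

theorem abs_le_of_abs_le_div_rpow {K γ : ℝ} (hγ : 0 ≤ γ) (hK : 0 < K) {ε : ℝ → ℝ}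
    (hε : ∀ x : ℝ, x ≠ 0 → |ε x| ≤ K / |x| ^ γ) (x : ℝ) (hx : 1 ≤ |x|) : |ε x| ≤ K :=
  (hε x (abs_pos.1 (zero_lt_one.trans_le hx))).trans
    (div_le_self hK.le (Real.one_le_rpow hx hγ))

/-- Here the decay bound can be used even at the origin, because `α + γ < 2` keeps the combined
weight integrable. -/
theorem InNormalAttraction.tailDiscrepancy_le_rpow {α β A K γ : ℝ} (h1 : 1 < α) (h2 : α < 2)
    (hβ : β ∈ Set.Icc (-1 : ℝ) 1) (hA : 0 < A) (hK : 0 < K) (hγ : 0 ≤ γ) (hγα : γ < 2 - α)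
    {ε : ℝ → ℝ} {μ : Measure ℝ} [IsProbabilityMeasure μ] (h : InNormalAttraction α β A ε μ)
    (hε : ∀ x : ℝ, x ≠ 0 → |ε x| ≤ K / |x| ^ γ) {b : ℝ} (hb : 0 < b) :
    tailDiscrepancy α β ε b ≤
      (2 * K + (1 + 2 * A)) * (∫ x, levyWeight (α + γ) x) * b ^ (-γ) := by
  have hi := integrable_levyWeight (α := α + γ) (by linarith) (by linarith)
  refine (integral_mono_ae (integrable_tailDiscrepancy h1 h2 hβ h.measurable h.bounded b)
    (hi.const_mul ((2 * K + (1 + 2 * A)) * b ^ (-γ))) ?_).trans_eq ?_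
  · filter_upwards [Measure.ae_ne volume (0 : ℝ)] with x hx
    have ax : 0 < |x| := abs_pos.2 hx
    have t := h.tailError_le_rpow (by linarith) hβ hA hK hε hγ le_rfl (mul_ne_zero hb.ne' hx)
    rw [abs_mul, abs_of_pos hb, Real.mul_rpow hb.le ax.le] at t
    refine (mul_le_mul_of_nonneg_left t (levyWeight_nonneg α x)).trans_eq ?_
    rw [levyWeight, levyWeight, neg_add, Real.rpow_add ax]
    ring
  · rw [integral_const_mul]; ring

/-- Now `|x|^(1-α-γ)` is not integrable at `0`, so the uniform bound is used on `|x| ≤ 1` and the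
decay only beyond. The remaining integral is bounded for `γ > 2 - α` and logarithmic for `γ = 2 -
α`. -/
theorem InNormalAttraction.tailDiscrepancy_le_rpow_mul_integral {α β A K γ : ℝ} (h1 : 1 < α)
    (h2 : α < 2) (hβ : β ∈ Set.Icc (-1 : ℝ) 1) (hA : 0 < A) (hK : 0 < K) (hγ : 2 - α ≤ γ)
    {ε : ℝ → ℝ} {μ : Measure ℝ} [IsProbabilityMeasure μ] (h : InNormalAttraction α β A ε μ)
    (hε : ∀ x : ℝ, x ≠ 0 → |ε x| ≤ K / |x| ^ γ) {b : ℝ} (hb : 0 < b) :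
    tailDiscrepancy α β ε b ≤ (2 * K + (1 + 2 * A)) * b ^ (α - 2) *
      (2 / (2 - α) + 2 / (α - 1) + 2 * ∫ x in Set.Ioc 1 (max b 1), x ^ (1 - α - γ)) := by
  set C := 2 * K + (1 + 2 * A) with hC
  have hC0 : 0 < C := by positivity
  have ht := fun δ h0 h1' x hx => h.tailError_le_rpow (δ := δ) (x := x) (by linarith) hβ hA hK hε h0 h1' hx
  refine (tailDiscrepancy_le h1 h2 hβ h.measurable h.bounded hb (D := C * b ^ (α - 2))
    fun x hx => ?_).trans ?_
  · have ax : 0 < |x| := hb.trans_le hx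
    refine (ht (2 - α) (by linarith) hγ x (abs_pos.1 ax)).trans
      (mul_le_mul_of_nonneg_left ?_ hC0.le)
    rw [neg_sub]
    exact Real.rpow_le_rpow_of_nonpos hb hx (by linarith)
  · have := integral_tailError_le h2 hβ h.measurable h.bounded hC0.le (γ := γ)
      (fun x hx => by simpa using ht 0 le_rfl (by linarith) x hx)
      (fun x hx => ht γ (by linarith) le_rfl x hx) b
    have hp : 0 ≤ b ^ (α - 2) := by positivity
    refine (add_le_add (mul_le_mul_of_nonneg_left this hp) le_rfl).trans_eq ?_
    ring

theorem integral_Ioc_rpow_le {s : ℝ} (hs : s < -1) (b : ℝ) :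
    ∫ x in Set.Ioc 1 b, x ^ s ≤ -1 / (s + 1) := by
  have := integral_Ioi_rpow_of_lt hs one_pos
  rw [Real.one_rpow] at this
  rw [← this]
  refine setIntegral_mono_set (integrableOn_Ioi_rpow_of_lt hs one_pos) ?_
    (Set.Ioc_subset_Ioi_self.eventuallyLE)
  filter_upwards [ae_restrict_mem measurableSet_Ioi] with x hx
  exact Real.rpow_nonneg (zero_le_one.trans (le_of_lt hx)) _

theorem integral_Ioc_max_rpow_neg_one_le {b : ℝ} (hb : 0 < b) :
    ∫ x in Set.Ioc 1 (max b 1), x ^ (-1 : ℝ) ≤ |Real.log b| := by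
  simp only [Real.rpow_neg_one]
  rw [← intervalIntegral.integral_of_le (le_max_right _ _),
    integral_inv_of_pos one_pos (lt_max_of_lt_left hb), div_one]
  rcases le_total b 1 with h | h
  · rw [max_eq_right h, Real.log_one]; exact abs_nonneg _
  · rw [max_eq_left h]; exact le_abs_self _

/-- Near the origin, on the heavier side, the correction has to cancel half of the main term. -/
theorem InNormalAttraction.exists_half_le_abs {α β A : ℝ} (hα : 0 < α) (hA : 0 < A) {ε : ℝ → ℝ}
    {μ : Measure ℝ} [IsProbabilityMeasure μ] (h : InNormalAttraction α β A ε μ) {t : ℝ}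
    (ht : 0 < t) (htA : t ^ α ≤ A / 2) :
    ∃ s : Set ℝ, MeasurableSet s ∧ volume.real s = t ∧ s ⊆ Set.Icc (-t) t ∧
      ∀ x ∈ s, x ≠ 0 ∧ A / 2 ≤ |ε x| := by
  have key : ∀ x, x ≠ 0 → |x| ≤ t → 1 ≤ (if 0 < x then 1 + β else 1 - β) → A / 2 ≤ |ε x| := by
    intro x hx hxt hw
    have hm := (h.mul_add_mem_Icc hx).2
    have hxα : |x| ^ α ≤ t ^ α := Real.rpow_le_rpow (abs_nonneg x) hxt hα.le
    set w := if 0 < x then 1 + β else 1 - β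
    have : A + ε x ≤ A / 2 := by
      by_contra! hcon
      nlinarith
    linarith [neg_abs_le (ε x)]
  rcases le_total 0 β with hβ | hβ
  · refine ⟨Set.Ioc 0 t, measurableSet_Ioc, by simp [ht.le], fun x hx => ⟨by linarith [hx.1], hx.2⟩,
      fun x hx => ⟨hx.1.ne', key x hx.1.ne' ?_ ?_⟩⟩
    · rw [abs_of_pos hx.1]; exact hx.2
    · rw [if_pos hx.1]; linarith
  · refine ⟨Set.Ico (-t) 0, measurableSet_Ico, by simp [ht.le],
      fun x hx => ⟨hx.1, by linarith [hx.2]⟩, fun x hx => ⟨hx.2.ne, key x hx.2.ne ?_ ?_⟩⟩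
    · rw [abs_of_neg hx.2]; linarith [hx.1]
    · rw [if_neg hx.2.not_gt]; linarith

/-- A lower bound that does not depend on the law; it lets the integral term of the case `γ = 0`
absorb the bare `n^(1-2/α)`. -/
theorem InNormalAttraction.le_integral_abs {α β A : ℝ} (h1 : 1 < α) (h2 : α < 2) (hA : 0 < A)
    {ε : ℝ → ℝ} {μ : Measure ℝ} [IsProbabilityMeasure μ] (h : InNormalAttraction α β A ε μ) {t b : ℝ}
    (ht : 0 < t) (htA : t ^ α ≤ A / 2) (htb : t ≤ b) :
    A / 2 * t ^ (1 - α) * t ≤ ∫ x in Set.Icc (-b) b, |x| ^ (1 - α) * |ε x| := by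
  have hi : IntegrableOn (fun x => |x| ^ (1 - α) * |ε x|) (Set.Icc (-b) b) := by
    have := integrableOn_abs_rpow_mul_tailError (β := 0) h2 (by simp) h.measurable h.bounded b
    simpa [tailError] using this
  obtain ⟨s, hs, hvol, hst, hse⟩ := h.exists_half_le_abs (by linarith) hA ht htA
  have hsb : s ⊆ Set.Icc (-b) b := hst.trans (Set.Icc_subset_Icc (by linarith) htb)
  calc A / 2 * t ^ (1 - α) * t = ∫ x in s, A / 2 * t ^ (1 - α) := by
        rw [setIntegral_const, hvol, smul_eq_mul, mul_comm]
    _ ≤ ∫ x in s, |x| ^ (1 - α) * |ε x| := by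
        refine setIntegral_mono_on (integrableOn_const ?_) (hi.mono_set hsb) hs fun x hx => ?_
        · refine (measure_mono hst).trans_lt ?_ |>.ne
          rw [Real.volume_Icc]; exact ENNReal.ofReal_lt_top
        · rw [mul_comm]
          have ax := abs_pos.2 (hse x hx).1
          refine mul_le_mul ?_ (hse x hx).2 (by positivity) (by positivity)
          exact Real.rpow_le_rpow_of_nonpos ax (abs_le.2 (hst hx)) (by linarith)
    _ ≤ _ := setIntegral_mono_set hi (ae_of_all _ fun x => by positivity) hsb.eventuallyLE

/-! ### The four rates. -/

/-- The rate when the tail correction decays faster than `|x|^(α - 2)`. -/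
theorem InNormalAttraction.exists_rate_of_gt {α β A K γ : ℝ} (h1 : 1 < α) (h2 : α < 2)
    (hβ : β ∈ Set.Icc (-1 : ℝ) 1) (hA : 0 < A) (hK : 0 < K) (hγ : 2 - α < γ) :
    ∃ c : ℝ, 0 < c ∧ ∀ (ε : ℝ → ℝ) (μ : Measure ℝ), IsProbabilityMeasure μ →
      InNormalAttraction α β A ε μ → (∀ x : ℝ, x ≠ 0 → |ε x| ≤ K / |x| ^ γ) → ∀ n : ℕ, 1 ≤ n →
      (n : ℝ) ^ (1 - 2 / α) + tailDiscrepancy α β ε (stableScale α A * (n : ℝ) ^ (1 / α)) ≤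
        c * (n : ℝ) ^ (1 - 2 / α) := by
  have hσ := stableScale_pos h1 h2 hA
  have a1 : 0 < 2 - α := by linarith
  have a2 : 0 < α - 1 := by linarith
  have a3 : 0 < γ + α - 2 := by linarith
  refine ⟨1 + (2 * K + (1 + 2 * A)) * stableScale α A ^ (α - 2) *
    (2 / (2 - α) + 2 / (α - 1) + 2 * (1 / (γ + α - 2))), by positivity,
    fun ε μ _ h hε n hn => ?_⟩
  have hb := scale_pos h1 h2 hA hn
  have hI := integral_Ioc_rpow_le (s := 1 - α - γ) (by linarith)
    (max (stableScale α A * (n : ℝ) ^ (1 / α)) 1)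
  rw [show 1 - α - γ + 1 = -(γ + α - 2) by ring, neg_div_neg_eq] at hI
  calc _ ≤ (n : ℝ) ^ (1 - 2 / α) + (2 * K + (1 + 2 * A)) *
        (stableScale α A * (n : ℝ) ^ (1 / α)) ^ (α - 2) *
        (2 / (2 - α) + 2 / (α - 1) + 2 * (1 / (γ + α - 2))) := by
        refine add_le_add le_rfl
          ((h.tailDiscrepancy_le_rpow_mul_integral h1 h2 hβ hA hK hγ.le hε hb).trans ?_)
        gcongr
    _ = _ := by rw [scale_rpow_sub_two h1 h2 hA]; ring

/-- The rate when the tail correction decays like `|x|^(α - 2)`. -/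
theorem InNormalAttraction.exists_rate_of_eq {α β A K γ : ℝ} (h1 : 1 < α) (h2 : α < 2)
    (hβ : β ∈ Set.Icc (-1 : ℝ) 1) (hA : 0 < A) (hK : 0 < K) (hγ : γ = 2 - α) :
    ∃ c : ℝ, 0 < c ∧ ∀ (ε : ℝ → ℝ) (μ : Measure ℝ), IsProbabilityMeasure μ →
      InNormalAttraction α β A ε μ → (∀ x : ℝ, x ≠ 0 → |ε x| ≤ K / |x| ^ γ) → ∀ n : ℕ, 2 ≤ n →
      (n : ℝ) ^ (1 - 2 / α) + tailDiscrepancy α β ε (stableScale α A * (n : ℝ) ^ (1 / α)) ≤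
        c * ((n : ℝ) ^ (1 - 2 / α) * Real.log n) := by
  have hσ := stableScale_pos h1 h2 hA
  set σ := stableScale α A with hσdef
  have a1 : 0 < 2 - α := by linarith
  have a2 : 0 < α - 1 := by linarith
  have hα0 : 0 < α := by linarith
  have hl2 : 0 < Real.log 2 := Real.log_pos one_lt_two
  set E := 2 / (2 - α) + 2 / (α - 1) + 2 * |Real.log σ| with hE
  have hE0 : 0 < E := by positivity
  set B := (2 * K + (1 + 2 * A)) * σ ^ (α - 2) with hB
  have hB0 : 0 < B := by positivity
  refine ⟨(1 + B * E) / Real.log 2 + B * (2 / α), by positivity, fun ε μ _ h hε n hn => ?_⟩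
  have hn1 : 1 ≤ n := by omega
  have hn0 : (0:ℝ) < n := by exact_mod_cast hn1
  have hb := scale_pos h1 h2 hA hn1
  have hlog : Real.log 2 ≤ Real.log n := Real.log_le_log two_pos (by exact_mod_cast hn)
  have hI := integral_Ioc_max_rpow_neg_one_le hb
  have hlb : |Real.log (σ * (n : ℝ) ^ (1 / α))| ≤ |Real.log σ| + 1 / α * Real.log n := by
    rw [Real.log_mul hσ.ne' (by positivity), Real.log_rpow hn0]
    refine (abs_add_le _ _).trans_eq ?_
    rw [abs_of_nonneg (a := 1 / α * Real.log n) (mul_nonneg (by positivity) (by linarith))]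
  have hQ := h.tailDiscrepancy_le_rpow_mul_integral h1 h2 hβ hA hK hγ.ge hε hb
  rw [show 1 - α - γ = -1 by rw [hγ]; ring, scale_rpow_sub_two h1 h2 hA] at hQ
  set N := (n : ℝ) ^ (1 - 2 / α) with hN
  have hN0 : 0 < N := by positivity
  calc _ ≤ N + B * N * (E + 2 / α * Real.log n) := by
        refine add_le_add le_rfl (hQ.trans ?_)
        calc _ ≤ (2 * K + (1 + 2 * A)) * (σ ^ (α - 2) * N) * (2 / (2 - α) + 2 / (α - 1)
              + 2 * (|Real.log σ| + 1 / α * Real.log n)) := by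
              gcongr
              exact hI.trans hlb
          _ = _ := by rw [hB, hE]; ring
    _ = (1 + B * E) * N * 1 + B * N * (2 / α) * Real.log n := by ring
    -- The terms without a logarithm are absorbed by `1 ≤ log n / log 2`, which is why `n ≥ 2` is
    -- needed.
    _ ≤ (1 + B * E) * N * (Real.log n / Real.log 2) + B * N * (2 / α) * Real.log n := by
        gcongr
        exact (one_le_div hl2).2 hlog
    _ = _ := by ring

/-- The rate when the tail correction decays slower than `|x|^(α - 2)`. -/
theorem InNormalAttraction.exists_rate_of_lt {α β A K γ : ℝ} (h1 : 1 < α) (h2 : α < 2)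
    (hβ : β ∈ Set.Icc (-1 : ℝ) 1) (hA : 0 < A) (hK : 0 < K) (hγ : 0 < γ) (hγα : γ < 2 - α) :
    ∃ c : ℝ, 0 < c ∧ ∀ (ε : ℝ → ℝ) (μ : Measure ℝ), IsProbabilityMeasure μ →
      InNormalAttraction α β A ε μ → (∀ x : ℝ, x ≠ 0 → |ε x| ≤ K / |x| ^ γ) → ∀ n : ℕ, 1 ≤ n →
      (n : ℝ) ^ (1 - 2 / α) + tailDiscrepancy α β ε (stableScale α A * (n : ℝ) ^ (1 / α)) ≤
        c * (n : ℝ) ^ (-((α - 1) * γ / (α * (1 - γ)))) := by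
  have hσ := stableScale_pos h1 h2 hA
  have hα0 : 0 < α := by linarith
  have hγ1 : 0 < 1 - γ := by linarith
  have hw : 0 ≤ ∫ x, levyWeight (α + γ) x := integral_nonneg fun x => levyWeight_nonneg _ x
  refine ⟨1 + (2 * K + (1 + 2 * A)) * (∫ x, levyWeight (α + γ) x) * stableScale α A ^ (-γ),
    by positivity, fun ε μ _ h hε n hn => ?_⟩
  have hn1 : (1:ℝ) ≤ n := by exact_mod_cast hn
  have hb := scale_pos h1 h2 hA hn
  have hQ := h.tailDiscrepancy_le_rpow h1 h2 hβ hA hK hγ.le hγα hε hb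
  rw [scale_rpow h1 h2 hA] at hQ
  -- The argument yields the rate `n^(-γ/α)`, which is stronger than the one claimed, since `γ < 2 -
  -- α` means `α - 1 < 1 - γ`.
  have e1 : (n : ℝ) ^ (-γ / α) ≤ (n : ℝ) ^ (-((α - 1) * γ / (α * (1 - γ)))) := by
    refine Real.rpow_le_rpow_of_exponent_le hn1 ?_
    rw [neg_div, neg_le_neg_iff, div_le_div_iff₀ (by positivity) hα0]
    nlinarith [mul_pos hα0 hγ]
  have e2 : (n : ℝ) ^ (1 - 2 / α) ≤ (n : ℝ) ^ (-γ / α) := by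
    refine Real.rpow_le_rpow_of_exponent_le hn1 ?_
    rw [one_sub_div hα0.ne']
    gcongr
    linarith
  calc _ ≤ (n : ℝ) ^ (-γ / α) + (2 * K + (1 + 2 * A)) * (∫ x, levyWeight (α + γ) x) *
        (stableScale α A ^ (-γ) * (n : ℝ) ^ (-γ / α)) := add_le_add e2 hQ
    _ = (1 + (2 * K + (1 + 2 * A)) * (∫ x, levyWeight (α + γ) x) * stableScale α A ^ (-γ)) *
        (n : ℝ) ^ (-γ / α) := by ring
    _ ≤ _ := by gcongr

/-- The rate for a tail correction that is only bounded. -/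
theorem InNormalAttraction.exists_rate_of_bounded {α β A K : ℝ} (h1 : 1 < α) (h2 : α < 2)
    (hβ : β ∈ Set.Icc (-1 : ℝ) 1) (hA : 0 < A) (hK : 0 < K) :
    ∃ c : ℝ, 0 < c ∧ ∀ (ε : ℝ → ℝ) (μ : Measure ℝ), IsProbabilityMeasure μ →
      InNormalAttraction α β A ε μ → (∀ x : ℝ, x ≠ 0 → |ε x| ≤ K) → ∀ n : ℕ, 1 ≤ n →
      (n : ℝ) ^ (1 - 2 / α) + tailDiscrepancy α β ε (stableScale α A * (n : ℝ) ^ (1 / α)) ≤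
        c * ((n : ℝ) ^ (1 - 2 / α) *
          (∫ x in (-(stableScale α A * (n : ℝ) ^ (1 / α)))..
            (stableScale α A * (n : ℝ) ^ (1 / α)), |ε x| / |x| ^ (α - 1)) +
          (⨆ x : {x : ℝ // stableScale α A * (n : ℝ) ^ (1 / α) ≤ |x|}, |ε x|) ^ (α - 1)) := by
  have hσ := stableScale_pos h1 h2 hA
  have hα0 : 0 < α := by linarith
  have a2 : 0 < α - 1 := by linarith
  -- The second entry ensures `t^α ≤ A / 2`; the first ensures `t ≤ b` for every `n ≥ 1`.
  set t := min (stableScale α A) ((A / 2) ^ (1 / α)) with ht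
  have ht0 : 0 < t := lt_min hσ (by positivity)
  have htA : t ^ α ≤ A / 2 := by
    calc t ^ α ≤ ((A / 2) ^ (1 / α)) ^ α := Real.rpow_le_rpow ht0.le (min_le_right _ _) hα0.le
      _ = A / 2 := by rw [← Real.rpow_mul (by positivity), one_div_mul_cancel hα0.ne', Real.rpow_one]
  set c0 := A / 2 * t ^ (1 - α) * t with hc0
  have hc0p : 0 < c0 := by positivity
  set c1 := 1 / c0 + 2 * stableScale α A ^ (α - 2) with hc1
  set c2 := 4 / (α - 1) * K ^ (2 - α) with hc2
  refine ⟨c1 + c2, by positivity, fun ε μ _ h hε n hn => ?_⟩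
  have hn1 : (1:ℝ) ≤ n := by exact_mod_cast hn
  have hb := scale_pos h1 h2 hA hn
  have hbt : t ≤ stableScale α A * (n : ℝ) ^ (1 / α) := (min_le_left _ _).trans
    (le_mul_of_one_le_right hσ.le (Real.one_le_rpow hn1 (by positivity)))
  have hb2 := scale_rpow_sub_two h1 h2 hA n
  set b := stableScale α A * (n : ℝ) ^ (1 / α) with hbdef
  set N := (n : ℝ) ^ (1 - 2 / α) with hN
  have hN0 : 0 < N := Real.rpow_pos_of_pos (by linarith) _
  set S := ⨆ x : {x : ℝ // b ≤ |x|}, |ε x| with hS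
  obtain ⟨B, hB⟩ := h.bounded
  have hbdd : BddAbove (Set.range fun x : {x : ℝ // b ≤ |x|} => |ε x|) :=
    ⟨B, Set.forall_mem_range.2 fun x => hB x⟩
  have hleS : ∀ x, b ≤ |x| → |ε x| ≤ S := fun x hx => le_ciSup hbdd ⟨x, hx⟩
  have hne : Nonempty {x : ℝ // b ≤ |x|} := ⟨⟨b, le_abs_self b⟩⟩
  have hSK : S ≤ K := ciSup_le fun x => hε x (abs_pos.1 (hb.trans_le x.2))
  have hS0 : 0 ≤ S := (abs_nonneg _).trans (hleS b (le_abs_self b))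
  -- The argument gives the supremum to the first power. It is weakened to the power `α - 1` through
  -- `S ≤ K` and `(2 - α) + (α - 1) = 1`.
  have hSpow : S ≤ K ^ (2 - α) * S ^ (α - 1) := by
    calc S = S ^ (2 - α) * S ^ (α - 1) := by
          rw [← Real.rpow_add' hS0 (by norm_num), show 2 - α + (α - 1) = 1 by ring, Real.rpow_one]
      _ ≤ _ := by
          refine mul_le_mul_of_nonneg_right ?_ (by positivity)
          exact Real.rpow_le_rpow hS0 hSK (by linarith)
  have hi : IntegrableOn (fun x => |x| ^ (1 - α) * |ε x|) (Set.Icc (-b) b) := by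
    have := integrableOn_abs_rpow_mul_tailError (β := 0) h2 (by simp) h.measurable h.bounded b
    simpa [tailError] using this
  have hI : ∫ x in (-b)..b, |ε x| / |x| ^ (α - 1) =
      ∫ x in Set.Icc (-b) b, |x| ^ (1 - α) * |ε x| := by
    rw [intervalIntegral.integral_of_le (by linarith), integral_Icc_eq_integral_Ioc]
    congr 1 with x
    rw [← neg_sub α 1, Real.rpow_neg (abs_nonneg x), div_eq_mul_inv, mul_comm]
  rw [hI]
  have hlow := h.le_integral_abs h1 h2 hA ht0 htA hbt
  set I := ∫ x in Set.Icc (-b) b, |x| ^ (1 - α) * |ε x| with hIdef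
  have hI0 : 0 < I := hc0p.trans_le hlow
  have hQ := tailDiscrepancy_le h1 h2 hβ h.measurable h.bounded hb (D := 2 * S)
    fun x hx => (tailError_le hβ ε x).trans (mul_le_mul_of_nonneg_left (hleS x hx) two_pos.le)
  have hT : ∫ x in Set.Icc (-b) b, |x| ^ (1 - α) * tailError β ε x ≤ 2 * I := by
    rw [hIdef, ← integral_const_mul]
    refine setIntegral_mono (integrableOn_abs_rpow_mul_tailError h2 hβ h.measurable h.bounded b)
      (hi.const_mul 2) fun x => ?_
    calc _ ≤ |x| ^ (1 - α) * (2 * |ε x|) :=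
          mul_le_mul_of_nonneg_left (tailError_le hβ ε x) (by positivity)
      _ = _ := by ring
  rw [hb2] at hQ
  have hS1 : 0 ≤ S ^ (α - 1) := by positivity
  calc _ ≤ N * (I / c0) + (stableScale α A ^ (α - 2) * N * (2 * I)
        + 2 / (α - 1) * (2 * (K ^ (2 - α) * S ^ (α - 1)))) := by
        refine add_le_add ?_ (hQ.trans ?_)
        · exact le_mul_of_one_le_right hN0.le ((one_le_div hc0p).2 hlow)
        · gcongr
    _ = c1 * (N * I) + c2 * S ^ (α - 1) := by rw [hc1, hc2]; ring
    _ ≤ c1 * (N * I) + c2 * S ^ (α - 1) + (c2 * (N * I) + c1 * S ^ (α - 1)) :=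
        le_add_of_nonneg_right (by positivity)
    _ = _ := by ring

/-! ### Assembly. -/

/-- The Wasserstein distance to the stable law, in terms of the discrepancy of the tails. -/
theorem exists_wassersteinDist_normalizedSum_le {α β γ A K : ℝ} (h1 : 1 < α) (h2 : α < 2)
    (hβ : β ∈ Set.Icc (-1 : ℝ) 1) (hγ : 0 ≤ γ) (hA : 0 < A) (hK : 0 < K) :
    ∃ C : ℝ, 0 < C ∧ ∀ ν : Measure ℝ, IsStableLaw α 1 β ν →
      ∀ (Ω : Type*) [MeasurableSpace Ω] (P : Measure Ω) [IsProbabilityMeasure P]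
        (X : ℕ → Ω → ℝ) (ε : ℝ → ℝ), iIndepFun X P → (∀ i, IdentDistrib (X i) (X 0) P P) →
        InNormalAttraction α β A ε (P.map (X 0)) → (∀ x : ℝ, x ≠ 0 → |ε x| ≤ K / |x| ^ γ) →
        Integrable (X 0) P ∧ Integrable (fun x : ℝ => x) ν ∧ IsProbabilityMeasure (P.map (X 0)) ∧
        ∀ (n : ℕ) (D : ℝ), 1 ≤ n →
          (n : ℝ) ^ (1 - 2 / α) +
            tailDiscrepancy α β ε (stableScale α A * (n : ℝ) ^ (1 / α)) ≤ D →
          wassersteinDist (P.map (normalizedSum P X α A n)) ν ≤ ENNReal.ofReal (C * D) := by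
  obtain ⟨C, hC0, hC⟩ := abs_integral_normalizedSum_sub_le h1 h2 hβ hA hK
  refine ⟨C + 1, by positivity, fun ν hν Ω _ P _ X ε hind hid hμ hε => ?_⟩
  have hε1 := abs_le_of_abs_le_div_rpow hγ hK hε
  have hνp := hν.isProbabilityMeasure
  have hνid := hν.integrable_id h1 h2 hβ
  have hX0 : AEMeasurable (X 0) P := (hid 0).aemeasurable_snd
  have hμp : IsProbabilityMeasure (P.map (X 0)) := Measure.isProbabilityMeasure_map hX0
  have hXi0 : Integrable (X 0) P := (integrable_map_measure (by fun_prop) hX0).1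
    (hμ.integrable_id_and_le h1 hβ (by positivity) hε1).1
  refine ⟨hXi0, hνid, hμp, fun n D hn hD => ?_⟩
  have hXi : ∀ i, Integrable (X i) P := fun i => (hid i).integrable_iff.2 hXi0
  have hSi : Integrable (normalizedSum P X α A n) P :=
    ((integrable_finsetSum _ fun i _ => hXi i).sub (integrable_const _)).const_mul _
  have hSp : IsProbabilityMeasure (P.map (normalizedSum P X α A n)) :=
    Measure.isProbabilityMeasure_map hSi.aemeasurable
  have hQ0 : 0 ≤ tailDiscrepancy α β ε (stableScale α A * (n : ℝ) ^ (1 / α)) :=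
    integral_nonneg fun x => mul_nonneg (levyWeight_nonneg α x) (tailError_nonneg hβ _ _)
  have hD0 : 0 ≤ D := le_trans (by positivity) hD
  refine wassersteinDist_le_of_forall_hasDerivAt
    ((integrable_map_measure (by fun_prop) hSi.aemeasurable).2 hSi) hνid fun g G hd hG hb => ?_
  rw [integral_map hSi.aemeasurable (continuous_of_hasDerivAt hd).aestronglyMeasurable]
  refine (hC ν hν Ω P X ε hind hid hμ hε1 n hn g G hd hG hb).trans ?_
  nlinarith [mul_le_mul_of_nonneg_left hD hC0]

end

theorem theorem2 (α β γ A K : ℝ) (hα1 : 1 < α) (hα2 : α < 2) (hβ : β ∈ Set.Icc (-1 : ℝ) 1)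
    (hγ : 0 ≤ γ) (hA : 0 < A) (hK : 0 < K) :
    ∃ c : ℝ, 0 < c ∧
      ∀ (ν : Measure ℝ), IsStableLaw α 1 β ν →
      ∀ (Ω : Type*) [MeasurableSpace Ω] (P : Measure Ω) [IsProbabilityMeasure P]
        (X : ℕ → Ω → ℝ) (ε : ℝ → ℝ),
        iIndepFun X P →
        (∀ i, IdentDistrib (X i) (X 0) P P) →
        InNormalAttraction α β A ε (P.map (X 0)) →
        (∀ x : ℝ, x ≠ 0 → |ε x| ≤ K / |x| ^ γ) →
        -- both laws have a finite first moment, as the distance presupposes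
        Integrable (X 0) P ∧ Integrable (fun x : ℝ => x) ν ∧
        ∀ n : ℕ, 1 ≤ n →
          (2 - α < γ →
            wassersteinDist (P.map (normalizedSum P X α A n)) ν ≤
              ENNReal.ofReal (c * (n : ℝ) ^ (1 - 2 / α))) ∧
          (γ = 2 - α → 2 ≤ n →
            wassersteinDist (P.map (normalizedSum P X α A n)) ν ≤
              ENNReal.ofReal (c * ((n : ℝ) ^ (1 - 2 / α) * Real.log n))) ∧
          (0 < γ → γ < 2 - α →
            wassersteinDist (P.map (normalizedSum P X α A n)) ν ≤
              ENNReal.ofReal (c * (n : ℝ) ^ (-((α - 1) * γ / (α * (1 - γ)))))) ∧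
          (γ = 0 →
            wassersteinDist (P.map (normalizedSum P X α A n)) ν ≤
              ENNReal.ofReal (c *
                ((n : ℝ) ^ (1 - 2 / α) *
                    (∫ x in (-(stableScale α A * (n : ℝ) ^ (1 / α)))..
                        (stableScale α A * (n : ℝ) ^ (1 / α)), |ε x| / |x| ^ (α - 1)) +
                  (⨆ x : {x : ℝ // stableScale α A * (n : ℝ) ^ (1 / α) ≤ |x|}, |ε x|)
                    ^ (α - 1)))) := by
  have h2γ : 0 < 2 - α := by linarith
  obtain ⟨C, hC, H⟩ := exists_wassersteinDist_normalizedSum_le hα1 hα2 hβ hγ hA hK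
  -- The constant may depend on `γ`, so the regime is fixed before the constant is chosen; the
  -- clauses of the other regimes are then vacuous.
  rcases lt_trichotomy γ (2 - α) with hlt | heq | hgt
  · rcases hγ.eq_or_lt with h0 | hpos
    · obtain ⟨c, hc, hr⟩ := InNormalAttraction.exists_rate_of_bounded hα1 hα2 hβ hA hK
      refine ⟨C * c, mul_pos hC hc, fun ν hν Ω _ P _ X ε hind hid hμ hε => ?_⟩
      obtain ⟨hX, hνi, hμp, hW⟩ := H ν hν Ω P X ε hind hid hμ hε
      refine ⟨hX, hνi, fun n hn => ⟨fun h => by linarith, fun h => by linarith,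
        fun h => by linarith, fun _ => ?_⟩⟩
      rw [mul_assoc]
      refine hW n _ hn (hr ε _ hμp hμ (fun x hx => ?_) n hn)
      simpa [← h0] using hε x hx
    · obtain ⟨c, hc, hr⟩ := InNormalAttraction.exists_rate_of_lt hα1 hα2 hβ hA hK hpos hlt
      refine ⟨C * c, mul_pos hC hc, fun ν hν Ω _ P _ X ε hind hid hμ hε => ?_⟩
      obtain ⟨hX, hνi, hμp, hW⟩ := H ν hν Ω P X ε hind hid hμ hε
      refine ⟨hX, hνi, fun n hn => ⟨fun h => by linarith, fun h => by linarith,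
        fun _ _ => ?_, fun h => by linarith⟩⟩
      rw [mul_assoc]
      exact hW n _ hn (hr ε _ hμp hμ hε n hn)
  · obtain ⟨c, hc, hr⟩ := InNormalAttraction.exists_rate_of_eq hα1 hα2 hβ hA hK heq
    refine ⟨C * c, mul_pos hC hc, fun ν hν Ω _ P _ X ε hind hid hμ hε => ?_⟩
    obtain ⟨hX, hνi, hμp, hW⟩ := H ν hν Ω P X ε hind hid hμ hε
    refine ⟨hX, hνi, fun n hn => ⟨fun h => by linarith, fun _ hn2 => ?_,
      fun _ h => by linarith, fun h => by linarith⟩⟩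
    rw [mul_assoc]
    exact hW n _ hn (hr ε _ hμp hμ hε n hn2)
  · obtain ⟨c, hc, hr⟩ := InNormalAttraction.exists_rate_of_gt hα1 hα2 hβ hA hK hgt
    refine ⟨C * c, mul_pos hC hc, fun ν hν Ω _ P _ X ε hind hid hμ hε => ?_⟩
    obtain ⟨hX, hνi, hμp, hW⟩ := H ν hν Ω P X ε hind hid hμ hε
    refine ⟨hX, hνi, fun n hn => ⟨fun _ => ?_, fun h => by linarith,
      fun _ h => by linarith, fun h => by linarith⟩⟩
    rw [mul_assoc]
    exact hW n _ hn (hr ε _ hμp hμ hε n hn)
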